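/- Definitions. A causal triangulation (CT) of height $h\ge 2$ is a finite connected map $G$ on the sphere (a planar graph with a fixed embedding, loops and multiple edges allowed) with a central vertex $S_0$ and a marked edge emerging from $S_0$ (the root edge), considered up to orientation preserving isomorphism, such that, writing $S_k(G)$ for the subgraph spanned by the vertices at graph distance $k$ ("height" $k$) from $S_0$: (i) the maximal height of a vertex is $h$; (ii) there is no loop at $S_0$, and for $0<k<h$ the subgraph $S_k(G)$ is a cycle (cycles of length one, a loop, and of length two, a double edge, are allowed); (iii) all faces are triangles except one, the exterior face, whose boundary is a simple closed curve along which the heights $h$ and $h-1$ alternate; (iv) every vertex at height $h$ has degree two and is contained in exactly one triangle. Let $\mathcal C^{(h)}$ be the set of these CTs, let $|S_k(G)|$ be the length of the cycle $S_k(G)$ and let $\Delta(G)$ be the number of triangles of $G$. The disk and annulus partition functions are $$W_M(g,z;h)=\sum_{G\in\mathcal C^{(h)}}|S_{h-1}(G)|\,(z/g)^{|S_{h-1}(G)|}g^{\Delta(G)},$$ $$W_{MM}(g,x,y;h)=\sum_{G\in\mathcal C^{(h)}}(x/g)^{|S_1(G)|}\,|S_{h-1}(G)|\,(y/g)^{|S_{h-1}(G)|}g^{\Delta(G)}.$$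 (1) Let $h\ge2$ be an integer, let $g,x,y,z$ be complex numbers with $0<|g|<\tfrac12$ and $|x|,|y|,|z|<1$, and let $\theta\in\mathbb C$ satisfy $g^{-1}=2\cosh\theta$. Then both series converge absolutely, the denominators below do not vanish, and $$W_M(g,z;h)=2\cosh\theta\,\frac{z\sinh^2\theta}{\bigl(\sinh h\theta-z\sinh (h-1)\theta\bigr)^2},$$ $$W_{MM}(g,x,y;h)=\frac{xy\sinh^2\theta}{\bigl(\sinh (h-1)\theta-(x+y)\sinh (h-2)\theta+xy\sinh(h-3)\theta\bigr)^2}.$$ (2) Let $\Lambda,H,X,Y>0$. In the scaling limit, i.e. when $\theta\to0^+$ and the integer $h$ varies so that $h\theta\to H\sqrt\Lambda$ (so $h\sim H\theta^{-1}\sqrt\Lambda$), with $g=\tfrac12\operatorname{sech}\theta$, $x=1-X\theta/\sqrt\Lambda$ and $y=1-Y\theta/\sqrt\Lambda$, $$W_M^s(\Lambda,Y,H):=\lim W_M(g,y;h)=\frac{2\Lambda}{\bigl(\sqrt\Lambda\cosh H\sqrt\Lambda+Y\sinh H\sqrt\Lambda\bigr)^2},$$ $$\lim\,\theta^2\,W_{MM}(g,x,y;h)=\frac{\Lambda^2}{\bigl((\Lambda+XY)\sinh\sqrt\Lambda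 H+\sqrt\Lambda(X+Y)\cosh\sqrt\Lambda H\bigr)^2},$$ or equivalently $$W_{MM}^s(\Lambda,X,Y,H):=\lim\,\frac{\theta^2}{\Lambda}\,W_{MM}(g,x,y;h)=\frac{\Lambda}{\bigl((\Lambda+XY)\sinh\sqrt\Lambda H+\sqrt\Lambda(X+Y)\cosh\sqrt\Lambda H\bigr)^2}.$$ (3) Let $\Lambda,H,Y>0$ and define the average area by $\langle\Delta\rangle_\theta=g\frac{\partial}{\partial g}\log W_M(g,y;h)$, the derivative being taken at fixed $y$ and $h$ and evaluated at $g=\tfrac12\operatorname{sech}\theta$, $y=1-Y\theta/\sqrt\Lambda$. Then, in the same scaling limit, the scaling Hausdorff dimension is $$d_H=\lim\frac{\log\langle\Delta\rangle_\theta}{\log h}=2.$$ -/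

import Mathlib

open Filter Topology

/-- A finite rooted combinatorial map on an oriented closed surface, loops and multiple edges
allowed.  Darts are oriented edges; `rot` turns a dart to the next dart around its initial vertex,
`flip` reverses a dart.  Vertices, edges and faces are the cycles of `rot`, `flip` and
`rot * flip`.  The map is rooted at the dart `root`: its initial vertex is the central vertex and
its edge is the marked root edge. -/
structure RootedMap where
  numDarts : ℕ
  rot : Equiv.Perm (Fin numDarts)
  flip : Equiv.Perm (Fin numDarts)
  flip_flip : ∀ d, flip (flip d) = d
  flip_ne : ∀ d, flip d ≠ d
  root : Fin numDarts

namespace RootedMap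

abbrev Dart (M : RootedMap) : Type := Fin M.numDarts

/-- From a dart `d` to the next dart along the face on a fixed side of `d`; it starts at the
terminal vertex of `d`. -/
def faceStep (M : RootedMap) : Equiv.Perm M.Dart := M.rot * M.flip

def Vertex (M : RootedMap) : Type := Quotient (Equiv.Perm.SameCycle.setoid M.rot)

def Edge (M : RootedMap) : Type := Quotient (Equiv.Perm.SameCycle.setoid M.flip)

def Face (M : RootedMap) : Type := Quotient (Equiv.Perm.SameCycle.setoid M.faceStep)

/-- The initial vertex of a dart. -/
def vert (M : RootedMap) (d : M.Dart) : M.Vertex :=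
  Quotient.mk (Equiv.Perm.SameCycle.setoid M.rot) d

/-- The terminal vertex of a dart. -/
def target (M : RootedMap) (d : M.Dart) : M.Vertex := M.vert (M.flip d)

/-- The face containing the corner at the initial vertex of `d` that `d` represents. -/
def face (M : RootedMap) (d : M.Dart) : M.Face :=
  Quotient.mk (Equiv.Perm.SameCycle.setoid M.faceStep) d

/-- The central vertex `S₀`. -/
def center (M : RootedMap) : M.Vertex := M.vert M.root

noncomputable def vertexDegree (M : RootedMap) (v : M.Vertex) : ℕ := Nat.card {d // M.vert d = v}

noncomputable def faceDegree (M : RootedMap) (f : M.Face) : ℕ := Nat.card {d // M.face d = f}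

/-- The adjacency graph of the vertices. -/
def graph (M : RootedMap) : SimpleGraph M.Vertex where
  Adj u v := u ≠ v ∧ ∃ d, M.vert d = u ∧ M.target d = v
  symm := ⟨fun u v h => ⟨h.1.symm, by
    obtain ⟨-, d, rfl, rfl⟩ := h
    exact ⟨M.flip d, rfl, by simp [target, M.flip_flip]⟩⟩⟩
  loopless := ⟨fun _ h => h.1 rfl⟩

/-- The height of a vertex: its graph distance from the central vertex. -/
noncomputable def height (M : RootedMap) (v : M.Vertex) : ℕ := M.graph.dist M.center v

/-- The number of vertices of `S_k`; when `S_k` is a cycle this is also its number of edges. -/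
noncomputable def layerSize (M : RootedMap) (k : ℕ) : ℕ := Nat.card {v // M.height v = k}

/-- The number of triangles. -/
noncomputable def area (M : RootedMap) : ℕ := Nat.card {f // M.faceDegree f = 3}

/-- `M` is a causal triangulation of the disk of height `h`. -/
structure IsCausal (M : RootedMap) (h : ℕ) : Prop where
  connected : M.graph.Connected
  /-- The surface is the sphere. -/
  planar : Nat.card M.Vertex + Nat.card M.Face = Nat.card M.Edge + 2
  height_le : ∀ v, M.height v ≤ h
  height_attained : ∃ v, M.height v = h
  /-- There is no loop at the central vertex. -/
  center_loopless : ∀ d, M.vert d = M.center → M.target d ≠ M.center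
  /-- For `0 < k < h` the subgraph spanned by `S_k` is a cycle, i.e. it is connected and
  2-regular.  Cycles of length one (a loop) and two (a double edge) are allowed. -/
  cycle_connected : ∀ k, 0 < k → k < h → (M.graph.induce {v | M.height v = k}).Connected
  cycle_regular : ∀ v, 0 < M.height v → M.height v < h →
    Nat.card {d // M.vert d = v ∧ M.height (M.target d) = M.height v} = 2
  /-- All faces except one, the exterior face, are triangles.  The exterior face is bounded by a
  simple closed curve along which the heights `h` and `h - 1` alternate, and every vertex at height
  `h` has degree two and lies in exactly one triangle. -/
  exterior : ∃ f : M.Face,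
    (∀ f', f' ≠ f → M.faceDegree f' = 3) ∧
    (∀ d d', M.face d = f → M.face d' = f → M.vert d = M.vert d' → d = d') ∧
    (∀ d, M.face d = f →
      (M.height (M.vert d) = h ∧ M.height (M.target d) + 1 = h) ∨
      (M.height (M.vert d) + 1 = h ∧ M.height (M.target d) = h)) ∧
    (∀ v, M.height v = h →
      M.vertexDegree v = 2 ∧ Nat.card {d // M.vert d = v ∧ M.face d ≠ f} = 1)

/-- An orientation preserving isomorphism of rooted maps. -/
structure Iso (M N : RootedMap) where
  toEquiv : M.Dart ≃ N.Dart
  map_rot : ∀ d, toEquiv (M.rot d) = N.rot (toEquiv d)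
  map_flip : ∀ d, toEquiv (M.flip d) = N.flip (toEquiv d)
  map_root : toEquiv M.root = N.root

namespace Iso

def refl (M : RootedMap) : Iso M M := ⟨Equiv.refl _, fun _ => rfl, fun _ => rfl, rfl⟩

def symm {M N : RootedMap} (e : Iso M N) : Iso N M where
  toEquiv := e.toEquiv.symm
  map_rot d := by rw [Equiv.symm_apply_eq, e.map_rot, Equiv.apply_symm_apply]
  map_flip d := by rw [Equiv.symm_apply_eq, e.map_flip, Equiv.apply_symm_apply]
  map_root := by rw [Equiv.symm_apply_eq, e.map_root]

def trans {M N P : RootedMap} (e : Iso M N) (e' : Iso N P) : Iso M P where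
  toEquiv := e.toEquiv.trans e'.toEquiv
  map_rot d := by simp [e.map_rot, e'.map_rot]
  map_flip d := by simp [e.map_flip, e'.map_flip]
  map_root := by simp [e.map_root, e'.map_root]

theorem sameCycle_iff {α β : Type*} (e : α ≃ β) (p : Equiv.Perm α) (q : Equiv.Perm β)
    (H : ∀ d, e (p d) = q (e d)) (a b : α) : p.SameCycle a b ↔ q.SameCycle (e a) (e b) := by
  have hq : q = (e.symm.trans p).trans e := by
    ext x
    simp [H]
  have hz : ∀ (i : ℤ) (x : α), e ((p ^ i) x) = (q ^ i) (e x) := by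
    intro i x
    have : q = e.permCongr p := by rw [hq]; rfl
    have h2 : q ^ i = e.permCongr (p ^ i) := by
      rw [this]
      exact (map_zpow e.permCongrHom p i).symm
    rw [h2]
    simp [Equiv.permCongr_apply]
  constructor
  · rintro ⟨i, hi⟩
    exact ⟨i, by rw [← hz, hi]⟩
  · rintro ⟨i, hi⟩
    exact ⟨i, e.injective (by rw [hz, hi])⟩

theorem map_faceStep {M N : RootedMap} (e : Iso M N) (d : M.Dart) :
    e.toEquiv (M.faceStep d) = N.faceStep (e.toEquiv d) := by
  simp [faceStep, e.map_rot, e.map_flip]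

def vertexEquiv {M N : RootedMap} (e : Iso M N) : M.Vertex ≃ N.Vertex :=
  Quotient.congr e.toEquiv (sameCycle_iff e.toEquiv M.rot N.rot e.map_rot)

def faceEquiv {M N : RootedMap} (e : Iso M N) : M.Face ≃ N.Face :=
  Quotient.congr e.toEquiv (sameCycle_iff e.toEquiv M.faceStep N.faceStep e.map_faceStep)

theorem vertexEquiv_vert {M N : RootedMap} (e : Iso M N) (d : M.Dart) :
    e.vertexEquiv (M.vert d) = N.vert (e.toEquiv d) := rfl

theorem faceEquiv_face {M N : RootedMap} (e : Iso M N) (d : M.Dart) :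
    e.faceEquiv (M.face d) = N.face (e.toEquiv d) := rfl

theorem vertexEquiv_target {M N : RootedMap} (e : Iso M N) (d : M.Dart) :
    e.vertexEquiv (M.target d) = N.target (e.toEquiv d) := by
  rw [target, vertexEquiv_vert, e.map_flip, target]

theorem vertexEquiv_center {M N : RootedMap} (e : Iso M N) :
    e.vertexEquiv M.center = N.center := by
  rw [center, vertexEquiv_vert, e.map_root, center]

def graphHom {M N : RootedMap} (e : Iso M N) : M.graph →g N.graph where
  toFun := e.vertexEquiv
  map_rel' := by
    rintro u v ⟨hne, d, rfl, rfl⟩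
    exact ⟨fun h => hne (e.vertexEquiv.injective h), e.toEquiv d,
      (e.vertexEquiv_vert d).symm, (e.vertexEquiv_target d).symm⟩

theorem edist_le_edist {V W : Type*} {G : SimpleGraph V} {H : SimpleGraph W} (f : G →g H)
    (u v : V) : H.edist (f u) (f v) ≤ G.edist u v :=
  le_iInf fun w => (SimpleGraph.edist_le (w.map f)).trans (by simp)

theorem height_eq {M N : RootedMap} (e : Iso M N) (v : M.Vertex) :
    N.height (e.vertexEquiv v) = M.height v := by
  have h1 : N.graph.edist N.center (e.vertexEquiv v) ≤ M.graph.edist M.center v := by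
    have := edist_le_edist e.graphHom M.center v
    rwa [show e.graphHom M.center = N.center from e.vertexEquiv_center] at this
  have h2 : M.graph.edist M.center v ≤ N.graph.edist N.center (e.vertexEquiv v) := by
    have := edist_le_edist e.symm.graphHom N.center (e.vertexEquiv v)
    rw [show e.symm.graphHom N.center = M.center from e.symm.vertexEquiv_center] at this
    have h3 : e.symm.graphHom (e.vertexEquiv v) = v := e.vertexEquiv.symm_apply_apply v
    rwa [h3] at this
  rw [height, height, SimpleGraph.dist, SimpleGraph.dist, le_antisymm h1 h2]

theorem layerSize_eq {M N : RootedMap} (e : Iso M N) (k : ℕ) : M.layerSize k = N.layerSize k :=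
  Nat.card_congr (e.vertexEquiv.subtypeEquiv fun v => by rw [e.height_eq])

theorem faceDegree_eq {M N : RootedMap} (e : Iso M N) (f : M.Face) :
    N.faceDegree (e.faceEquiv f) = M.faceDegree f :=
  (Nat.card_congr (e.toEquiv.subtypeEquiv fun d => by
    rw [← e.faceEquiv_face, e.faceEquiv.apply_eq_iff_eq])).symm

theorem area_eq {M N : RootedMap} (e : Iso M N) : M.area = N.area :=
  Nat.card_congr (e.faceEquiv.subtypeEquiv fun f => by rw [e.faceDegree_eq])

end Iso

end RootedMap

/-- Isomorphism of causal triangulations of height `h`. -/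
def causalSetoid (h : ℕ) : Setoid {M : RootedMap // M.IsCausal h} where
  r M N := Nonempty (RootedMap.Iso M.1 N.1)
  iseqv :=
    ⟨fun M => ⟨RootedMap.Iso.refl M.1⟩, fun ⟨e⟩ => ⟨e.symm⟩, fun ⟨e⟩ ⟨e'⟩ => ⟨e.trans e'⟩⟩

/-- The set of causal triangulations of the disk of height `h` with a marked root edge, up to
orientation preserving isomorphism. -/
def CausalTriangulation (h : ℕ) : Type := Quotient (causalSetoid h)

namespace CausalTriangulation

noncomputable def layerSize {h : ℕ} (G : CausalTriangulation h) (k : ℕ) : ℕ :=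
  Quotient.lift (fun M : {M : RootedMap // M.IsCausal h} => M.1.layerSize k)
    (fun _ _ he => Nonempty.elim he fun e => e.layerSize_eq k) G

noncomputable def area {h : ℕ} (G : CausalTriangulation h) : ℕ :=
  Quotient.lift (fun M : {M : RootedMap // M.IsCausal h} => M.1.area)
    (fun _ _ he => Nonempty.elim he fun e => e.area_eq) G

end CausalTriangulation

/-- The contribution of `G` to the disk partition function. -/
noncomputable def diskWeight {𝕜 : Type*} [RCLike 𝕜] (g z : 𝕜) {h : ℕ}
    (G : CausalTriangulation h) : 𝕜 :=
  (G.layerSize (h - 1) : 𝕜) * (z / g) ^ G.layerSize (h - 1) * g ^ G.area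

/-- The disk partition function `W_M(g, z; h)`. -/
noncomputable def diskPartition {𝕜 : Type*} [RCLike 𝕜] (g z : 𝕜) (h : ℕ) : 𝕜 :=
  ∑' G : CausalTriangulation h, diskWeight g z G

/-- The contribution of `G` to the annulus partition function. -/
noncomputable def annulusWeight {𝕜 : Type*} [RCLike 𝕜] (g x y : 𝕜) {h : ℕ}
    (G : CausalTriangulation h) : 𝕜 :=
  (x / g) ^ G.layerSize 1 * (G.layerSize (h - 1) : 𝕜) * (y / g) ^ G.layerSize (h - 1) * g ^ G.area

/-- The annulus partition function `W_MM(g, x, y; h)`. -/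
noncomputable def annulusPartition {𝕜 : Type*} [RCLike 𝕜] (g x y : 𝕜) (h : ℕ) : 𝕜 :=
  ∑' G : CausalTriangulation h, annulusWeight g x y G

/-- The average area in the disk ensemble, defined as `g ∂/∂g log W_M(g, y; h)`: the boundary
triangles carry the weight `y`, which is kept fixed. -/
noncomputable def averageArea (g y : ℝ) (h : ℕ) : ℝ :=
  g * deriv (fun g' : ℝ => Real.log (diskPartition g' y h)) g

/-- The scaling limit `θ → 0⁺`, `θ h → H √Λ`, for pairs `(θ, h)` of a positive real number and an
integer height. -/
noncomputable def scalingLimit (Λ H : ℝ) : Filter (ℝ × ℕ) :=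
  comap Prod.fst (𝓝[>] 0) ⊓ comap (fun p : ℝ × ℕ => p.1 * p.2) (𝓝 (H * √Λ))

/-- The scaling limit is not vacuous: `θ = H √Λ / h` with `h → ∞` is an instance of it. -/
theorem scalingLimit_neBot {Λ H : ℝ} (hΛ : 0 < Λ) (hH : 0 < H) : (scalingLimit Λ H).NeBot := by
  have hpos : 0 < H * √Λ := mul_pos hH (Real.sqrt_pos.2 hΛ)
  have h0 : Tendsto (fun n : ℕ => H * √Λ / n) atTop (𝓝[>] 0) := by
    refine tendsto_nhdsWithin_iff.2 ⟨tendsto_const_div_atTop_nhds_zero_nat _, ?_⟩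
    filter_upwards [eventually_gt_atTop 0] with n hn
    have : (0 : ℝ) < n := by exact_mod_cast hn
    exact div_pos hpos this
  have h1 : Tendsto (fun n : ℕ => (H * √Λ / n) * (n : ℝ)) atTop (𝓝 (H * √Λ)) := by
    refine tendsto_const_nhds.congr' ?_
    filter_upwards [eventually_gt_atTop 0] with n hn
    have : (n : ℝ) ≠ 0 := by exact_mod_cast hn.ne'
    field_simp
  have h2 : Tendsto (fun n : ℕ => ((H * √Λ / n, n) : ℝ × ℕ)) atTop (scalingLimit Λ H) :=
    tendsto_inf.2 ⟨tendsto_comap_iff.2 h0, tendsto_comap_iff.2 h1⟩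
  exact h2.neBot

/-! A causal triangulation of height `n + 2` is a stack of annular bands and is equivalent to a
plane forest whose layer `k`, for `0 ≤ k ≤ n`, is the cycle `S_{k+1}`. Summed over forests, the
weights form an iterated geometric series, that is, a finite continued fraction, and this is
evaluated by a linear recurrence solved by hyperbolic sines.

The bands come from Euler's relation. Counting darts by vertices and by faces turns it into the
statement that there are as many horizontal darts (both ends at the same height) as triangles. By
parity every triangle has at least one horizontal side, so planarity says that it has exactly one
(`planar_iff`, `card_isHor_add_one_eq_iff`); the area is then `2 ∑ |S_k|`. Around an inner vertex
the two horizontal darts separate the ascending darts from the descending ones, and every horizontal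
edge has one triangle above and one below (`apexUp_flip_iff`). Hence each cycle is oriented, and the
`m` ascending darts at a vertex below the top cycle enclose `m - 1` triangles based on edges of the
next cycle: these edges are the children.

The root edge fixes where the numbering of each layer starts. Conversely `LayerData.toMap` glues a
map from a forest and `isBanded_toMap` checks the axioms. A map is recovered from its forest by
`IsBanded.nonempty_iso`, and a forest from its map by `LayerData.deg_eq_of_iso`. Together these give
`codeEquiv`.

Each vertex of the forest carries `g ^ 2`, so one layer of the sum is the substitution `t ↦ g ^ 2 /
(1 - t)`. It preserves the disc `‖t‖ < 1 / 2` when `‖g‖ < 1 / 2`, whence absolute convergence.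
Writing `1 - t_n = g D_{n+1} / D_n` linearises it to `D_{n+2} = g⁻¹ D_{n+1} - D_n`; for `g⁻¹ = 2
cosh θ` the solution is `D_n = sinh (n+1)θ - y sinh nθ`.

For the scaling limits the denominators are expanded by the addition formulas. The chain rule in `θ`
gives the average area; `θ²` times it tends to a positive constant, and so does `θ h`, so the ratio
of logarithms tends to 2. -/

/-! ### Cycles of permutations, counting, graph distance -/

theorem Equiv.Perm.SameCycle.mem_of_closed {α : Type*} [Finite α] {p : Equiv.Perm α} {a b : α}
    (hab : p.SameCycle a b) {S : α → Prop} (ha : S a) (hS : ∀ x, S x → S (p x)) : S b := by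
  -- On a finite type nonnegative powers exhaust a cycle, so closure under `p` alone suffices.
  obtain ⟨i, rfl⟩ := hab.exists_nat_pow_eq
  clear hab
  induction i with
  | zero => simpa
  | succ i ih => rw [pow_succ', Equiv.Perm.mul_apply]; exact hS _ ih

theorem Equiv.Perm.pow_card_sameCycle {α : Type*} [Finite α] (p : Equiv.Perm α) (a : α) :
    (p ^ Nat.card {b // p.SameCycle b a}) a = a := by
  have e : {b // p.SameCycle b a} ≃ MulAction.orbit (Subgroup.zpowers p) a :=
    Equiv.subtypeEquivRight fun b => by
      rw [Equiv.Perm.sameCycle_comm]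
      constructor
      · rintro ⟨i, hi⟩
        exact ⟨⟨p ^ i, i, rfl⟩, hi⟩
      · rintro ⟨⟨_, i, rfl⟩, hi⟩
        exact ⟨i, hi⟩
  have : Fintype (MulAction.orbit (Subgroup.zpowers p) a) := Fintype.ofFinite _
  rw [Nat.card_congr e, Nat.card_eq_fintype_card, ← MulAction.minimalPeriod_eq_card]
  have := Function.iterate_minimalPeriod (f := fun x => p • x) (x := a)
  rwa [smul_iterate] at this

theorem Nat.card_eq_sum_fiber {α β : Type*} [Finite α] [Fintype β] (q : α → β) :
    Nat.card α = ∑ b, Nat.card {a // q a = b} := by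
  rw [Nat.card_congr (Equiv.sigmaFiberEquiv q).symm, Nat.card_sigma]

theorem Nat.card_subtype_add_card_subtype_not {α : Type*} [Finite α] (P : α → Prop) :
    Nat.card {a // P a} + Nat.card {a // ¬ P a} = Nat.card α := by
  classical
  rw [← Nat.card_sum, Nat.card_congr (Equiv.sumCompl P)]

theorem SimpleGraph.Connected.exists_adj_dist_add_one {V : Type*} {G : SimpleGraph V}
    (hc : G.Connected) {u v : V} (h : 0 < G.dist u v) :
    ∃ w, G.Adj v w ∧ G.dist u w + 1 = G.dist u v := by
  obtain ⟨p, hp⟩ := (hc.preconnected v u).exists_walk_length_eq_dist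
  rw [SimpleGraph.dist_comm] at hp
  match p with
  | .nil => simp at h
  | .cons (v := w) hadj p =>
    refine ⟨w, hadj, ?_⟩
    have h1 : G.dist u w ≤ p.length := by
      rw [SimpleGraph.dist_comm]; exact SimpleGraph.dist_le p
    have h2 := hc.dist_triangle (u := u) (v := w) (w := v)
    rw [SimpleGraph.dist_eq_one_iff_adj.2 hadj.symm] at h2
    rw [SimpleGraph.Walk.length_cons] at hp
    omega

/-! ### Darts and heights in a rooted map -/

namespace RootedMap

variable {M : RootedMap}

instance : Finite M.Vertex := inferInstanceAs (Finite (Quotient _))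
instance : Finite M.Edge := inferInstanceAs (Finite (Quotient _))
instance : Finite M.Face := inferInstanceAs (Finite (Quotient _))

theorem faceStep_apply (d : M.Dart) : M.faceStep d = M.rot (M.flip d) := rfl

theorem faceStep_flip (d : M.Dart) : M.faceStep (M.flip d) = M.rot d := by
  rw [faceStep_apply, M.flip_flip]

theorem vert_eq_iff {d d' : M.Dart} : M.vert d = M.vert d' ↔ M.rot.SameCycle d d' :=
  Quotient.eq (r := Equiv.Perm.SameCycle.setoid M.rot)

theorem face_eq_iff {d d' : M.Dart} : M.face d = M.face d' ↔ M.faceStep.SameCycle d d' :=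
  Quotient.eq (r := Equiv.Perm.SameCycle.setoid M.faceStep)

theorem exists_vert_eq (v : M.Vertex) : ∃ d, M.vert d = v := Quotient.exists_rep v

theorem exists_face_eq (f : M.Face) : ∃ d, M.face d = f := Quotient.exists_rep f

@[simp] theorem vert_rot (d : M.Dart) : M.vert (M.rot d) = M.vert d :=
  vert_eq_iff.2 (Equiv.Perm.sameCycle_apply_left.2 (Equiv.Perm.SameCycle.refl _ _))

@[simp] theorem vert_rot_pow (d : M.Dart) (i : ℕ) : M.vert ((M.rot ^ i) d) = M.vert d :=
  vert_eq_iff.2 (Equiv.Perm.sameCycle_pow_left.2 (Equiv.Perm.SameCycle.refl _ _))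

@[simp] theorem face_faceStep (d : M.Dart) : M.face (M.faceStep d) = M.face d :=
  face_eq_iff.2 (Equiv.Perm.sameCycle_apply_left.2 (Equiv.Perm.SameCycle.refl _ _))

theorem vert_faceStep (d : M.Dart) : M.vert (M.faceStep d) = M.target d := vert_rot _

theorem target_flip (d : M.Dart) : M.target (M.flip d) = M.vert d := by
  rw [target, M.flip_flip]

/-- The height of the initial vertex of a dart. -/
noncomputable def lev (M : RootedMap) (d : M.Dart) : ℕ := M.height (M.vert d)

@[simp] theorem lev_rot (d : M.Dart) : M.lev (M.rot d) = M.lev d := by rw [lev, vert_rot, lev]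

@[simp] theorem lev_rot_pow (d : M.Dart) (i : ℕ) : M.lev ((M.rot ^ i) d) = M.lev d := by
  rw [lev, vert_rot_pow, lev]

theorem lev_faceStep (d : M.Dart) : M.lev (M.faceStep d) = M.lev (M.flip d) := lev_rot _

theorem height_target (d : M.Dart) : M.height (M.target d) = M.lev (M.flip d) := rfl

theorem lev_root : M.lev M.root = 0 := SimpleGraph.dist_self

/-- A dart is horizontal if both ends have the same height. -/
def IsHor (M : RootedMap) (d : M.Dart) : Prop := M.lev (M.flip d) = M.lev d

theorem IsHor.flip {d : M.Dart} (hd : M.IsHor d) : M.IsHor (M.flip d) := by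
  rw [IsHor, M.flip_flip]; exact hd.symm

theorem lev_flip_le (hc : M.graph.Connected) (d : M.Dart) : M.lev (M.flip d) ≤ M.lev d + 1 := by
  by_cases hd : M.vert d = M.target d
  · exact (congrArg M.height hd).symm.le.trans (Nat.le_succ _)
  · have : M.graph.Adj (M.vert d) (M.target d) := ⟨hd, d, rfl, rfl⟩
    have h1 := hc.dist_triangle (u := M.center) (v := M.vert d) (w := M.target d)
    rwa [SimpleGraph.dist_eq_one_iff_adj.2 this] at h1

theorem le_lev_flip (hc : M.graph.Connected) (d : M.Dart) : M.lev d ≤ M.lev (M.flip d) + 1 := by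
  simpa [M.flip_flip] using lev_flip_le hc (M.flip d)

theorem exists_lev_flip_add_one (hc : M.graph.Connected) {v : M.Vertex} (hv : 0 < M.height v) :
    ∃ d, M.vert d = v ∧ M.lev (M.flip d) + 1 = M.height v := by
  obtain ⟨w, hadj, hw⟩ := hc.exists_adj_dist_add_one hv
  obtain ⟨-, d, rfl, rfl⟩ := hadj
  exact ⟨d, rfl, hw⟩

theorem vert_eq_center_of_lev (hc : M.graph.Connected) {d : M.Dart} (hd : M.lev d = 0) :
    M.vert d = M.center :=
  ((hc.dist_eq_zero_iff).1 hd).symm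

/-- The edge of a dart. -/
def edge (M : RootedMap) (d : M.Dart) : M.Edge :=
  Quotient.mk (Equiv.Perm.SameCycle.setoid M.flip) d

theorem edge_eq_iff {d d' : M.Dart} : M.edge d = M.edge d' ↔ M.flip.SameCycle d d' :=
  Quotient.eq (r := Equiv.Perm.SameCycle.setoid M.flip)

theorem two_mul_card_edge (M : RootedMap) : 2 * Nat.card M.Edge = M.numDarts := by
  classical
  let _ : Fintype M.Edge := Fintype.ofFinite _
  have h1 := Nat.card_eq_sum_fiber M.edge
  rw [Nat.card_eq_fintype_card, Fintype.card_fin] at h1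
  rw [h1, Finset.sum_congr rfl (g := fun _ => 2), Finset.sum_const, Finset.card_univ,
    Nat.card_eq_fintype_card, smul_eq_mul, mul_comm]
  intro e _
  obtain ⟨d, rfl⟩ : ∃ d, M.edge d = e := Quotient.exists_rep e
  have : ∀ x, M.edge x = M.edge d ↔ x ∈ ({d, M.flip d} : Finset M.Dart) := by
    intro x
    rw [edge_eq_iff]
    constructor
    · intro hx
      refine Equiv.Perm.SameCycle.mem_of_closed (S := fun x => x ∈ ({d, M.flip d} : Finset M.Dart))
        (hx.symm) (by simp) ?_
      intro y hy
      simp only [Finset.mem_insert, Finset.mem_singleton] at hy ⊢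
      rcases hy with rfl | rfl
      · exact Or.inr rfl
      · exact Or.inl (M.flip_flip _)
    · intro hx
      simp only [Finset.mem_insert, Finset.mem_singleton] at hx
      rcases hx with rfl | rfl
      · exact Equiv.Perm.SameCycle.refl _ _
      · exact Equiv.Perm.sameCycle_apply_left.2 (Equiv.Perm.SameCycle.refl _ _)
  rw [Nat.card_congr (Equiv.subtypeEquivRight this), Nat.card_eq_fintype_card, Fintype.card_coe,
    Finset.card_pair (M.flip_ne d).symm]

/-! ### Euler's relation and horizontal sides of triangles -/

/-- The axioms of a causal triangulation other than planarity, for a given exterior face. -/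
structure IsLayered (M : RootedMap) (h : ℕ) (f : M.Face) : Prop where
  connected : M.graph.Connected
  height_le : ∀ d, M.lev d ≤ h
  height_attained : ∃ d, M.lev d = h
  center_loopless : ∀ d, M.vert d = M.center → M.target d ≠ M.center
  cycle_connected : ∀ k, 0 < k → k < h → (M.graph.induce {v | M.height v = k}).Connected
  cycle_regular : ∀ v, 0 < M.height v → M.height v < h →
    Nat.card {d // M.vert d = v ∧ M.height (M.target d) = M.height v} = 2
  triangle : ∀ f', f' ≠ f → M.faceDegree f' = 3
  exterior_simple : ∀ d d', M.face d = f → M.face d' = f → M.vert d = M.vert d' → d = d'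
  exterior_alternates : ∀ d, M.face d = f →
      (M.lev d = h ∧ M.lev (M.flip d) + 1 = h) ∨ (M.lev d + 1 = h ∧ M.lev (M.flip d) = h)
  top_vertex : ∀ v, M.height v = h →
      M.vertexDegree v = 2 ∧ Nat.card {d // M.vert d = v ∧ M.face d ≠ f} = 1

theorem isCausal_iff {h : ℕ} : M.IsCausal h ↔ (∃ f, M.IsLayered h f) ∧
    Nat.card M.Vertex + Nat.card M.Face = Nat.card M.Edge + 2 := by
  constructor
  · intro hM
    obtain ⟨f, h1, h2, h3, h4⟩ := hM.exterior
    obtain ⟨v, hv⟩ := hM.height_attained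
    obtain ⟨d, rfl⟩ := exists_vert_eq v
    exact ⟨⟨f, hM.connected, fun d => hM.height_le _, ⟨d, hv⟩, hM.center_loopless,
      hM.cycle_connected, hM.cycle_regular, h1, h2, h3, h4⟩, hM.planar⟩
  · rintro ⟨⟨f, hM⟩, hp⟩
    obtain ⟨d, hd⟩ := hM.height_attained
    refine ⟨hM.connected, hp, fun v => ?_, ⟨_, hd⟩, hM.center_loopless, hM.cycle_connected,
      hM.cycle_regular, f, hM.triangle, hM.exterior_simple, hM.exterior_alternates, hM.top_vertex⟩
    obtain ⟨d, rfl⟩ := exists_vert_eq v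
    exact hM.height_le d

namespace IsLayered

variable {h : ℕ} {f : M.Face}

theorem faceStep_three (hM : M.IsLayered h f) {d : M.Dart} (hd : M.face d ≠ f) :
    M.faceStep (M.faceStep (M.faceStep d)) = d := by
  have h1 := Equiv.Perm.pow_card_sameCycle M.faceStep d
  have h2 := hM.triangle _ hd
  rw [faceDegree, Nat.card_congr (Equiv.subtypeEquivRight fun x => face_eq_iff)] at h2
  rw [h2] at h1
  simpa [pow_succ] using h1

theorem rot_rot_of_top (hM : M.IsLayered h f) {d : M.Dart} (hd : M.lev d = h) :
    M.rot (M.rot d) = d := by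
  have h1 := Equiv.Perm.pow_card_sameCycle M.rot d
  have h2 := (hM.top_vertex _ hd).1
  rw [vertexDegree, Nat.card_congr (Equiv.subtypeEquivRight fun x => vert_eq_iff)] at h2
  rw [h2] at h1
  simpa [pow_succ] using h1

/-- A vertex of maximal height has exactly one dart along the exterior face. -/
theorem exists_exterior (hM : M.IsLayered h f) {v : M.Vertex} (hv : M.height v = h) :
    ∃ d, M.vert d = v ∧ M.face d = f := by
  by_contra! hcon
  have h1 := hM.top_vertex v hv
  rw [vertexDegree] at h1
  have : Nat.card {d // M.vert d = v ∧ M.face d ≠ f} = Nat.card {d // M.vert d = v} :=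
    Nat.card_congr (Equiv.subtypeEquivRight fun d => ⟨fun hd => hd.1, fun hd => ⟨hd, hcon d hd⟩⟩)
  omega

/-- Every dart at a vertex of maximal height goes down. -/
theorem lev_flip_of_top (hM : M.IsLayered h f) {d : M.Dart} (hd : M.lev d = h) :
    M.lev (M.flip d) + 1 = h := by
  obtain ⟨e, he, hef⟩ := hM.exists_exterior hd
  have hle : M.lev e = h := (congrArg M.height he).trans hd
  have hrr := hM.rot_rot_of_top hle
  have hS : d = e ∨ d = M.rot e := by
    refine (vert_eq_iff.1 he).mem_of_closed (S := fun d => d = e ∨ d = M.rot e) (Or.inl rfl) ?_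
    rintro x (rfl | rfl)
    · exact Or.inr rfl
    · exact Or.inl hrr
  rcases hS with rfl | rfl
  · rcases hM.exterior_alternates d hef with h1 | h1
    · exact h1.2
    · omega
  -- The second dart at the vertex is the reverse of the exterior dart that arrives there just
  -- before `e`.
  · have hx : M.faceStep (M.flip (M.rot e)) = e := by rw [faceStep_flip, hrr]
    have hxf : M.face (M.flip (M.rot e)) = f := by rw [← face_faceStep, hx, hef]
    rcases hM.exterior_alternates _ hxf with h1 | h1 <;> rw [M.flip_flip, lev_rot] at h1
    · omega
    · exact h1.1

theorem lev_flip_center (hM : M.IsLayered h f) {d : M.Dart} (hd : M.lev d = 0) :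
    M.lev (M.flip d) = 1 := by
  have h1 := hM.center_loopless d (vert_eq_center_of_lev hM.connected hd)
  have h2 := lev_flip_le hM.connected d
  have h3 : M.lev (M.flip d) ≠ 0 := fun h0 => h1 (vert_eq_center_of_lev hM.connected h0)
  omega

theorem not_isHor_exterior (hM : M.IsLayered h f) {d : M.Dart} (hd : M.face d = f) :
    ¬ M.IsHor d := by
  rw [IsHor]
  rcases hM.exterior_alternates d hd with h1 | h1 <;> omega

theorem lev_pos_of_isHor (hM : M.IsLayered h f) {d : M.Dart} (hd : M.IsHor d) : 0 < M.lev d := by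
  by_contra h0
  have := hM.lev_flip_center (d := d) (by omega)
  rw [IsHor] at hd
  omega

theorem lev_lt_of_isHor (hM : M.IsLayered h f) {d : M.Dart} (hd : M.IsHor d) : M.lev d < h := by
  refine lt_of_le_of_ne (hM.height_le d) fun h0 => ?_
  have := hM.lev_flip_of_top h0
  rw [IsHor] at hd
  omega

/-- Along the exterior face upper and lower vertices alternate, so half of its darts start at height
`h`. These correspond to the top vertices, since the boundary is simple and passes through each of
them. -/
theorem faceDegree_exterior (hM : M.IsLayered h f) :
    M.faceDegree f = 2 * Nat.card {v : M.Vertex // M.height v = h} := by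
  have h1 := Nat.card_subtype_add_card_subtype_not
    (fun d : {d : M.Dart // M.face d = f} => M.lev d.1 = h)
  rw [faceDegree, ← h1]
  have e1 : Nat.card {d : {d : M.Dart // M.face d = f} // M.lev d.1 = h} =
      Nat.card {v : M.Vertex // M.height v = h} := by
    refine Nat.card_eq_of_bijective (fun d => ⟨M.vert d.1.1, d.2⟩) ⟨?_, ?_⟩
    · intro d d' hdd
      exact Subtype.ext (Subtype.ext
        (hM.exterior_simple _ _ d.1.2 d'.1.2 (congrArg Subtype.val hdd)))
    · rintro ⟨v, hv⟩
      obtain ⟨d, rfl, hd⟩ := hM.exists_exterior hv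
      exact ⟨⟨⟨d, hd⟩, hv⟩, rfl⟩
  have e2 : Nat.card {d : {d : M.Dart // M.face d = f} // ¬ M.lev d.1 = h} =
      Nat.card {d : {d : M.Dart // M.face d = f} // M.lev d.1 = h} := by
    refine Nat.card_eq_of_bijective (fun d => ⟨⟨M.faceStep d.1.1, ?_⟩, ?_⟩) ⟨?_, ?_⟩
    · rw [face_faceStep, d.1.2]
    · have := hM.exterior_alternates _ d.1.2
      have h2 := d.2
      change M.lev (M.faceStep _) = h
      rw [lev_faceStep]
      omega
    · intro d d' hdd
      exact Subtype.ext (Subtype.ext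
        (M.faceStep.injective (congrArg (fun x => x.1.1) hdd)))
    · rintro ⟨⟨d, hd⟩, hdh⟩
      have hd' : M.face (M.faceStep.symm d) = f := by
        rw [← face_faceStep, Equiv.apply_symm_apply, hd]
      refine ⟨⟨⟨M.faceStep.symm d, hd'⟩, ?_⟩, ?_⟩
      · have := hM.exterior_alternates _ hd'
        have h3 : M.lev (M.flip (M.faceStep.symm d)) = h := by
          rw [← lev_faceStep, Equiv.apply_symm_apply]; exact hdh
        change ¬ M.lev (M.faceStep.symm d) = h
        omega
      · exact Subtype.ext (Subtype.ext (M.faceStep.apply_symm_apply d))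
  omega

theorem numDarts_add_three (hM : M.IsLayered h f) :
    M.numDarts + 3 = 3 * Nat.card M.Face + M.faceDegree f := by
  classical
  let _ : Fintype M.Face := Fintype.ofFinite _
  have h1 := Nat.card_eq_sum_fiber M.face
  rw [Nat.card_eq_fintype_card, Fintype.card_fin,
    ← Finset.add_sum_erase _ _ (Finset.mem_univ f),
    Finset.sum_congr rfl (g := fun _ => 3)
      (fun f' hf' => show Nat.card {a // M.face a = f'} = 3 from hM.triangle f' (Finset.ne_of_mem_erase hf')),
    Finset.sum_const, Finset.card_erase_of_mem (Finset.mem_univ f), Finset.card_univ,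
    ← Nat.card_eq_fintype_card] at h1
  have h2 : 0 < Nat.card M.Face := Nat.card_pos_iff.2 ⟨⟨f⟩, inferInstance⟩
  simp only [smul_eq_mul] at h1
  change M.numDarts = M.faceDegree f + _ at h1
  omega

theorem card_isHor (hM : M.IsLayered h f) :
    Nat.card {d // M.IsHor d} =
      2 * Nat.card {v : M.Vertex // 0 < M.height v ∧ M.height v < h} := by
  classical
  let _ : Fintype {v : M.Vertex // 0 < M.height v ∧ M.height v < h} := Fintype.ofFinite _
  have hV : ∀ d, M.IsHor d → 0 < M.height (M.vert d) ∧ M.height (M.vert d) < h := fun d hd =>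
    ⟨lev_pos_of_isHor hM hd, lev_lt_of_isHor hM hd⟩
  rw [Nat.card_eq_sum_fiber (fun d : {d // M.IsHor d} =>
    (⟨M.vert d.1, hV d.1 d.2⟩ : {v : M.Vertex // 0 < M.height v ∧ M.height v < h})),
    Finset.sum_congr rfl (g := fun _ => 2), Finset.sum_const, Finset.card_univ,
    ← Nat.card_eq_fintype_card, smul_eq_mul, mul_comm]
  rintro ⟨v, hv⟩ -
  rw [← hM.cycle_regular v hv.1 hv.2]
  refine Nat.card_congr ⟨fun d => ⟨d.1.1, congrArg Subtype.val d.2, ?_⟩,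
    fun d => ⟨⟨d.1, ?_⟩, Subtype.ext d.2.1⟩, fun d => rfl, fun d => rfl⟩
  · have h1 : M.height (M.target d.1.1) = M.height (M.vert d.1.1) := d.1.2
    have h2 : M.vert d.1.1 = v := congrArg Subtype.val d.2
    rw [h1, h2]
  · have := d.2
    rw [IsHor, lev, lev, this.1]
    exact this.2

theorem card_vertex (hM : M.IsLayered h f) (hh : 0 < h) :
    Nat.card M.Vertex = 1 + Nat.card {v : M.Vertex // 0 < M.height v ∧ M.height v < h} +
      Nat.card {v : M.Vertex // M.height v = h} := by
  have hle : ∀ v : M.Vertex, M.height v ≤ h := fun v => by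
    obtain ⟨d, rfl⟩ := exists_vert_eq v
    exact hM.height_le d
  rw [← Nat.card_subtype_add_card_subtype_not (fun v : M.Vertex => M.height v = h),
    ← Nat.card_subtype_add_card_subtype_not
      (fun v : {v : M.Vertex // ¬ M.height v = h} => M.height v.1 = 0)]
  have e1 : Nat.card {v : {v : M.Vertex // ¬ M.height v = h} // M.height v.1 = 0} = 1 := by
    have h0 : M.height M.center = 0 := SimpleGraph.dist_self
    rw [Nat.card_eq_one_iff_unique]
    refine ⟨⟨fun a b => ?_⟩, ⟨⟨⟨M.center, by omega⟩, h0⟩⟩⟩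
    have key : ∀ v : M.Vertex, M.height v = 0 → v = M.center := fun v hv =>
      ((hM.connected.dist_eq_zero_iff).1 hv).symm
    exact Subtype.ext (Subtype.ext ((key _ a.2).trans (key _ b.2).symm))
  have e2 : Nat.card {v : {v : M.Vertex // ¬ M.height v = h} // ¬ M.height v.1 = 0} =
      Nat.card {v : M.Vertex // 0 < M.height v ∧ M.height v < h} :=
    Nat.card_congr ⟨fun v => ⟨v.1.1, Nat.pos_of_ne_zero v.2, lt_of_le_of_ne (hle _) v.1.2⟩,
      fun v => ⟨⟨v.1, v.2.2.ne⟩, v.2.1.ne'⟩, fun v => rfl, fun v => rfl⟩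
  omega

/-- Euler's relation in terms of horizontal darts. -/
theorem planar_iff (hM : M.IsLayered h f) (hh : 0 < h) :
    Nat.card M.Vertex + Nat.card M.Face = Nat.card M.Edge + 2 ↔
      Nat.card {d // M.IsHor d} + 1 = Nat.card M.Face := by
  -- With `m` inner and `t` top vertices, `V = 1 + m + t` and `2 E = 3 (F - 1) + 2 t`. In Euler's
  -- relation `t` cancels and `2 m + 1 = F` remains, where `2 m` is the number of horizontal darts.
  have h1 := hM.card_vertex hh
  have h2 := hM.card_isHor
  have h3 := hM.numDarts_add_three
  have h4 := hM.faceDegree_exterior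
  have h5 := M.two_mul_card_edge
  omega

theorem area_add_one (hM : M.IsLayered h f) : M.area + 1 = Nat.card M.Face := by
  have h1 := Nat.card_subtype_add_card_subtype_not (fun f' : M.Face => M.faceDegree f' = 3)
  have h2 : Nat.card {f' : M.Face // ¬ M.faceDegree f' = 3} = 1 := by
    rw [Nat.card_eq_one_iff_unique]
    have key : ∀ f' : M.Face, ¬ M.faceDegree f' = 3 → f' = f := fun f' hf' => by
      by_contra hne
      exact hf' (hM.triangle f' hne)
    refine ⟨⟨fun a b => Subtype.ext ((key _ a.2).trans (key _ b.2).symm)⟩, ⟨⟨f, ?_⟩⟩⟩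
    -- The exterior degree is even, so the exterior face is not counted as a triangle.
    rw [hM.faceDegree_exterior]
    omega
  rw [area]
  omega

theorem card_isHor_eq_sum (hM : M.IsLayered h f) :
    Nat.card {d // M.IsHor d} = ∑ k ∈ Finset.Ioo 0 h, 2 * M.layerSize k := by
  classical
  rw [hM.card_isHor, ← Finset.mul_sum]
  congr 1
  rw [Nat.card_eq_sum_fiber
    (fun v : {v : M.Vertex // 0 < M.height v ∧ M.height v < h} =>
      (⟨M.height v.1, Finset.mem_Ioo.2 v.2⟩ : Finset.Ioo 0 h)),
    ← Finset.sum_coe_sort (Finset.Ioo 0 h)]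
  refine Finset.sum_congr rfl ?_
  rintro ⟨k, hk⟩ -
  exact Nat.card_congr ⟨fun v => ⟨v.1.1, congrArg Subtype.val v.2⟩,
    fun v => ⟨⟨v.1, by rw [v.2]; exact Finset.mem_Ioo.1 hk⟩, Subtype.ext v.2⟩,
    fun v => rfl, fun v => rfl⟩

/-- Along every triangle the height changes an even number of times. -/
theorem isHor_or_isHor_or_isHor (hM : M.IsLayered h f) {d : M.Dart} (hd : M.face d ≠ f) :
    M.IsHor d ∨ M.IsHor (M.faceStep d) ∨ M.IsHor (M.faceStep (M.faceStep d)) := by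
  have h1 := lev_flip_le hM.connected d
  have h2 := le_lev_flip hM.connected d
  have h3 := lev_flip_le hM.connected (M.faceStep d)
  have h4 := le_lev_flip hM.connected (M.faceStep d)
  have h5 := lev_flip_le hM.connected (M.faceStep (M.faceStep d))
  have h6 := le_lev_flip hM.connected (M.faceStep (M.faceStep d))
  have h7 := hM.faceStep_three hd
  simp only [IsHor, ← lev_faceStep, h7] at *
  omega

/-- Euler's relation holds if and only if every triangle has exactly one horizontal side. -/
theorem card_isHor_add_one_eq_iff (hM : M.IsLayered h f) :
    Nat.card {d // M.IsHor d} + 1 = Nat.card M.Face ↔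
      ∀ f', f' ≠ f → Nat.card {d // M.face d = f' ∧ M.IsHor d} = 1 := by
  classical
  let _ : Fintype M.Face := Fintype.ofFinite _
  have h1 : Nat.card {d // M.IsHor d} = ∑ f' : M.Face, Nat.card {d // M.face d = f' ∧ M.IsHor d} := by
    rw [Nat.card_eq_sum_fiber (fun d : {d // M.IsHor d} => M.face d.1)]
    refine Finset.sum_congr rfl fun f' _ => Nat.card_congr ?_
    exact ⟨fun d => ⟨d.1.1, d.2, d.1.2⟩, fun d => ⟨⟨d.1, d.2.2⟩, d.2.1⟩, fun _ => rfl, fun _ => rfl⟩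
  have h0 : Nat.card {d // M.face d = f ∧ M.IsHor d} = 0 := by
    rw [Nat.card_eq_zero]
    exact Or.inl ⟨fun d => hM.not_isHor_exterior d.2.1 d.2.2⟩
  have hpos : ∀ f' ∈ Finset.univ.erase f, 1 ≤ Nat.card {d // M.face d = f' ∧ M.IsHor d} := by
    intro f' hf'
    obtain ⟨d, rfl⟩ := exists_face_eq f'
    refine Nat.card_pos_iff.2 ⟨?_, inferInstance⟩
    rcases hM.isHor_or_isHor_or_isHor (Finset.ne_of_mem_erase hf') with hd | hd | hd
    · exact ⟨⟨d, rfl, hd⟩⟩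
    · exact ⟨⟨_, face_faceStep d, hd⟩⟩
    · exact ⟨⟨_, by simp, hd⟩⟩
  have h2 : ∑ f' ∈ Finset.univ.erase f, 1 + 1 = Nat.card M.Face := by
    have h3 : 0 < Nat.card M.Face := Nat.card_pos_iff.2 ⟨⟨f⟩, inferInstance⟩
    rw [Nat.card_eq_fintype_card] at *
    rw [Finset.sum_const, Finset.card_erase_of_mem (Finset.mem_univ f), Finset.card_univ,
      smul_eq_mul, mul_one, Nat.sub_add_cancel h3]
  -- A sum of terms that are at least 1 equals the number of terms only if every term is 1.
  rw [h1, ← Finset.add_sum_erase _ _ (Finset.mem_univ f), h0, zero_add, ← h2, add_left_inj, eq_comm,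
    Finset.sum_eq_sum_iff_of_le hpos]
  simp [eq_comm]

end IsLayered

/-- A causal triangulation of height at least two with a given exterior face, planarity being
replaced by the condition that every triangle has exactly one horizontal side. -/
structure IsBanded (M : RootedMap) (h : ℕ) (f : M.Face) : Prop extends M.IsLayered h f where
  two_le : 2 ≤ h
  card_isHor_face : ∀ f', f' ≠ f → Nat.card {d // M.face d = f' ∧ M.IsHor d} = 1

theorem isCausal_iff_isBanded {h : ℕ} (hh : 2 ≤ h) : M.IsCausal h ↔ ∃ f, M.IsBanded h f := by
  rw [isCausal_iff]
  constructor
  · rintro ⟨⟨f, hM⟩, hp⟩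
    exact ⟨f, hM, hh, hM.card_isHor_add_one_eq_iff.1 ((hM.planar_iff (by omega)).1 hp)⟩
  · rintro ⟨f, hM⟩
    exact ⟨⟨f, hM.1⟩, (hM.planar_iff (by omega)).2
      (hM.card_isHor_add_one_eq_iff.2 hM.card_isHor_face)⟩

/-- Triangles correspond to horizontal darts, and every inner vertex carries two of these. This
turns `g ^ area` into a factor `g ^ 2` per inner vertex. -/
theorem IsBanded.area_eq {h : ℕ} {f : M.Face} (hM : M.IsBanded h f) :
    M.area = ∑ k ∈ Finset.Ioo 0 h, 2 * M.layerSize k := by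
  have h1 := hM.area_add_one
  have h2 := hM.card_isHor_add_one_eq_iff.2 hM.card_isHor_face
  have h3 := hM.card_isHor_eq_sum
  omega

end RootedMap

/-! ### The band structure around inner vertices -/

namespace RootedMap

variable {M : RootedMap}

/-- A dart is ascending if its terminal vertex is one step higher than its initial vertex. -/
def IsUp (M : RootedMap) (d : M.Dart) : Prop := M.lev (M.flip d) = M.lev d + 1

def IsDown (M : RootedMap) (d : M.Dart) : Prop := M.lev (M.flip d) + 1 = M.lev d

/-- The third vertex of the triangle along a horizontal dart lies above the dart. -/
def ApexUp (M : RootedMap) (d : M.Dart) : Prop :=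
  M.lev (M.faceStep (M.faceStep d)) = M.lev d + 1

/-- A horizontal dart with the next level on the side of its face. -/
def IsFwd (M : RootedMap) (d : M.Dart) : Prop := M.IsHor d ∧ M.ApexUp d

/-- A horizontal dart with the previous level on the side of its face. -/
def IsBack (M : RootedMap) (d : M.Dart) : Prop := M.IsHor d ∧ ¬ M.ApexUp d

theorem IsUp.not_isHor {d : M.Dart} (hd : M.IsUp d) : ¬ M.IsHor d := by
  rw [IsUp] at hd; rw [IsHor]; omega

theorem IsDown.not_isHor {d : M.Dart} (hd : M.IsDown d) : ¬ M.IsHor d := by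
  rw [IsDown] at hd; rw [IsHor]; omega

theorem IsUp.not_isDown {d : M.Dart} (hd : M.IsUp d) : ¬ M.IsDown d := by
  rw [IsUp] at hd; rw [IsDown]; omega

namespace IsBanded

variable {h : ℕ} {f : M.Face}

section
variable (hM : M.IsBanded h f)
include hM

theorem isUp_or (d : M.Dart) : M.IsUp d ∨ M.IsHor d ∨ M.IsDown d := by
  have h1 := lev_flip_le hM.connected d
  have h2 := le_lev_flip hM.connected d
  simp only [IsUp, IsHor, IsDown]
  omega

theorem face_ne_of_isHor {d : M.Dart} (hd : M.IsHor d) : M.face d ≠ f := fun hf =>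
  hM.not_isHor_exterior hf hd

theorem face_ne_of_lev {d : M.Dart} (hd : M.lev d + 1 < h ∨ M.lev (M.flip d) + 1 < h) :
    M.face d ≠ f := fun hf => by
  have := hM.exterior_alternates d hf
  omega

theorem faceStep_ne {d : M.Dart} (hd : M.face d ≠ f) : M.faceStep d ≠ d := by
  intro hfix
  have h3 := hM.triangle _ hd
  rw [faceDegree, Nat.card_congr (Equiv.subtypeEquivRight fun x => face_eq_iff)] at h3
  have : Subsingleton {x // M.faceStep.SameCycle x d} := ⟨fun a b => by
    have key : ∀ x, M.faceStep.SameCycle x d → x = d := fun x hx =>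
      hx.symm.mem_of_closed (S := fun x => x = d) rfl (by rintro _ rfl; exact hfix)
    exact Subtype.ext ((key _ a.2).trans (key _ b.2).symm)⟩
  have := Finite.card_le_one_iff_subsingleton.2 this
  omega

theorem eq_of_isHor_face {d e : M.Dart} (hd : M.IsHor d) (he : M.IsHor e)
    (hde : M.face d = M.face e) : d = e := by
  have h1 := (Nat.card_eq_one_iff_unique.1 (hM.card_isHor_face _ (hM.face_ne_of_isHor hd))).1
  exact congrArg Subtype.val
    (h1.elim ⟨d, rfl, hd⟩ ⟨e, hde.symm, he⟩)

theorem not_isHor_faceStep {d : M.Dart} (hd : M.IsHor d) : ¬ M.IsHor (M.faceStep d) := fun h1 =>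
  hM.faceStep_ne (hM.face_ne_of_isHor hd) (hM.eq_of_isHor_face h1 hd (by simp))

omit hM in
theorem lev_faceStep_of_isHor {d : M.Dart} (hd : M.IsHor d) :
    M.lev (M.faceStep d) = M.lev d := by
  rw [lev_faceStep]; exact hd

theorem apex_of_isHor {d : M.Dart} (hd : M.IsHor d) :
    M.lev (M.faceStep (M.faceStep d)) = M.lev d + 1 ∨
      M.lev (M.faceStep (M.faceStep d)) + 1 = M.lev d := by
  have h1 := hM.not_isHor_faceStep hd
  have h2 := hM.isUp_or (M.faceStep d)
  have h3 := lev_faceStep_of_isHor hd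
  rw [lev_faceStep (M.faceStep d)]
  simp only [IsUp, IsHor, IsDown] at *
  omega

/-- The dart preceding `e` along its triangle starts at the apex, so it shows on which side the apex
lies. -/
theorem apexUp_of_faceStep {d e : M.Dart} (he : M.IsHor e) (hde : M.faceStep d = e) :
    M.ApexUp e ↔ M.IsUp (M.flip d) := by
  have hf : M.face d ≠ f := by
    rw [← face_faceStep, hde]; exact hM.face_ne_of_isHor he
  have h3 := hM.faceStep_three hf
  rw [hde] at h3
  have h4 : M.lev (M.flip d) = M.lev e := by rw [← hde, lev_faceStep]
  rw [ApexUp, h3, IsUp, M.flip_flip, h4]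

/-- The corner between `d` and `M.rot d` belongs to the face of `M.flip d`. If `M.rot d` descended,
a triangle there would join heights that differ by two; on the exterior face the alternation of
heights excludes a descent. -/
theorem isUp_rot {d : M.Dart} (hd : M.IsUp d) :
    M.IsUp (M.rot d) ∨ M.IsFwd (M.rot d) := by
  have hstep := faceStep_flip d
  have hle := lev_flip_le hM.connected (M.rot d)
  have hlr := lev_rot d
  rcases hM.isUp_or (M.rot d) with h1 | h1 | h1
  · exact Or.inl h1
  · refine Or.inr ⟨h1, (hM.apexUp_of_faceStep h1 hstep).2 ?_⟩
    rwa [M.flip_flip]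
  · exfalso
    by_cases hf : M.face (M.flip d) = f
    · have h2 := hM.exterior_alternates _ hf
      have h3 : M.face (M.rot d) = f := by rw [← hstep, face_faceStep, hf]
      have h4 := hM.exterior_alternates _ h3
      rw [M.flip_flip] at h2
      simp only [IsUp, IsDown] at *
      omega
    · have h2 := hM.faceStep_three hf
      rw [hstep] at h2
      have h5 := le_lev_flip hM.connected (M.faceStep (M.rot d))
      have h6 := lev_flip_le hM.connected (M.faceStep (M.rot d))
      rw [← lev_faceStep, h2, lev_faceStep] at h5 h6
      simp only [IsUp, IsDown] at *
      omega

/-- Mirror image of `isUp_rot`. Below the top level the corner after a descending dart is never in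
the exterior face. -/
theorem isDown_rot {d : M.Dart} (hd : M.IsDown d) (hlt : M.lev d < h) :
    M.IsDown (M.rot d) ∨ M.IsBack (M.rot d) := by
  have hstep := faceStep_flip d
  have hle := lev_flip_le hM.connected (M.rot d)
  have hlr := lev_rot d
  have hf : M.face (M.flip d) ≠ f := hM.face_ne_of_lev (by rw [IsDown] at hd; omega)
  rcases hM.isUp_or (M.rot d) with h1 | h1 | h1
  · exfalso
    have h2 := hM.faceStep_three hf
    rw [hstep] at h2
    have h5 := le_lev_flip hM.connected (M.faceStep (M.rot d))
    have h6 := lev_flip_le hM.connected (M.faceStep (M.rot d))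
    rw [← lev_faceStep, h2, lev_faceStep] at h5 h6
    simp only [IsUp, IsDown] at *
    omega
  · refine Or.inr ⟨h1, fun h2 => ?_⟩
    have h3 := (hM.apexUp_of_faceStep h1 hstep).1 h2
    rw [M.flip_flip] at h3
    exact h3.not_isDown hd
  · exact Or.inl h1

omit hM in
theorem isUp_rot_of_isHor {d : M.Dart} (hd : M.IsHor d) (ha : M.ApexUp (M.flip d)) :
    M.IsUp (M.rot d) := by
  have h2 : M.lev (M.flip d) = M.lev d := hd
  rw [ApexUp, faceStep_flip, lev_faceStep, h2] at ha
  rw [IsUp, ha, lev_rot]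

theorem isDown_rot_of_isHor {d : M.Dart} (hd : M.IsHor d) (ha : ¬ M.ApexUp (M.flip d)) :
    M.IsDown (M.rot d) := by
  have h1 := (hM.apex_of_isHor hd.flip).resolve_left ha
  have h2 : M.lev (M.flip d) = M.lev d := hd
  rw [faceStep_flip, lev_faceStep, h2] at h1
  rw [IsDown, h1, lev_rot]

theorem exists_pair {v : M.Vertex} (h0 : 0 < M.height v) (h1 : M.height v < h) :
    ∃ a b, a ≠ b ∧ ∀ d, M.vert d = v ∧ M.IsHor d ↔ d = a ∨ d = b := by
  have h2 := hM.cycle_regular v h0 h1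
  have h3 : {d | M.vert d = v ∧ M.height (M.target d) = M.height v}.ncard = 2 := h2
  obtain ⟨a, b, hab, hS⟩ := Set.ncard_eq_two.1 h3
  refine ⟨a, b, hab, fun d => ?_⟩
  have h4 : d ∈ {d | M.vert d = v ∧ M.height (M.target d) = M.height v} ↔
    d ∈ ({a, b} : Set M.Dart) := by rw [hS]
  simp only [Set.mem_ofPred_eq, Set.mem_insert_iff, Set.mem_singleton_iff] at h4
  rw [← h4]
  constructor
  · rintro ⟨rfl, h5⟩
    exact ⟨rfl, h5⟩
  · rintro ⟨rfl, h5⟩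
    exact ⟨rfl, h5⟩

/-- At a vertex there are at most two horizontal darts. -/
theorem eq_or_eq_of_isHor {a b c : M.Dart} (ha : M.IsHor a) (hb : M.IsHor b) (hc : M.IsHor c)
    (hab : M.vert a = M.vert b) (hac : M.vert a = M.vert c) (hne : a ≠ b) : c = a ∨ c = b := by
  obtain ⟨x, y, -, hS⟩ := hM.exists_pair (v := M.vert a)
    (hM.lev_pos_of_isHor ha) (hM.lev_lt_of_isHor ha)
  have h1 := (hS a).1 ⟨rfl, ha⟩
  have h2 := (hS b).1 ⟨hab.symm, hb⟩
  have h3 := (hS c).1 ⟨hac.symm, hc⟩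
  grind

theorem exists_isHor {v : M.Vertex} (h0 : 0 < M.height v) (h1 : M.height v < h) :
    ∃ d, M.vert d = v ∧ M.IsHor d := by
  obtain ⟨x, y, -, hS⟩ := hM.exists_pair h0 h1
  exact ⟨x, (hS x).2 (Or.inl rfl)⟩

theorem exists_ne_isHor {d : M.Dart} (hd : M.IsHor d) :
    ∃ e, M.vert e = M.vert d ∧ M.IsHor e ∧ e ≠ d := by
  obtain ⟨x, y, hxy, hS⟩ := hM.exists_pair (v := M.vert d)
    (hM.lev_pos_of_isHor hd) (hM.lev_lt_of_isHor hd)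
  by_cases hx : x = d
  · exact ⟨y, ((hS y).2 (Or.inr rfl)).1, ((hS y).2 (Or.inr rfl)).2, fun hy => hxy (hx.trans hy.symm)⟩
  · exact ⟨x, ((hS x).2 (Or.inl rfl)).1, ((hS x).2 (Or.inl rfl)).2, hx⟩

/-- The sector between two horizontal darts at a vertex lies entirely above or entirely below. -/
theorem apexUp_iff_of_ne {d e : M.Dart} (hd : M.IsHor d) (he : M.IsHor e)
    (hv : M.vert d = M.vert e) (hne : d ≠ e) : M.ApexUp e ↔ M.ApexUp (M.flip d) := by
  have hex : ∃ s, (M.rot ^ s) d = e := (vert_eq_iff.1 hv).exists_nat_pow_eq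
  classical
  -- The first time the rotation from `d` meets `e`. No horizontal dart occurs in between, because
  -- the vertex carries only two, so the sector keeps one direction throughout.
  obtain ⟨s, hs, hmin⟩ : ∃ s, (M.rot ^ s) d = e ∧ ∀ j < s, (M.rot ^ j) d ≠ e :=
    ⟨Nat.find hex, Nat.find_spec hex, fun j hj => Nat.find_min hex hj⟩
  have hnh : ∀ j, 0 < j → j < s → ¬ M.IsHor ((M.rot ^ j) d) := by
    intro j hj hjs hhor
    rcases hM.eq_or_eq_of_isHor hd he hhor hv (by simp) hne with h1 | h1
    · refine hmin (s - j) (by omega) ?_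
      have h2 : (M.rot ^ (s - j)) ((M.rot ^ j) d) = e := by
        rw [← Equiv.Perm.mul_apply, ← pow_add, Nat.sub_add_cancel hjs.le, hs]
      rwa [h1] at h2
    · exact hmin j hjs h1
  have hs0 : 0 < s := by
    rcases Nat.eq_zero_or_pos s with rfl | h1
    · exact absurd hs hne
    · exact h1
  have hlt := hM.lev_lt_of_isHor hd
  by_cases ha : M.ApexUp (M.flip d)
  · have key : ∀ j, j < s → M.IsUp ((M.rot ^ (j + 1)) d) ∨ M.IsFwd ((M.rot ^ (j + 1)) d) := by
      intro j
      induction j with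
      | zero => intro _; exact Or.inl (by simpa using isUp_rot_of_isHor hd ha)
      | succ j ih =>
        intro hj
        rw [pow_succ', Equiv.Perm.mul_apply]
        exact hM.isUp_rot ((ih (by omega)).resolve_right
          fun h1 => hnh (j + 1) (by omega) hj h1.1)
    have h1 := key (s - 1) (by omega)
    rw [Nat.sub_add_cancel hs0, hs] at h1
    exact iff_of_true (h1.resolve_left fun h2 => h2.not_isHor he).2 ha
  · have key : ∀ j, j < s →
        M.IsDown ((M.rot ^ (j + 1)) d) ∨ M.IsBack ((M.rot ^ (j + 1)) d) := by
      intro j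
      induction j with
      | zero => intro _; exact Or.inl (by simpa using hM.isDown_rot_of_isHor hd ha)
      | succ j ih =>
        intro hj
        rw [pow_succ' _ (j + 1), Equiv.Perm.mul_apply]
        exact hM.isDown_rot ((ih (by omega)).resolve_right
          fun h1 => hnh (j + 1) (by omega) hj h1.1) (by simpa using hlt)
    have h1 := key (s - 1) (by omega)
    rw [Nat.sub_add_cancel hs0, hs] at h1
    exact iff_of_false (h1.resolve_left fun h2 => h2.not_isHor he).2 ha

/-- By `apexUp_iff_of_ne` the side is handed on from one edge to the next across their common
vertex. An edge with both triangles on one side therefore forces the same for its neighbours, and by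
connectedness for the whole cycle; `apexUp_flip_iff` refutes this. -/
theorem apexUp_of_same_side {d : M.Dart} (hd : M.IsHor d)
    (hbad : M.ApexUp d ↔ M.ApexUp (M.flip d)) {e : M.Dart} (he : M.IsHor e)
    (hv : M.lev d = M.lev e) :
    (M.ApexUp e ↔ M.ApexUp d) ∧ (M.ApexUp (M.flip e) ↔ M.ApexUp d) := by
  have same : ∀ x y : M.Dart, M.IsHor x → M.IsHor y → M.vert x = M.vert y →
      (M.ApexUp x ↔ M.ApexUp d) ∧ (M.ApexUp (M.flip x) ↔ M.ApexUp d) →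
      (M.ApexUp y ↔ M.ApexUp d) ∧ (M.ApexUp (M.flip y) ↔ M.ApexUp d) := by
    intro x y hx hy hxy hb
    by_cases hne : x = y
    · rwa [← hne]
    · exact ⟨(hM.apexUp_iff_of_ne hx hy hxy hne).trans hb.2,
        (hM.apexUp_iff_of_ne hy hx hxy.symm (Ne.symm hne)).symm.trans hb.1⟩
  have hcon := hM.cycle_connected (M.lev d) (hM.lev_pos_of_isHor hd) (hM.lev_lt_of_isHor hd)
  have hreach := hcon.preconnected ⟨M.vert d, rfl⟩ ⟨M.vert e, hv.symm⟩
  rw [SimpleGraph.reachable_iff_reflTransGen] at hreach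
  suffices H : ∀ w : {v | M.height v = M.lev d}, Relation.ReflTransGen
      (M.graph.induce {v | M.height v = M.lev d}).Adj ⟨M.vert d, rfl⟩ w →
      ∀ y, M.vert y = w.1 → M.IsHor y →
        (M.ApexUp y ↔ M.ApexUp d) ∧ (M.ApexUp (M.flip y) ↔ M.ApexUp d) from
    H _ hreach e rfl he
  intro w hw
  induction hw with
  | refl => exact fun y hy hyh => same d y hd hyh hy.symm ⟨Iff.rfl, hbad.symm⟩
  | @tail a b _ hadj ih =>
    obtain ⟨-, x, hx1, hx2⟩ := hadj
    have hx1' : M.lev x = M.lev d := (congrArg M.height hx1).trans a.2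
    have hx2' : M.lev (M.flip x) = M.lev d := (congrArg M.height hx2).trans b.2
    have hxh : M.IsHor x := hx2'.trans hx1'.symm
    have := ih x hx1 hxh
    intro y hy hyh
    exact same (M.flip x) y hxh.flip hyh (hx2.trans hy.symm)
      ⟨this.2, by rw [M.flip_flip]; exact this.1⟩

/-- Geodesics from a vertex of height `h` down to the centre cross every level. -/
theorem exists_isUp_of_lt {k : ℕ} (hk : k < h) : ∃ d, M.lev d = k ∧ M.IsUp d := by
  have key : ∀ j, j ≤ h → ∃ d, M.lev d = h - j := by
    intro j
    induction j with
    | zero => intro _; exact hM.height_attained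
    | succ j ih =>
      intro hj
      obtain ⟨d, hd⟩ := ih (by omega)
      obtain ⟨e, he, he'⟩ := exists_lev_flip_add_one hM.connected (v := M.vert d)
        (show 0 < M.lev d by omega)
      change M.lev (M.flip e) + 1 = M.lev d at he'
      exact ⟨M.flip e, by omega⟩
  obtain ⟨d, hd⟩ := key (h - (k + 1)) (by omega)
  obtain ⟨e, he, he'⟩ := exists_lev_flip_add_one hM.connected (v := M.vert d)
    (show 0 < M.lev d by omega)
  change M.lev (M.flip e) + 1 = M.lev d at he'
  have h2 : M.lev e = M.lev d := congrArg M.height he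
  refine ⟨M.flip e, by omega, ?_⟩
  rw [IsUp, M.flip_flip]
  omega

/-- The two sides of a horizontal edge lie in different bands. -/
theorem apexUp_flip_iff {d : M.Dart} (hd : M.IsHor d) :
    M.ApexUp (M.flip d) ↔ ¬ M.ApexUp d := by
  by_contra hcon
  have hbad : M.ApexUp d ↔ M.ApexUp (M.flip d) := by tauto
  have hall : ∀ e, M.IsHor e → M.lev e = M.lev d →
    (M.ApexUp e ↔ M.ApexUp d) ∧ (M.ApexUp (M.flip e) ↔ M.ApexUp d) := fun e he hv =>
    hM.apexUp_of_same_side hd hbad he hv.symm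
  have h0 := hM.lev_pos_of_isHor hd
  have hlt := hM.lev_lt_of_isHor hd
  by_cases ha : M.ApexUp d
  -- If all triangles along the cycle lie above it, no dart at the vertex descends; but a geodesic
  -- to the centre starts with such a dart.
  · obtain ⟨x, hx, hx'⟩ := exists_lev_flip_add_one hM.connected (v := M.vert d) h0
    have hxd : M.lev x = M.lev d := congrArg M.height hx
    have h1 : M.lev x = M.lev d ∧ (M.IsUp x ∨ M.IsHor x) := by
      refine (vert_eq_iff.1 hx.symm).mem_of_closed
        (S := fun x => M.lev x = M.lev d ∧ (M.IsUp x ∨ M.IsHor x)) ⟨rfl, Or.inr hd⟩ ?_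
      rintro y ⟨hy, hy' | hy'⟩
      · exact ⟨by rwa [lev_rot], (hM.isUp_rot hy').imp_right And.left⟩
      · exact ⟨by rwa [lev_rot], Or.inl (isUp_rot_of_isHor hy' ((hall y hy' hy).2.2 ha))⟩
    have hdown : M.IsDown x := by
      rw [IsDown, hxd]; exact hx'
    rcases h1.2 with h2 | h2
    · exact h2.not_isDown hdown
    · exact hdown.not_isHor h2
  -- If all of them lie below, no dart leaves this level upwards, although level `h` is attained.
  · obtain ⟨x, hx, hxu⟩ := hM.exists_isUp_of_lt hlt
    obtain ⟨y, hy, hyh⟩ := hM.exists_isHor (v := M.vert x)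
      (show 0 < M.lev x by omega) (show M.lev x < h by omega)
    have hyl : M.lev y = M.lev d := (congrArg M.height hy).trans hx
    have h1 : M.lev x = M.lev d ∧ (M.IsDown x ∨ M.IsHor x) := by
      refine (vert_eq_iff.1 hy).mem_of_closed
        (S := fun x => M.lev x = M.lev d ∧ (M.IsDown x ∨ M.IsHor x)) ⟨hyl, Or.inr hyh⟩ ?_
      rintro z ⟨hz, hz' | hz'⟩
      · exact ⟨by rwa [lev_rot], (hM.isDown_rot hz' (by omega)).imp_right And.left⟩
      · exact ⟨by rwa [lev_rot], Or.inl (hM.isDown_rot_of_isHor hz'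
          fun h3 => ha ((hall z hz' hz).2.1 h3))⟩
    rcases h1.2 with h2 | h2
    · exact hxu.not_isDown h2
    · exact hxu.not_isHor h2

theorem isBack_flip {d : M.Dart} (hd : M.IsFwd d) : M.IsBack (M.flip d) :=
  ⟨hd.1.flip, fun h1 => (hM.apexUp_flip_iff hd.1).1 h1 hd.2⟩

theorem isFwd_flip {d : M.Dart} (hd : M.IsBack d) : M.IsFwd (M.flip d) :=
  ⟨hd.1.flip, (hM.apexUp_flip_iff hd.1).2 hd.2⟩

/-- Of the two horizontal darts at a vertex only one has the upper band on its face. Forward darts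
thus orient each cycle, with one leaving and one arriving at every vertex. -/
theorem eq_of_isFwd {d e : M.Dart} (hd : M.IsFwd d) (he : M.IsFwd e) (hv : M.vert d = M.vert e) :
    d = e := by
  by_contra hne
  exact (hM.apexUp_flip_iff hd.1).1 ((hM.apexUp_iff_of_ne hd.1 he.1 hv hne).1 he.2) hd.2

theorem eq_of_isBack {d e : M.Dart} (hd : M.IsBack d) (he : M.IsBack e)
    (hv : M.target d = M.target e) : d = e :=
  M.flip.injective (hM.eq_of_isFwd (hM.isFwd_flip hd) (hM.isFwd_flip he) hv)

theorem exists_isFwd {v : M.Vertex} (h0 : 0 < M.height v) (h1 : M.height v < h) :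
    ∃ d, M.vert d = v ∧ M.IsFwd d := by
  obtain ⟨d, rfl, hd⟩ := hM.exists_isHor h0 h1
  obtain ⟨e, he, heh, hne⟩ := hM.exists_ne_isHor hd
  by_cases ha : M.ApexUp d
  · exact ⟨d, rfl, hd, ha⟩
  · exact ⟨e, he, heh, (hM.apexUp_iff_of_ne hd heh he.symm hne.symm).2
      ((hM.apexUp_flip_iff hd).2 ha)⟩

theorem exists_isBack {v : M.Vertex} (h0 : 0 < M.height v) (h1 : M.height v < h) :
    ∃ d, M.target d = v ∧ M.IsBack d := by
  obtain ⟨d, rfl, hd⟩ := hM.exists_isFwd h0 h1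
  exact ⟨M.flip d, target_flip d, hM.isBack_flip hd⟩

end

end IsBanded

end RootedMap

/-! ### From a plane forest to a map: labels and face rules -/

/-- The sizes of the layers of a plane forest and the numbers of children of its vertices. The
vertices in the top layer are given one child each, which form one more layer. -/
structure LayerData (n : ℕ) where
  size : ℕ → ℕ
  deg : ℕ → ℕ → ℕ
  size_succ : ∀ k ≤ n, size (k + 1) = ∑ i ∈ Finset.range (size k), deg k i
  size_pos : ∀ k ≤ n, 0 < size k
  deg_top : ∀ i, deg n i = 1

namespace LayerData

variable {n : ℕ} (P : LayerData n)

/-- The number of children of the first `i` vertices of a layer. -/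
def offset (k i : ℕ) : ℕ := ∑ j ∈ Finset.range i, P.deg k j

/-- The parent of a vertex in layer `k + 1`. -/
noncomputable def parent (k w : ℕ) : ℕ := sInf {i | w < P.offset k (i + 1)}

/-- The cyclic successor in a layer. -/
def next (k i : ℕ) : ℕ := if i + 1 = P.size k then 0 else i + 1

/-- The cyclic predecessor in a layer. -/
def prev (k i : ℕ) : ℕ := if i = 0 then P.size k - 1 else i - 1

@[simp] theorem offset_zero (k : ℕ) : P.offset k 0 = 0 := rfl

theorem offset_succ (k i : ℕ) : P.offset k (i + 1) = P.offset k i + P.deg k i :=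
  Finset.sum_range_succ _ _

theorem offset_mono (k : ℕ) : Monotone (P.offset k) :=
  monotone_nat_of_le_succ fun i => by rw [offset_succ]; omega

theorem offset_size {k : ℕ} (hk : k ≤ n) : P.offset k (P.size k) = P.size (k + 1) :=
  (P.size_succ k hk).symm

theorem offset_top (i : ℕ) : P.offset n i = i := by simp [offset, P.deg_top]

theorem size_top : P.size (n + 1) = P.size n := by
  rw [← P.offset_size le_rfl, offset_top]

theorem offset_add_le {k i j : ℕ} (hk : k ≤ n) (hi : i < P.size k) (hj : j ≤ P.deg k i) :
    P.offset k i + j ≤ P.size (k + 1) := by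
  have h1 := P.offset_mono k (show i + 1 ≤ P.size k from hi)
  rw [offset_succ, P.offset_size hk] at h1
  omega

theorem offset_add_lt {k i j : ℕ} (hk : k ≤ n) (hi : i < P.size k) (hj : j < P.deg k i) :
    P.offset k i + j < P.size (k + 1) := by
  have h1 := P.offset_add_le hk hi (show j + 1 ≤ P.deg k i from hj)
  omega

theorem parent_offset_add {k i j : ℕ} (hj : j < P.deg k i) : P.parent k (P.offset k i + j) = i := by
  have hmem : i ∈ {i' | P.offset k i + j < P.offset k (i' + 1)} := by
    rw [Set.mem_ofPred_eq, offset_succ]; omega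
  refine le_antisymm (Nat.sInf_le hmem) ?_
  by_contra hlt
  have h1 : P.offset k i + j < P.offset k (P.parent k (P.offset k i + j) + 1) :=
    Nat.sInf_mem ⟨i, hmem⟩
  have h2 := P.offset_mono k
    (show P.parent k (P.offset k i + j) + 1 ≤ i by rw [not_le] at hlt; exact hlt)
  omega

theorem exists_offset_add {k w : ℕ} (hk : k ≤ n) (hw : w < P.size (k + 1)) :
    ∃ i j, i < P.size k ∧ j < P.deg k i ∧ w = P.offset k i + j := by
  rw [← P.offset_size hk] at hw
  have key : ∀ m, w < P.offset k m → ∃ i j, i < m ∧ j < P.deg k i ∧ w = P.offset k i + j := by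
    intro m
    induction m with
    | zero => intro h0; simp at h0
    | succ m ih =>
      intro h0
      by_cases h1 : w < P.offset k m
      · obtain ⟨i, j, hi, hj⟩ := ih h1
        exact ⟨i, j, by omega, hj⟩
      · rw [offset_succ] at h0
        exact ⟨m, w - P.offset k m, by omega, by omega, by omega⟩
  exact key _ hw

theorem next_lt {k i : ℕ} (hi : i < P.size k) : P.next k i < P.size k := by
  rw [next]; split_ifs <;> omega

theorem prev_lt {k i : ℕ} (hi : i < P.size k) : P.prev k i < P.size k := by
  rw [prev]; split_ifs <;> omega

theorem next_prev {k i : ℕ} (hi : i < P.size k) : P.next k (P.prev k i) = i := by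
  rw [next, prev]; split_ifs <;> omega

theorem prev_next (k i : ℕ) : P.prev k (P.next k i) = i := by
  unfold next prev; grind

/-- Labels of the darts of the causal triangulation built from a plane forest. -/
inductive RawDart where
  | cup (i : ℕ)
  | cdown (i : ℕ)
  | back (k i : ℕ)
  | fwd (k i : ℕ)
  | up (k i j : ℕ)
  | down (k i j : ℕ)

open RawDart

/-- The labels that occur. -/
def Valid : RawDart → Prop
  | cup i => i < P.size 0
  | cdown i => i < P.size 0
  | back k i => k ≤ n ∧ i < P.size k
  | fwd k i => k ≤ n ∧ i < P.size k
  | up k i j => k ≤ n ∧ i < P.size k ∧ j ≤ P.deg k i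
  | down k i j => k ≤ n ∧ i < P.size k ∧ j ≤ P.deg k i

def rawFlip : RawDart → RawDart
  | cup i => cdown i
  | cdown i => cup i
  | back k i => fwd k i
  | fwd k i => back k i
  | up k i j => down k i j
  | down k i j => up k i j

/-- Layer `k` sits at height `k + 1`. The dart `cup i` joins the centre to vertex `i` of layer 0;
`fwd k i` runs from vertex `i` to its cyclic successor, and `back k i` is its reverse. The darts `up
k i j` with `0 ≤ j ≤ deg k i` start at the successor of `i` and end at vertex `offset k i + j` of
layer `k + 1`, taken cyclically: `deg k i + 1` darts enclose one triangle for each child. Above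
layer `n` that triangle is missing and the exterior face takes its place. -/
noncomputable def rawFace : RawDart → RawDart
  | cup i => back 0 (P.prev 0 i)
  | cdown i => cup (P.next 0 i)
  | back 0 i => cdown i
  | back (k + 1) w => down k (P.parent k w) (w - P.offset k (P.parent k w))
  | fwd k i => up k i 0
  | up k i 0 => down k (P.prev k i) (P.deg k (P.prev k i))
  | up k i (j + 1) => if k < n then back (k + 1) (P.offset k i + j) else down k (P.next k i) 0
  | down k i j => if j = P.deg k i then fwd k (P.next k i) else up k i (j + 1)

theorem rawFace_cup (i : ℕ) : P.rawFace (cup i) = back 0 (P.prev 0 i) := rfl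
theorem rawFace_cdown (i : ℕ) : P.rawFace (cdown i) = cup (P.next 0 i) := rfl
theorem rawFace_back_zero (i : ℕ) : P.rawFace (back 0 i) = cdown i := rfl
theorem rawFace_fwd (k i : ℕ) : P.rawFace (fwd k i) = up k i 0 := rfl
theorem rawFace_up_zero (k i : ℕ) :
    P.rawFace (up k i 0) = down k (P.prev k i) (P.deg k (P.prev k i)) := rfl
theorem rawFace_back_succ {k i j : ℕ} (hj : j < P.deg k i) :
    P.rawFace (back (k + 1) (P.offset k i + j)) = down k i j := by
  rw [rawFace, P.parent_offset_add hj, Nat.add_sub_cancel_left]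
theorem rawFace_up_succ {k i j : ℕ} (hk : k < n) :
    P.rawFace (up k i (j + 1)) = back (k + 1) (P.offset k i + j) := if_pos hk
theorem rawFace_up_top (i j : ℕ) :
    P.rawFace (up n i (j + 1)) = down n (P.next n i) 0 := if_neg (lt_irrefl _)
theorem rawFace_down_last (k i : ℕ) :
    P.rawFace (down k i (P.deg k i)) = fwd k (P.next k i) := if_pos rfl
theorem rawFace_down {k i j : ℕ} (hj : j < P.deg k i) :
    P.rawFace (down k i j) = up k i (j + 1) := if_neg hj.ne

theorem rawFlip_rawFlip (x : RawDart) : rawFlip (rawFlip x) = x := by cases x <;> rfl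

theorem rawFlip_ne (x : RawDart) : rawFlip x ≠ x := by cases x <;> simp [rawFlip]

theorem valid_rawFlip {x : RawDart} (hx : P.Valid x) : P.Valid (rawFlip x) := by
  cases x <;> exact hx

theorem valid_rawFace {x : RawDart} (hx : P.Valid x) : P.Valid (P.rawFace x) := by
  match x, hx with
  | cup i, hx => exact ⟨Nat.zero_le _, P.prev_lt hx⟩
  | cdown i, hx => exact P.next_lt (k := 0) hx
  | back 0 i, hx => exact hx.2
  | back (k + 1) w, hx =>
    obtain ⟨i, j, hi, hj, rfl⟩ := P.exists_offset_add (k := k) (by have := hx.1; omega) hx.2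
    rw [P.rawFace_back_succ hj]
    exact ⟨by have := hx.1; omega, hi, hj.le⟩
  | fwd k i, hx => exact ⟨hx.1, hx.2, Nat.zero_le _⟩
  | up k i 0, hx => exact ⟨hx.1, P.prev_lt hx.2.1, le_rfl⟩
  | up k i (j + 1), hx =>
    rw [rawFace]
    split_ifs with hk
    · exact ⟨hk, P.offset_add_lt hk.le hx.2.1 hx.2.2⟩
    · exact ⟨hx.1, P.next_lt hx.2.1, Nat.zero_le _⟩
  | down k i j, hx =>
    rw [rawFace]
    split_ifs with hj
    · exact ⟨hx.1, P.next_lt hx.2.1⟩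
    · exact ⟨hx.1, hx.2.1, lt_of_le_of_ne hx.2.2 hj⟩

/-- There are finitely many valid labels, so surjectivity already makes `rawFace` a permutation and
no inverse has to be written down. -/
theorem exists_rawFace_eq {x : RawDart} (hx : P.Valid x) : ∃ y, P.Valid y ∧ P.rawFace y = x := by
  match x, hx with
  | cup i, hx =>
    exact ⟨cdown (P.prev 0 i), P.prev_lt (k := 0) hx, by rw [rawFace_cdown, P.next_prev hx]⟩
  | cdown i, hx => exact ⟨back 0 i, ⟨Nat.zero_le _, hx⟩, rfl⟩
  | back 0 i, hx =>
    exact ⟨cup (P.next 0 i), P.next_lt hx.2, by rw [rawFace_cup, P.prev_next]⟩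
  | back (k + 1) w, hx =>
    have hk : k < n := hx.1
    obtain ⟨i, j, hi, hj, rfl⟩ := P.exists_offset_add (k := k) hk.le hx.2
    exact ⟨up k i (j + 1), ⟨hk.le, hi, hj⟩, P.rawFace_up_succ hk⟩
  | fwd k i, hx =>
    exact ⟨down k (P.prev k i) (P.deg k (P.prev k i)), ⟨hx.1, P.prev_lt hx.2, le_rfl⟩, by
      rw [rawFace_down_last, P.next_prev hx.2]⟩
  | up k i 0, hx => exact ⟨fwd k i, ⟨hx.1, hx.2.1⟩, rfl⟩
  | up k i (j + 1), hx => exact ⟨down k i j, ⟨hx.1, hx.2.1, by have := hx.2.2; omega⟩,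
      P.rawFace_down hx.2.2⟩
  | down k i j, hx =>
    rcases hx.2.2.eq_or_lt with rfl | hj
    · exact ⟨up k (P.next k i) 0, ⟨hx.1, P.next_lt hx.2.1, Nat.zero_le _⟩, by
        rw [rawFace_up_zero, P.prev_next]⟩
    · rcases hx.1.eq_or_lt with rfl | hk
      · have h1 := P.deg_top i
        obtain rfl : j = 0 := by omega
        exact ⟨up k (P.prev k i) 1, ⟨le_rfl, P.prev_lt hx.2.1, (P.deg_top _).ge⟩, by
          rw [rawFace_up_top, P.next_prev hx.2.1]⟩
      · exact ⟨back (k + 1) (P.offset k i + j), ⟨hk, P.offset_add_lt hx.1 hx.2.1 hj⟩,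
          P.rawFace_back_succ hj⟩

instance : Finite {x // P.Valid x} := by
  let S := Σ k : Fin (n + 1), Fin (P.size k)
  let T := Σ p : S, Fin (P.deg p.1 p.2 + 1)
  let F : (Fin (P.size 0) ⊕ Fin (P.size 0)) ⊕ (S ⊕ S) ⊕ (T ⊕ T) → {x // P.Valid x} :=
    Sum.elim (Sum.elim (fun i => ⟨cup i, i.2⟩) (fun i => ⟨cdown i, i.2⟩))
      (Sum.elim (Sum.elim (fun p => ⟨back p.1 p.2, Nat.le_of_lt_succ p.1.2, p.2.2⟩)
        (fun p => ⟨fwd p.1 p.2, Nat.le_of_lt_succ p.1.2, p.2.2⟩))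
      (Sum.elim (fun p => ⟨up p.1.1 p.1.2 p.2, Nat.le_of_lt_succ p.1.1.2, p.1.2.2,
          Nat.le_of_lt_succ p.2.2⟩)
        (fun p => ⟨down p.1.1 p.1.2 p.2, Nat.le_of_lt_succ p.1.1.2, p.1.2.2,
          Nat.le_of_lt_succ p.2.2⟩)))
  refine Finite.of_surjective F ?_
  rintro ⟨x, hx⟩
  match x, hx with
  | cup i, hx => exact ⟨Sum.inl (Sum.inl ⟨i, hx⟩), rfl⟩
  | cdown i, hx => exact ⟨Sum.inl (Sum.inr ⟨i, hx⟩), rfl⟩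
  | back k i, hx =>
    exact ⟨Sum.inr (Sum.inl (Sum.inl ⟨⟨k, Nat.lt_succ_of_le hx.1⟩, ⟨i, hx.2⟩⟩)), rfl⟩
  | fwd k i, hx =>
    exact ⟨Sum.inr (Sum.inl (Sum.inr ⟨⟨k, Nat.lt_succ_of_le hx.1⟩, ⟨i, hx.2⟩⟩)), rfl⟩
  | up k i j, hx =>
    exact ⟨Sum.inr (Sum.inr (Sum.inl ⟨⟨⟨k, Nat.lt_succ_of_le hx.1⟩, ⟨i, hx.2.1⟩⟩,
      ⟨j, Nat.lt_succ_of_le hx.2.2⟩⟩)), rfl⟩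
  | down k i j, hx =>
    exact ⟨Sum.inr (Sum.inr (Sum.inr ⟨⟨⟨k, Nat.lt_succ_of_le hx.1⟩, ⟨i, hx.2.1⟩⟩,
      ⟨j, Nat.lt_succ_of_le hx.2.2⟩⟩)), rfl⟩

noncomputable def facePerm : Equiv.Perm {x // P.Valid x} :=
  Equiv.ofBijective (fun x => ⟨P.rawFace x.1, P.valid_rawFace x.2⟩)
    (Finite.surjective_iff_bijective.1 fun x => by
      obtain ⟨y, hy, hyx⟩ := P.exists_rawFace_eq x.2
      exact ⟨⟨y, hy⟩, Subtype.ext hyx⟩)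

def flipPerm : Equiv.Perm {x // P.Valid x} where
  toFun x := ⟨rawFlip x.1, P.valid_rawFlip x.2⟩
  invFun x := ⟨rawFlip x.1, P.valid_rawFlip x.2⟩
  left_inv x := Subtype.ext (rawFlip_rawFlip x.1)
  right_inv x := Subtype.ext (rawFlip_rawFlip x.1)

theorem valid_root : P.Valid (cup 0) := P.size_pos 0 (Nat.zero_le _)

/-- The causal triangulation built from a plane forest. -/
noncomputable def toMap : RootedMap where
  numDarts := Nat.card {x // P.Valid x}
  -- Forced by `faceStep = rot * flip`, as `flip` is an involution.
  rot := (Finite.equivFin _).permCongr (P.facePerm * P.flipPerm)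
  flip := (Finite.equivFin _).permCongr P.flipPerm
  flip_flip d := by
    simp only [Equiv.permCongr_apply, Equiv.symm_apply_apply]
    rw [← Equiv.eq_symm_apply]
    exact Subtype.ext (rawFlip_rawFlip _)
  flip_ne d := by
    rw [Equiv.permCongr_apply, Ne, ← Equiv.eq_symm_apply]
    exact fun h => rawFlip_ne _ (congrArg Subtype.val h)
  root := Finite.equivFin _ ⟨cup 0, P.valid_root⟩

open Classical in
/-- The dart with a given label. -/
noncomputable def dart (x : RawDart) : P.toMap.Dart :=
  if hx : P.Valid x then Finite.equivFin {x // P.Valid x} ⟨x, hx⟩ else P.toMap.root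

theorem dart_of_valid {x : RawDart} (hx : P.Valid x) :
    P.dart x = Finite.equivFin {x // P.Valid x} ⟨x, hx⟩ := dif_pos hx

theorem root_eq : P.toMap.root = P.dart (cup 0) := (P.dart_of_valid P.valid_root).symm

theorem exists_dart_eq (d : P.toMap.Dart) : ∃ x, P.Valid x ∧ P.dart x = d := by
  refine ⟨((Finite.equivFin _).symm d).1, ((Finite.equivFin _).symm d).2, ?_⟩
  rw [dart_of_valid]
  exact Equiv.apply_symm_apply _ _

theorem dart_injective {x y : RawDart} (hx : P.Valid x) (hy : P.Valid y)
    (hxy : P.dart x = P.dart y) : x = y := by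
  rw [P.dart_of_valid hx, P.dart_of_valid hy] at hxy
  exact congrArg Subtype.val ((Finite.equivFin _).injective hxy)

theorem flip_dart {x : RawDart} (hx : P.Valid x) : P.toMap.flip (P.dart x) = P.dart (rawFlip x) := by
  rw [P.dart_of_valid hx, P.dart_of_valid (P.valid_rawFlip hx)]
  change (Finite.equivFin _).permCongr P.flipPerm _ = _
  rw [Equiv.permCongr_apply, Equiv.symm_apply_apply]
  rfl

theorem rot_dart {x : RawDart} (hx : P.Valid x) :
    P.toMap.rot (P.dart x) = P.dart (P.rawFace (rawFlip x)) := by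
  rw [P.dart_of_valid hx, P.dart_of_valid (P.valid_rawFace (P.valid_rawFlip hx))]
  change (Finite.equivFin _).permCongr (P.facePerm * P.flipPerm) _ = _
  rw [Equiv.permCongr_apply, Equiv.symm_apply_apply]
  rfl

theorem faceStep_dart {x : RawDart} (hx : P.Valid x) :
    P.toMap.faceStep (P.dart x) = P.dart (P.rawFace x) := by
  rw [RootedMap.faceStep_apply, P.flip_dart hx, P.rot_dart (P.valid_rawFlip hx), rawFlip_rawFlip]

end LayerData

/-! ### Heights and vertices of the constructed map -/

namespace RootedMap

variable {M : RootedMap}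

theorem eq_of_vert_eq {α : Type*} {L : M.Dart → α} (hrot : ∀ d, L (M.rot d) = L d) {d e : M.Dart}
    (hde : M.vert d = M.vert e) : L d = L e :=
  (vert_eq_iff.1 hde).mem_of_closed (S := fun x => L d = L x) rfl
    fun x hx => hx.trans (hrot x).symm

theorem le_add_length_of_walk {L : M.Dart → ℕ} (hrot : ∀ d, L (M.rot d) = L d)
    (hflip : ∀ d, L (M.flip d) ≤ L d + 1) {v w : M.Vertex} (p : M.graph.Walk v w) :
    ∀ d e, M.vert d = v → M.vert e = w → L e ≤ L d + p.length := by
  induction p with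
  | nil =>
    intro d e hd he
    rw [eq_of_vert_eq hrot (hd.trans he.symm)]
    exact Nat.le_add_right _ _
  | cons hadj p ih =>
    intro d e hd he
    obtain ⟨-, x, hx, hx'⟩ := id hadj
    have h1 := ih (M.flip x) e hx' he
    have h2 := hflip x
    have h3 := eq_of_vert_eq hrot (hd.trans hx.symm)
    rw [SimpleGraph.Walk.length_cons]
    omega

/-- A function on the darts that behaves like the height is the height. -/
theorem connected_and_lev_eq {L : M.Dart → ℕ} (hrot : ∀ d, L (M.rot d) = L d)
    (hflip : ∀ d, L (M.flip d) ≤ L d + 1) (hroot : L M.root = 0)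
    (hcenter : ∀ d, L d = 0 → M.vert d = M.center)
    (hdown : ∀ d, 0 < L d → ∃ e, M.vert e = M.vert d ∧ L (M.flip e) + 1 = L d) :
    M.graph.Connected ∧ ∀ d, M.lev d = L d := by
  have hwalk : ∀ m d, L d = m → ∃ p : M.graph.Walk M.center (M.vert d), p.length = m := by
    intro m
    induction m with
    | zero =>
      intro d hd
      rw [hcenter d hd]
      exact ⟨.nil, rfl⟩
    | succ m ih =>
      intro d hd
      obtain ⟨e, he, he'⟩ := hdown d (by omega)
      obtain ⟨p, hp⟩ := ih (M.flip e) (by omega)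
      have h1 := eq_of_vert_eq hrot he
      have hadj : M.graph.Adj (M.vert (M.flip e)) (M.vert d) := by
        refine ⟨fun h2 => ?_, M.flip e, rfl, by rw [target_flip, he]⟩
        have h3 := eq_of_vert_eq hrot h2
        omega
      exact ⟨p.concat hadj, by rw [SimpleGraph.Walk.length_concat, hp]⟩
  have hconn : M.graph.Connected := by
    have : Nonempty M.Vertex := ⟨M.center⟩
    refine ⟨fun v w => ?_⟩
    have key : ∀ v, M.graph.Reachable M.center v := fun v => by
      obtain ⟨d, rfl⟩ := exists_vert_eq v
      obtain ⟨p, -⟩ := hwalk _ d rfl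
      exact ⟨p⟩
    exact (key v).symm.trans (key w)
  refine ⟨hconn, fun d => le_antisymm ?_ ?_⟩
  · obtain ⟨p, hp⟩ := hwalk _ d rfl
    rw [← hp]
    exact SimpleGraph.dist_le p
  · obtain ⟨p, hp⟩ := (hconn.preconnected M.center (M.vert d)).exists_walk_length_eq_dist
    have h1 := le_add_length_of_walk hrot hflip p M.root d rfl rfl
    rw [hroot, zero_add, hp] at h1
    exact h1

end RootedMap

namespace LayerData

variable {n : ℕ} (P : LayerData n)

open RawDart

/-- The height of the initial vertex of the dart with a given label. -/
def rawLev : RawDart → ℕ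
  | cup _ => 0
  | cdown _ => 1
  | back k _ => k + 1
  | fwd k _ => k + 1
  | up k _ _ => k + 1
  | down k _ _ => k + 2

/-- The position of a vertex in layer `k` counted with one extra position at the end. -/
def wrap (k i : ℕ) : ℕ := if i = P.size k then 0 else i

/-- The position in its layer of the initial vertex of the dart with a given label. -/
def rawPos : RawDart → ℕ
  | cup _ => 0
  | cdown i => i
  | back k i => P.next k i
  | fwd _ i => i
  | up k i _ => P.next k i
  | down k i j => P.wrap (k + 1) (P.offset k i + j)

theorem wrap_of_lt {k i : ℕ} (hi : i < P.size k) : P.wrap k i = i := if_neg hi.ne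

theorem wrap_size (k : ℕ) : P.wrap k (P.size k) = 0 := if_pos rfl

theorem wrap_lt {k i : ℕ} (hi : i ≤ P.size k) (h0 : 0 < P.size k) : P.wrap k i < P.size k := by
  rw [wrap]; split_ifs <;> omega

/-- The last ascending dart of one vertex ends where the first one of the next vertex ends, also
across the seam where the position jumps from `size (k + 1)` back to 0. -/
theorem wrap_offset_next {k i : ℕ} (hk : k ≤ n) (hi : i < P.size k) :
    P.wrap (k + 1) (P.offset k (P.next k i)) = P.wrap (k + 1) (P.offset k (i + 1)) := by
  rw [next]
  split_ifs with h1
  · have h2 : 0 < P.size (k + 1) := by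
      rcases hk.eq_or_lt with rfl | hk
      · rw [P.size_top]; exact P.size_pos _ le_rfl
      · exact P.size_pos _ hk
    rw [h1, P.offset_size hk, wrap_size, offset_zero, P.wrap_of_lt h2]
  · rfl

theorem rawLev_rawFace {x : RawDart} (hx : P.Valid x) :
    rawLev (P.rawFace x) = rawLev (rawFlip x) := by
  match x, hx with
  | cup i, hx => rfl
  | cdown i, hx => rfl
  | back 0 i, hx => rfl
  | back (k + 1) w, hx => rfl
  | fwd k i, hx => rfl
  | up k i 0, hx => rfl
  | up k i (j + 1), hx => rw [rawFace]; split_ifs <;> rfl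
  | down k i j, hx => rw [rawFace]; split_ifs <;> rfl

/-- Since `rot` is `rawFace` after `rawFlip`, the position is constant around a vertex. Together
with the level it tells vertices apart. -/
theorem rawPos_rawFace {x : RawDart} (hx : P.Valid x) :
    P.rawPos (P.rawFace x) = P.rawPos (rawFlip x) := by
  match x, hx with
  | cup i, hx => exact P.next_prev hx
  | cdown i, hx => rfl
  | back 0 i, hx => rfl
  | back (k + 1) w, hx =>
    have hk : k < n := hx.1
    obtain ⟨i, j, hi, hj, rfl⟩ := P.exists_offset_add (k := k) hk.le hx.2
    rw [P.rawFace_back_succ hj]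
    exact P.wrap_of_lt hx.2
  | fwd k i, hx => rfl
  | up k i 0, hx =>
    have h1 := P.wrap_offset_next hx.1 (P.prev_lt hx.2.1)
    rw [P.next_prev hx.2.1, offset_succ] at h1
    exact h1.symm
  | up k i (j + 1), hx =>
    rcases hx.1.eq_or_lt with rfl | hk
    · rw [rawFace_up_top]
      have h1 := hx.2.2
      rw [P.deg_top] at h1
      obtain rfl : j = 0 := by omega
      have h2 := P.wrap_offset_next le_rfl hx.2.1
      rw [offset_succ, P.deg_top] at h2
      exact h2
    · rw [P.rawFace_up_succ hk]
      rfl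
  | down k i j, hx =>
    rcases hx.2.2.eq_or_lt with rfl | hj
    · rw [rawFace_down_last]; rfl
    · rw [P.rawFace_down hj]; rfl

theorem rawLev_rot {x : RawDart} (hx : P.Valid x) : rawLev (P.rawFace (rawFlip x)) = rawLev x := by
  rw [P.rawLev_rawFace (P.valid_rawFlip hx), rawFlip_rawFlip]

theorem rawPos_rot {x : RawDart} (hx : P.Valid x) :
    P.rawPos (P.rawFace (rawFlip x)) = P.rawPos x := by
  rw [P.rawPos_rawFace (P.valid_rawFlip hx), rawFlip_rawFlip]

noncomputable def label (d : P.toMap.Dart) : RawDart := (P.exists_dart_eq d).choose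

theorem valid_label (d : P.toMap.Dart) : P.Valid (P.label d) := (P.exists_dart_eq d).choose_spec.1

theorem dart_label (d : P.toMap.Dart) : P.dart (P.label d) = d := (P.exists_dart_eq d).choose_spec.2

theorem label_dart {x : RawDart} (hx : P.Valid x) : P.label (P.dart x) = x :=
  P.dart_injective (P.valid_label _) hx (P.dart_label _)

theorem label_rot (d : P.toMap.Dart) : P.label (P.toMap.rot d) = P.rawFace (rawFlip (P.label d)) := by
  obtain ⟨x, hx, rfl⟩ := P.exists_dart_eq d
  rw [P.rot_dart hx, P.label_dart hx, P.label_dart (P.valid_rawFace (P.valid_rawFlip hx))]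

theorem label_flip (d : P.toMap.Dart) : P.label (P.toMap.flip d) = rawFlip (P.label d) := by
  obtain ⟨x, hx, rfl⟩ := P.exists_dart_eq d
  rw [P.flip_dart hx, P.label_dart hx, P.label_dart (P.valid_rawFlip hx)]

theorem label_faceStep (d : P.toMap.Dart) :
    P.label (P.toMap.faceStep d) = P.rawFace (P.label d) := by
  rw [RootedMap.faceStep_apply, label_rot, label_flip, rawFlip_rawFlip]

theorem vert_rot_dart {x : RawDart} (hx : P.Valid x) :
    P.toMap.vert (P.dart (P.rawFace (rawFlip x))) = P.toMap.vert (P.dart x) := by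
  rw [← P.rot_dart hx, RootedMap.vert_rot]

theorem vert_up {k i : ℕ} (hk : k ≤ n) (hi : i < P.size k) {j : ℕ} (hj : j ≤ P.deg k i) :
    P.toMap.vert (P.dart (up k i j)) = P.toMap.vert (P.dart (back k i)) := by
  induction j with
  | zero => exact P.vert_rot_dart (x := back k i) ⟨hk, hi⟩
  | succ j ih =>
    rw [← ih (by omega)]
    have := P.vert_rot_dart (x := up k i j) ⟨hk, hi, by omega⟩
    rwa [rawFlip, P.rawFace_down hj] at this

theorem vert_back {k i : ℕ} (hk : k ≤ n) (hi : i < P.size k) :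
    P.toMap.vert (P.dart (back k i)) = P.toMap.vert (P.dart (fwd k (P.next k i))) := by
  rw [← P.vert_up hk hi le_rfl]
  have := P.vert_rot_dart (x := up k i (P.deg k i)) ⟨hk, hi, le_rfl⟩
  rw [rawFlip, P.rawFace_down_last] at this
  exact this.symm

theorem vert_cup {i : ℕ} (hi : i < P.size 0) : P.toMap.vert (P.dart (cup i)) = P.toMap.center := by
  induction i with
  | zero => rw [RootedMap.center, root_eq]
  | succ i ih =>
    rw [← ih (by omega)]
    have := P.vert_rot_dart (x := cup i) (show i < P.size 0 by omega)
    rwa [rawFlip, rawFace_cdown, next, if_neg hi.ne] at this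

theorem vert_down_next {k i : ℕ} (hk : k ≤ n) (hi : i < P.size k) :
    P.toMap.vert (P.dart (down k i (P.deg k i))) =
      P.toMap.vert (P.dart (down k (P.next k i) 0)) := by
  have := P.vert_rot_dart (x := down k (P.next k i) 0) ⟨hk, P.next_lt hi, Nat.zero_le _⟩
  rwa [rawFlip, rawFace_up_zero, P.prev_next] at this

theorem vert_down_of_lt {k i j : ℕ} (hk : k < n) (hi : i < P.size k) (hj : j < P.deg k i) :
    P.toMap.vert (P.dart (down k i j)) =
      P.toMap.vert (P.dart (fwd (k + 1) (P.offset k i + j))) := by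
  have := P.vert_rot_dart (x := fwd (k + 1) (P.offset k i + j))
    ⟨hk, P.offset_add_lt hk.le hi hj⟩
  rwa [rawFlip, P.rawFace_back_succ hj] at this

/-- If `j` is the last index, the end vertex is also reached from the next vertex of the layer,
which may again be childless; `m` counts the vertices left, so the search ends. -/
theorem vert_down_of_offset_lt {k : ℕ} (hk : k < n) (m : ℕ) : ∀ i j, i + m = P.size k →
    i < P.size k → j ≤ P.deg k i → P.offset k i + j < P.size (k + 1) →
    P.toMap.vert (P.dart (down k i j)) =
      P.toMap.vert (P.dart (fwd (k + 1) (P.offset k i + j))) := by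
  induction m with
  | zero => intro i j h1 h2; omega
  | succ m ih =>
    intro i j him hi hj hlt
    rcases hj.eq_or_lt with rfl | hj
    · rw [← offset_succ] at hlt ⊢
      have hi' : i + 1 < P.size k := by
        by_contra hcon
        have h1 : i + 1 = P.size k := by omega
        rw [h1, P.offset_size hk.le] at hlt
        omega
      have hn : P.next k i = i + 1 := if_neg hi'.ne
      rw [P.vert_down_next hk.le hi, hn]
      exact ih (i + 1) 0 (by omega) hi' (Nat.zero_le _) hlt
    · exact P.vert_down_of_lt hk hi hj

/-- Adds the seam to `vert_down_of_offset_lt`. At position `size (k + 1)` the remaining vertices are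
childless, and they are skipped until the index returns to 0. -/
theorem vert_down {k : ℕ} (hk : k < n) (m : ℕ) : ∀ i j, i + m = P.size k →
    i < P.size k → j ≤ P.deg k i →
    P.toMap.vert (P.dart (down k i j)) =
      P.toMap.vert (P.dart (fwd (k + 1) (P.wrap (k + 1) (P.offset k i + j)))) := by
  induction m with
  | zero => intro i j h1 h2; omega
  | succ m ih =>
    intro i j him hi hj
    rcases (P.offset_add_le hk.le hi hj).eq_or_lt with heq | hlt
    · have hj' : j = P.deg k i := by
        by_contra hcon
        have := P.offset_add_lt hk.le hi (lt_of_le_of_ne hj hcon)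
        omega
      subst hj'
      rw [P.vert_down_next hk.le hi]
      by_cases hi' : i + 1 = P.size k
      · have hn : P.next k i = 0 := if_pos hi'
        rw [heq, wrap_size, hn]
        exact P.vert_down_of_offset_lt hk (P.size k) 0 0 (zero_add _) (P.size_pos k hk.le)
          (Nat.zero_le _) (P.size_pos _ hk)
      · have hn : P.next k i = i + 1 := if_neg hi'
        have := ih (i + 1) 0 (by omega) (by omega) (Nat.zero_le _)
        rwa [add_zero, offset_succ, ← hn] at this
    · rw [P.wrap_of_lt hlt]
      exact P.vert_down_of_offset_lt hk _ i j him hi hj hlt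

/-- Every vertex that is neither the centre nor at maximal height is the initial vertex of a
forward dart. -/
theorem vert_eq_vert_fwd {x : RawDart} (hx : P.Valid x) {k : ℕ} (hk : k ≤ n)
    (hxk : rawLev x = k + 1) :
    P.rawPos x < P.size k ∧ P.toMap.vert (P.dart x) = P.toMap.vert (P.dart (fwd k (P.rawPos x))) := by
  match x, hx with
  | cdown i, hx =>
    obtain rfl : k = 0 := by simp only [rawLev] at hxk; omega
    exact ⟨hx, P.vert_rot_dart (x := fwd 0 i) ⟨hk, hx⟩⟩
  | back k' i, hx =>
    obtain rfl : k = k' := by simp only [rawLev] at hxk; omega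
    exact ⟨P.next_lt hx.2, P.vert_back hk hx.2⟩
  | fwd k' i, hx =>
    obtain rfl : k = k' := by simp only [rawLev] at hxk; omega
    exact ⟨hx.2, rfl⟩
  | up k' i j, hx =>
    obtain rfl : k = k' := by simp only [rawLev] at hxk; omega
    exact ⟨P.next_lt hx.2.1, (P.vert_up hk hx.2.1 hx.2.2).trans (P.vert_back hk hx.2.1)⟩
  | down k' i j, hx =>
    obtain rfl : k = k' + 1 := by simp only [rawLev] at hxk; omega
    exact ⟨P.wrap_lt (P.offset_add_le hx.1 hx.2.1 hx.2.2) (P.size_pos _ hk),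
      P.vert_down hk (P.size k' - i) i j (by have := hx.2.1; omega) hx.2.1 hx.2.2⟩

theorem valid_of_rawLev_eq_zero {x : RawDart} (hx : P.Valid x) (h0 : rawLev x = 0) :
    ∃ i, i < P.size 0 ∧ x = cup i := by
  match x, hx with
  | cup i, hx => exact ⟨i, hx, rfl⟩

theorem rawLev_le {x : RawDart} (hx : P.Valid x) : rawLev x ≤ n + 2 := by
  match x, hx with
  | cup i, hx => exact Nat.zero_le _
  | cdown i, hx => exact Nat.le_add_left 1 (n + 1)
  | back k i, hx => have := hx.1; simp only [rawLev]; omega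
  | fwd k i, hx => have := hx.1; simp only [rawLev]; omega
  | up k i j, hx => have := hx.1; simp only [rawLev]; omega
  | down k i j, hx => have := hx.1; simp only [rawLev]; omega

theorem eq_down_of_rawLev_eq {x : RawDart} (hx : P.Valid x) (h0 : rawLev x = n + 2) :
    ∃ i j, i < P.size n ∧ j ≤ 1 ∧ x = down n i j := by
  match x, hx with
  | back k i, hx => have := hx.1; simp only [rawLev] at h0; omega
  | fwd k i, hx => have := hx.1; simp only [rawLev] at h0; omega
  | up k i j, hx => have := hx.1; simp only [rawLev] at h0; omega
  | down k i j, hx =>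
    obtain rfl : k = n := by simp only [rawLev] at h0; omega
    exact ⟨i, j, hx.2.1, by rw [← P.deg_top i]; exact hx.2.2, rfl⟩

theorem rawLev_rawFlip_le (x : RawDart) : rawLev (rawFlip x) ≤ rawLev x + 1 := by
  cases x <;> simp only [rawLev, rawFlip] <;> omega

theorem connected_and_lev :
    P.toMap.graph.Connected ∧ ∀ d, P.toMap.lev d = rawLev (P.label d) := by
  refine RootedMap.connected_and_lev_eq ?_ ?_ ?_ ?_ ?_
  · intro d
    rw [label_rot, P.rawLev_rot (P.valid_label d)]
  · intro d
    rw [label_flip]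
    exact rawLev_rawFlip_le _
  · rw [root_eq, P.label_dart P.valid_root]
    rfl
  · intro d hd
    obtain ⟨i, hi, hx⟩ := P.valid_of_rawLev_eq_zero (P.valid_label d) hd
    rw [← P.dart_label d, hx, P.vert_cup hi]
  · intro d hd
    by_cases htop : rawLev (P.label d) = n + 2
    · obtain ⟨i, j, -, -, hx⟩ := P.eq_down_of_rawLev_eq (P.valid_label d) htop
      refine ⟨d, rfl, ?_⟩
      rw [label_flip, hx]
      rfl
    · have h1 := P.rawLev_le (P.valid_label d)
      obtain ⟨h2, h3⟩ := P.vert_eq_vert_fwd (P.valid_label d)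
        (k := rawLev (P.label d) - 1) (by omega) (by omega)
      rw [dart_label] at h3
      have hv : P.Valid (fwd (rawLev (P.label d) - 1) (P.rawPos (P.label d))) := ⟨by omega, h2⟩
      -- The dart that follows the forward dart around a vertex descends.
      refine ⟨P.toMap.rot (P.dart (fwd (rawLev (P.label d) - 1) (P.rawPos (P.label d)))), ?_, ?_⟩
      · rw [RootedMap.vert_rot, h3]
      · rw [label_flip, label_rot, P.label_dart hv, rawFlip]
        obtain ⟨m, hm⟩ : ∃ m, rawLev (P.label d) = m + 1 := ⟨rawLev (P.label d) - 1, by omega⟩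
        rw [hm, Nat.add_sub_cancel]
        cases m with
        | zero => rfl
        | succ m => rfl

theorem connected : P.toMap.graph.Connected := P.connected_and_lev.1

theorem lev_eq (d : P.toMap.Dart) : P.toMap.lev d = rawLev (P.label d) := P.connected_and_lev.2 d

theorem lev_dart {x : RawDart} (hx : P.Valid x) : P.toMap.lev (P.dart x) = rawLev x := by
  rw [lev_eq, P.label_dart hx]

theorem rawPos_eq_of_vert_eq {d e : P.toMap.Dart} (h : P.toMap.vert d = P.toMap.vert e) :
    P.rawPos (P.label d) = P.rawPos (P.label e) :=
  RootedMap.eq_of_vert_eq (L := fun d => P.rawPos (P.label d))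
    (fun d => by rw [label_rot, P.rawPos_rot (P.valid_label d)]) h

/-- Every vertex at height `k + 1` emits a forward dart of layer `k`, and these have distinct
positions. -/
theorem layerSize_toMap {k : ℕ} (hk : k ≤ n) : P.toMap.layerSize (k + 1) = P.size k := by
  have hv : ∀ i : Fin (P.size k), P.Valid (fwd k i) := fun i => ⟨hk, i.2⟩
  rw [RootedMap.layerSize, ← Nat.card_fin (P.size k)]
  symm
  refine Nat.card_eq_of_bijective
    (fun i : Fin (P.size k) => ⟨P.toMap.vert (P.dart (fwd k i)), P.lev_dart (hv i)⟩) ⟨?_, ?_⟩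
  · intro i j hij
    have h1 := P.rawPos_eq_of_vert_eq (congrArg Subtype.val hij)
    rw [P.label_dart (hv i), P.label_dart (hv j)] at h1
    exact Fin.ext h1
  · rintro ⟨v, hv'⟩
    obtain ⟨d, rfl⟩ := RootedMap.exists_vert_eq v
    have h1 : rawLev (P.label d) = k + 1 := by rw [← lev_eq]; exact hv'
    obtain ⟨h2, h3⟩ := P.vert_eq_vert_fwd (P.valid_label d) hk h1
    rw [dart_label] at h3
    exact ⟨⟨_, h2⟩, Subtype.ext h3.symm⟩

end LayerData

/-! ### Faces of the constructed map and the axioms -/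

namespace RootedMap

variable {M : RootedMap}

theorem face_eq_iff_of_three {y : M.Dart}
    (h3 : M.faceStep (M.faceStep (M.faceStep y)) = y) (d : M.Dart) :
    M.face d = M.face y ↔ d = y ∨ d = M.faceStep y ∨ d = M.faceStep (M.faceStep y) := by
  constructor
  · intro h
    refine (face_eq_iff.1 h.symm).mem_of_closed
      (S := fun d => d = y ∨ d = M.faceStep y ∨ d = M.faceStep (M.faceStep y)) (Or.inl rfl) ?_
    rintro x (rfl | rfl | rfl)
    · exact Or.inr (Or.inl rfl)
    · exact Or.inr (Or.inr rfl)
    · exact Or.inl h3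
  · rintro (rfl | rfl | rfl) <;> simp

theorem faceDegree_of_three {y : M.Dart} (h3 : M.faceStep (M.faceStep (M.faceStep y)) = y)
    (hy : M.faceStep y ≠ y) : M.faceDegree (M.face y) = 3 := by
  have h2 : M.faceStep (M.faceStep y) ≠ y := fun h => by
    rw [h] at h3; exact hy h3
  have h1 : M.faceStep (M.faceStep y) ≠ M.faceStep y := fun h => hy (M.faceStep.injective h)
  rw [faceDegree, Nat.card_congr (Equiv.subtypeEquivRight fun d =>
      (face_eq_iff_of_three h3 d).trans (show _ ↔ d ∈ ({y, M.faceStep y,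
        M.faceStep (M.faceStep y)} : Finset M.Dart) by simp)), Nat.card_eq_fintype_card,
    Fintype.card_coe]
  exact Finset.card_eq_three.2 ⟨_, _, _, hy.symm, h2.symm, h1.symm, rfl⟩

end RootedMap

theorem Nat.card_subtype_eq_two {α : Type*} {p : α → Prop} {a b : α} (hab : a ≠ b)
    (h : ∀ x, p x ↔ x = a ∨ x = b) : Nat.card {x // p x} = 2 := by
  have : {x | p x} = {a, b} := Set.ext fun x => by simpa using h x
  change {x | p x}.ncard = 2
  rw [this, Set.ncard_pair hab]

theorem Nat.card_subtype_eq_one {α : Type*} {p : α → Prop} {a : α}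
    (h : ∀ x, p x ↔ x = a) : Nat.card {x // p x} = 1 := by
  have : {x | p x} = {a} := Set.ext fun x => by simpa using h x
  change {x | p x}.ncard = 1
  rw [this, Set.ncard_singleton]

namespace LayerData

variable {n : ℕ} (P : LayerData n)

open RawDart

theorem isHor_dart_iff {x : RawDart} (hx : P.Valid x) :
    P.toMap.IsHor (P.dart x) ↔ ∃ k i, x = back k i ∨ x = fwd k i := by
  rw [RootedMap.IsHor, P.flip_dart hx, P.lev_dart hx, P.lev_dart (P.valid_rawFlip hx)]
  cases x <;> simp [rawLev, rawFlip]

/-- The labels of the darts along the exterior face. -/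
def IsExterior (n : ℕ) (x : RawDart) : Prop := ∃ i, x = down n i 0 ∨ x = up n i 1

noncomputable def exteriorFace : P.toMap.Face := P.toMap.face (P.dart (down n 0 0))

theorem valid_down_top {i : ℕ} (hi : i < P.size n) : P.Valid (down n i 0) :=
  ⟨le_rfl, hi, Nat.zero_le _⟩

theorem valid_up_top {i : ℕ} (hi : i < P.size n) : P.Valid (up n i 1) :=
  ⟨le_rfl, hi, (P.deg_top i).ge⟩

theorem rawFace_down_top (i : ℕ) : P.rawFace (down n i 0) = up n i 1 :=
  P.rawFace_down (by rw [P.deg_top]; exact one_pos)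

theorem face_down_top {i : ℕ} (hi : i < P.size n) :
    P.toMap.face (P.dart (down n i 0)) = P.exteriorFace := by
  induction i with
  | zero => rfl
  | succ i ih =>
    have hi' : i < P.size n := by omega
    rw [← ih hi', ← RootedMap.face_faceStep (P.dart (down n i 0)),
      P.faceStep_dart (P.valid_down_top hi'), rawFace_down_top,
      ← RootedMap.face_faceStep (P.dart (up n i 1)), P.faceStep_dart (P.valid_up_top hi'),
      rawFace_up_top, next, if_neg hi.ne]

theorem face_dart_eq_iff {x : RawDart} (hx : P.Valid x) :
    P.toMap.face (P.dart x) = P.exteriorFace ↔ IsExterior n x := by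
  constructor
  · intro h
    have h1 : IsExterior n (P.label (P.dart x)) := by
      refine (RootedMap.face_eq_iff.1 h.symm).mem_of_closed
        (S := fun d => IsExterior n (P.label d)) ?_ ?_
      · rw [P.label_dart (P.valid_down_top (P.size_pos n le_rfl))]
        exact ⟨0, Or.inl rfl⟩
      · rintro d ⟨i, hd | hd⟩
        · rw [label_faceStep, hd, rawFace_down_top]
          exact ⟨i, Or.inr rfl⟩
        · rw [label_faceStep, hd, rawFace_up_top]
          exact ⟨_, Or.inl rfl⟩
    rwa [P.label_dart hx] at h1
  · rintro ⟨i, rfl | rfl⟩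
    · exact P.face_down_top hx.2.1
    · rw [← P.face_down_top hx.2.1, ← RootedMap.face_faceStep (P.dart (down n i 0)),
        P.faceStep_dart (P.valid_down_top hx.2.1), rawFace_down_top]

theorem rawFace_three {y : RawDart} (hy : P.Valid y) (hh : ∃ k i, y = back k i ∨ y = fwd k i) :
    P.rawFace (P.rawFace (P.rawFace y)) = y ∧
      (¬ ∃ k i, P.rawFace y = back k i ∨ P.rawFace y = fwd k i) ∧
      ¬ ∃ k i, P.rawFace (P.rawFace y) = back k i ∨ P.rawFace (P.rawFace y) = fwd k i := by
  match y, hy, hh with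
  | back 0 i, hy, _ =>
    rw [rawFace_back_zero, rawFace_cdown, rawFace_cup, P.prev_next]
    simp
  | back (k + 1) w, hy, _ =>
    have hk : k < n := hy.1
    obtain ⟨i, j, hi, hj, rfl⟩ := P.exists_offset_add hk.le hy.2
    rw [P.rawFace_back_succ hj, P.rawFace_down hj, P.rawFace_up_succ hk]
    simp
  | fwd k i, hy, _ =>
    rw [rawFace_fwd, rawFace_up_zero, rawFace_down_last, P.next_prev hy.2]
    simp

theorem exists_horizontal_of_not_isExterior {x : RawDart} (hx : P.Valid x)
    (he : ¬ IsExterior n x) : ∃ y, P.Valid y ∧ (∃ k i, y = back k i ∨ y = fwd k i) ∧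
      (x = y ∨ x = P.rawFace y ∨ x = P.rawFace (P.rawFace y)) := by
  match x, hx, he with
  | cup i, hx, _ =>
    exact ⟨back 0 (P.prev 0 i), ⟨Nat.zero_le _, P.prev_lt hx⟩, ⟨_, _, Or.inl rfl⟩,
      Or.inr (Or.inr (by rw [rawFace_back_zero, rawFace_cdown, P.next_prev hx]))⟩
  | cdown i, hx, _ =>
    exact ⟨back 0 i, ⟨Nat.zero_le _, hx⟩, ⟨_, _, Or.inl rfl⟩, Or.inr (Or.inl rfl)⟩
  | back k i, hx, _ => exact ⟨back k i, hx, ⟨_, _, Or.inl rfl⟩, Or.inl rfl⟩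
  | fwd k i, hx, _ => exact ⟨fwd k i, hx, ⟨_, _, Or.inr rfl⟩, Or.inl rfl⟩
  | up k i 0, hx, _ =>
    exact ⟨fwd k i, ⟨hx.1, hx.2.1⟩, ⟨_, _, Or.inr rfl⟩, Or.inr (Or.inl rfl)⟩
  | up k i (j + 1), hx, he =>
    have hk : k < n := by
      refine lt_of_le_of_ne hx.1 ?_
      rintro rfl
      have := hx.2.2
      rw [P.deg_top] at this
      obtain rfl : j = 0 := by omega
      exact he ⟨i, Or.inr rfl⟩
    have hj : j < P.deg k i := hx.2.2
    exact ⟨back (k + 1) (P.offset k i + j), ⟨hk, P.offset_add_lt hk.le hx.2.1 hj⟩,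
      ⟨_, _, Or.inl rfl⟩, Or.inr (Or.inr (by rw [P.rawFace_back_succ hj, P.rawFace_down hj]))⟩
  | down k i j, hx, he =>
    rcases hx.2.2.eq_or_lt with rfl | hj
    · refine ⟨fwd k (P.next k i), ⟨hx.1, P.next_lt hx.2.1⟩, ⟨_, _, Or.inr rfl⟩,
        Or.inr (Or.inr ?_)⟩
      rw [rawFace_fwd, rawFace_up_zero, P.prev_next]
    · have hk : k < n := by
        refine lt_of_le_of_ne hx.1 ?_
        rintro rfl
        rw [P.deg_top] at hj
        obtain rfl : j = 0 := by omega
        exact he ⟨i, Or.inl rfl⟩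
      exact ⟨back (k + 1) (P.offset k i + j), ⟨hk, P.offset_add_lt hk.le hx.2.1 hj⟩,
        ⟨_, _, Or.inl rfl⟩, Or.inr (Or.inl (P.rawFace_back_succ hj).symm)⟩

/-- Every face but the exterior one is the orbit of a horizontal dart. This yields at once that it
is a triangle and that it has exactly one horizontal side. -/
theorem exists_horizontal_of_ne {f : P.toMap.Face} (hf : f ≠ P.exteriorFace) :
    ∃ y, P.toMap.face y = f ∧ P.toMap.faceStep (P.toMap.faceStep (P.toMap.faceStep y)) = y ∧
      P.toMap.IsHor y ∧ ¬ P.toMap.IsHor (P.toMap.faceStep y) ∧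
      ¬ P.toMap.IsHor (P.toMap.faceStep (P.toMap.faceStep y)) := by
  obtain ⟨d, rfl⟩ := RootedMap.exists_face_eq f
  obtain ⟨x, hx, rfl⟩ := P.exists_dart_eq d
  obtain ⟨y, hy, hyh, hxy⟩ := P.exists_horizontal_of_not_isExterior hx
    fun h => hf ((P.face_dart_eq_iff hx).2 h)
  obtain ⟨h3, h4, h5⟩ := P.rawFace_three hy hyh
  have hy1 := P.valid_rawFace hy
  have hy2 := P.valid_rawFace hy1
  have e1 := P.faceStep_dart hy
  have e2 := P.faceStep_dart hy1
  have e3 := P.faceStep_dart hy2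
  refine ⟨P.dart y, ?_, ?_, ?_, ?_, ?_⟩
  · rcases hxy with rfl | rfl | rfl
    · rfl
    · rw [← e1, RootedMap.face_faceStep]
    · rw [← e2, ← e1, RootedMap.face_faceStep, RootedMap.face_faceStep]
  · rw [e1, e2, e3, h3]
  · exact (P.isHor_dart_iff hy).2 hyh
  · rw [e1]
    exact fun h => h4 ((P.isHor_dart_iff hy1).1 h)
  · rw [e1, e2]
    exact fun h => h5 ((P.isHor_dart_iff hy2).1 h)

theorem exists_fwd {v : P.toMap.Vertex} (h0 : 0 < P.toMap.height v)
    (h1 : P.toMap.height v < n + 2) :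
    ∃ k i, k ≤ n ∧ i < P.size k ∧ P.toMap.height v = k + 1 ∧
      v = P.toMap.vert (P.dart (fwd k i)) := by
  obtain ⟨d, rfl⟩ := RootedMap.exists_vert_eq v
  change 0 < P.toMap.lev d at h0
  change P.toMap.lev d < n + 2 at h1
  have hl := P.lev_eq d
  obtain ⟨h2, h3⟩ := P.vert_eq_vert_fwd (P.valid_label d)
    (k := P.toMap.lev d - 1) (by omega) (by omega)
  rw [dart_label] at h3
  exact ⟨_, _, by omega, h2, by change P.toMap.lev d = _; omega, h3⟩

theorem vert_fwd_next {k i : ℕ} (hk : k ≤ n) (hi : i < P.size k) :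
    P.toMap.target (P.dart (fwd k i)) = P.toMap.vert (P.dart (fwd k (P.next k i))) := by
  rw [RootedMap.target, P.flip_dart (x := fwd k i) ⟨hk, hi⟩]
  exact P.vert_back hk hi

theorem cycle_connected {k : ℕ} (h0 : 0 < k) (h1 : k < n + 2) :
    (P.toMap.graph.induce {v | P.toMap.height v = k}).Connected := by
  obtain ⟨k, rfl⟩ : ∃ m, k = m + 1 := ⟨k - 1, by omega⟩
  have hk : k ≤ n := by omega
  have hmem : ∀ i, i < P.size k → P.toMap.height (P.toMap.vert (P.dart (fwd k i))) = k + 1 :=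
    fun i hi => P.lev_dart (x := fwd k i) ⟨hk, hi⟩
  have key : ∀ i (hi : i < P.size k),
      (P.toMap.graph.induce {v | P.toMap.height v = k + 1}).Reachable
        ⟨P.toMap.vert (P.dart (fwd k 0)), hmem 0 (P.size_pos k hk)⟩
        ⟨P.toMap.vert (P.dart (fwd k i)), hmem i hi⟩ := by
    intro i
    induction i with
    | zero => intro _; rfl
    | succ i ih =>
      intro hi
      refine (ih (by omega)).trans ?_
      have hv := P.vert_fwd_next hk (show i < P.size k by omega)
      rw [next, if_neg hi.ne] at hv
      -- On a cycle of length one consecutive vertices coincide and the simple graph has no edge.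
      by_cases heq : P.toMap.vert (P.dart (fwd k i)) = P.toMap.vert (P.dart (fwd k (i + 1)))
      · simp only [heq]; rfl
      · exact SimpleGraph.Adj.reachable ⟨heq, P.dart (fwd k i), rfl, hv⟩
  have hne : Nonempty {v | P.toMap.height v = k + 1} := ⟨⟨_, hmem 0 (P.size_pos k hk)⟩⟩
  have key' : ∀ v : {v | P.toMap.height v = k + 1},
      (P.toMap.graph.induce {v | P.toMap.height v = k + 1}).Reachable
        ⟨P.toMap.vert (P.dart (fwd k 0)), hmem 0 (P.size_pos k hk)⟩ v := by
    rintro ⟨v, hv⟩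
    have hv' : P.toMap.height v = k + 1 := hv
    obtain ⟨k', i, hk', hi, hkk, rfl⟩ := P.exists_fwd (v := v) (by omega) (by omega)
    obtain rfl : k = k' := by omega
    exact key i hi
  exact ⟨fun v w => (key' v).symm.trans (key' w)⟩

theorem cycle_regular {v : P.toMap.Vertex} (h0 : 0 < P.toMap.height v)
    (h1 : P.toMap.height v < n + 2) :
    Nat.card {d // P.toMap.vert d = v ∧
      P.toMap.height (P.toMap.target d) = P.toMap.height v} = 2 := by
  obtain ⟨k, i, hk, hi, hkv, rfl⟩ := P.exists_fwd h0 h1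
  have hf : P.Valid (fwd k i) := ⟨hk, hi⟩
  have hb : P.Valid (back k (P.prev k i)) := ⟨hk, P.prev_lt hi⟩
  have hv : P.toMap.vert (P.dart (back k (P.prev k i))) = P.toMap.vert (P.dart (fwd k i)) := by
    rw [P.vert_back hk (P.prev_lt hi), P.next_prev hi]
  refine Nat.card_subtype_eq_two (a := P.dart (fwd k i)) (b := P.dart (back k (P.prev k i)))
    (fun h => by have := P.dart_injective hf hb h; simp at this) fun d => ⟨?_, ?_⟩
  · rintro ⟨hd, hd'⟩
    have hpos := P.rawPos_eq_of_vert_eq hd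
    have hlev : P.toMap.lev d = k + 1 := (congrArg P.toMap.height hd).trans hkv
    have hhor : P.toMap.IsHor d := hd'.trans (congrArg P.toMap.height hd).symm
    obtain ⟨x, hx, rfl⟩ := P.exists_dart_eq d
    rw [P.label_dart hx, P.label_dart hf] at hpos
    rw [P.lev_dart hx] at hlev
    obtain ⟨k', i', rfl | rfl⟩ := (P.isHor_dart_iff hx).1 hhor
    · obtain rfl : k' = k := by simp only [rawLev] at hlev; omega
      right
      simp only [rawPos] at hpos
      rw [← hpos, P.prev_next]
    · obtain rfl : k' = k := by simp only [rawLev] at hlev; omega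
      left
      simp only [rawPos] at hpos
      rw [hpos]
  · rintro (rfl | rfl)
    · exact ⟨rfl, (P.isHor_dart_iff hf).2 ⟨_, _, Or.inr rfl⟩⟩
    · refine ⟨hv, ?_⟩
      rw [← hv]
      exact (P.isHor_dart_iff hb).2 ⟨_, _, Or.inl rfl⟩

theorem wrap_offset_top {i : ℕ} (hi : i < P.size n) : P.wrap (n + 1) (P.offset n i) = i := by
  rw [offset_top, P.wrap_of_lt]
  rwa [size_top]

theorem wrap_offset_top_succ (i : ℕ) : P.wrap (n + 1) (P.offset n i + 1) = P.next n i := by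
  rw [offset_top, wrap, size_top, next]

theorem next_injective {k i j : ℕ} (h : P.next k i = P.next k j) : i = j := by
  rw [← P.prev_next k i, h, P.prev_next]

theorem exterior_simple {d e : P.toMap.Dart} (hd : P.toMap.face d = P.exteriorFace)
    (he : P.toMap.face e = P.exteriorFace) (h : P.toMap.vert d = P.toMap.vert e) : d = e := by
  have hpos := P.rawPos_eq_of_vert_eq h
  have hlev : P.toMap.lev d = P.toMap.lev e := congrArg P.toMap.height h
  obtain ⟨x, hx, rfl⟩ := P.exists_dart_eq d
  obtain ⟨y, hy, rfl⟩ := P.exists_dart_eq e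
  rw [P.label_dart hx, P.label_dart hy] at hpos
  rw [P.lev_dart hx, P.lev_dart hy] at hlev
  obtain ⟨i, rfl | rfl⟩ := (P.face_dart_eq_iff hx).1 hd <;>
    obtain ⟨j, rfl | rfl⟩ := (P.face_dart_eq_iff hy).1 he
  · simp only [rawPos, add_zero] at hpos
    rw [P.wrap_offset_top hx.2.1, P.wrap_offset_top hy.2.1] at hpos
    rw [hpos]
  · simp [rawLev] at hlev
  · simp [rawLev] at hlev
  · rw [P.next_injective hpos]

theorem exterior_alternates {d : P.toMap.Dart} (hd : P.toMap.face d = P.exteriorFace) :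
    (P.toMap.lev d = n + 2 ∧ P.toMap.lev (P.toMap.flip d) + 1 = n + 2) ∨
      (P.toMap.lev d + 1 = n + 2 ∧ P.toMap.lev (P.toMap.flip d) = n + 2) := by
  obtain ⟨x, hx, rfl⟩ := P.exists_dart_eq d
  rw [P.lev_dart hx, P.flip_dart hx, P.lev_dart (P.valid_rawFlip hx)]
  obtain ⟨i, rfl | rfl⟩ := (P.face_dart_eq_iff hx).1 hd
  · exact Or.inl ⟨rfl, rfl⟩
  · exact Or.inr ⟨rfl, rfl⟩

/-- At a top vertex the second ascending dart of one vertex of layer `n` meets the first one of the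
next vertex, and nothing else arrives. -/
theorem exists_vert_top {v : P.toMap.Vertex} (hv : P.toMap.height v = n + 2) :
    ∃ i, i < P.size n ∧ ∀ d, P.toMap.vert d = v ↔
      d = P.dart (down n (P.next n i) 0) ∨ d = P.dart (down n i 1) := by
  obtain ⟨d, rfl⟩ := RootedMap.exists_vert_eq v
  have hrot : ∀ i, i < P.size n → P.toMap.vert (P.dart (down n i 1)) =
      P.toMap.vert (P.dart (down n (P.next n i) 0)) := fun i hi => by
    have := P.vert_down_next le_rfl hi
    rwa [P.deg_top] at this
  have hcases : ∀ e, P.toMap.lev e = n + 2 → ∃ i, i < P.size n ∧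
      P.rawPos (P.label e) = P.next n i ∧
      (e = P.dart (down n (P.next n i) 0) ∨ e = P.dart (down n i 1)) := by
    intro e he
    obtain ⟨x, hx, rfl⟩ := P.exists_dart_eq e
    rw [P.lev_dart hx] at he
    obtain ⟨i, j, hi, hj, rfl⟩ := P.eq_down_of_rawLev_eq hx he
    rw [P.label_dart hx]
    obtain rfl | rfl : j = 0 ∨ j = 1 := by omega
    · refine ⟨P.prev n i, P.prev_lt hi, ?_, Or.inl ?_⟩
      · rw [P.next_prev hi]
        exact P.wrap_offset_top hi
      · rw [P.next_prev hi]
    · exact ⟨i, hi, P.wrap_offset_top_succ i, Or.inr rfl⟩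
  obtain ⟨i, hi, hpos, hdi⟩ := hcases d hv
  have hvd : P.toMap.vert d = P.toMap.vert (P.dart (down n i 1)) := by
    rcases hdi with rfl | rfl
    · exact (hrot i hi).symm
    · rfl
  refine ⟨i, hi, fun e => ⟨fun he => ?_, ?_⟩⟩
  · obtain ⟨i', hi', hpos', hei⟩ := hcases e ((congrArg P.toMap.height he).trans hv)
    rw [P.rawPos_eq_of_vert_eq he, hpos] at hpos'
    rwa [P.next_injective hpos']
  · rintro (rfl | rfl)
    · rw [hvd, hrot i hi]
    · exact hvd.symm

theorem top_vertex {v : P.toMap.Vertex} (hv : P.toMap.height v = n + 2) :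
    P.toMap.vertexDegree v = 2 ∧
      Nat.card {d // P.toMap.vert d = v ∧ P.toMap.face d ≠ P.exteriorFace} = 1 := by
  obtain ⟨i, hi, h⟩ := P.exists_vert_top hv
  have h0 : P.Valid (down n (P.next n i) 0) := P.valid_down_top (P.next_lt hi)
  have h1 : P.Valid (down n i 1) := ⟨le_rfl, hi, (P.deg_top i).ge⟩
  have hf0 := (P.face_dart_eq_iff h0).2 ⟨_, Or.inl rfl⟩
  have hf1 : P.toMap.face (P.dart (down n i 1)) ≠ P.exteriorFace := fun hf => by
    obtain ⟨j, hj | hj⟩ := (P.face_dart_eq_iff h1).1 hf <;> simp at hj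
  refine ⟨Nat.card_subtype_eq_two (fun heq => ?_) h, Nat.card_subtype_eq_one
    (a := P.dart (down n i 1)) fun d => ⟨?_, ?_⟩⟩
  · rw [heq] at hf0
    exact hf1 hf0
  · rintro ⟨hd, hd'⟩
    rcases (h d).1 hd with rfl | rfl
    · exact absurd hf0 hd'
    · rfl
  · rintro rfl
    exact ⟨(h _).2 (Or.inr rfl), hf1⟩

theorem isBanded_toMap : P.toMap.IsBanded (n + 2) P.exteriorFace where
  connected := P.connected
  height_le d := by
    rw [lev_eq]
    exact P.rawLev_le (P.valid_label d)
  height_attained :=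
    ⟨P.dart (down n 0 0), P.lev_dart (P.valid_down_top (P.size_pos n le_rfl))⟩
  center_loopless d hd hd' := by
    have h0 : P.toMap.height P.toMap.center = 0 := RootedMap.lev_root
    have h1 : P.toMap.lev d = 0 := (congrArg P.toMap.height hd).trans h0
    have h2 : P.toMap.lev (P.toMap.flip d) = 0 := (congrArg P.toMap.height hd').trans h0
    rw [lev_eq] at h1 h2
    obtain ⟨i, hi, hx⟩ := P.valid_of_rawLev_eq_zero (P.valid_label d) h1
    rw [label_flip, hx] at h2
    simp [rawFlip, rawLev] at h2
  cycle_connected _ h0 h1 := P.cycle_connected h0 h1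
  cycle_regular _ h0 h1 := P.cycle_regular h0 h1
  triangle f hf := by
    obtain ⟨y, rfl, h3, hy, hy1, -⟩ := P.exists_horizontal_of_ne hf
    exact RootedMap.faceDegree_of_three h3 fun h => by
      rw [h] at hy1
      exact hy1 hy
  exterior_simple _ _ := P.exterior_simple
  exterior_alternates _ := P.exterior_alternates
  top_vertex _ := P.top_vertex
  two_le := Nat.le_add_left _ _
  card_isHor_face f hf := by
    obtain ⟨y, rfl, h3, hy, hy1, hy2⟩ := P.exists_horizontal_of_ne hf
    refine Nat.card_subtype_eq_one (a := y) fun d => ⟨?_, ?_⟩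
    · rintro ⟨hd, hd'⟩
      rcases (RootedMap.face_eq_iff_of_three h3 d).1 hd with rfl | rfl | rfl
      · rfl
      · exact absurd hd' hy1
      · exact absurd hd' hy2
    · rintro rfl
      exact ⟨rfl, hy⟩

theorem isCausal_toMap : P.toMap.IsCausal (n + 2) :=
  (RootedMap.isCausal_iff_isBanded (Nat.le_add_left _ _)).2 ⟨_, P.isBanded_toMap⟩

end LayerData

/-! ### The plane forest of a causal triangulation -/

namespace RootedMap

variable {M : RootedMap}

/-- The number of ascending darts that follow a backward dart at its initial vertex. -/
noncomputable def numUp (M : RootedMap) (d : M.Dart) : ℕ := sInf {m | M.IsHor ((M.rot ^ (m + 1)) d)}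

/-- The next backward dart of the same cycle. -/
noncomputable def nextBack (M : RootedMap) (d : M.Dart) : M.Dart :=
  M.flip ((M.rot ^ (M.numUp d + 1)) d)

theorem rot_pow_succ (d : M.Dart) (j : ℕ) : M.rot ((M.rot ^ j) d) = (M.rot ^ (j + 1)) d := by
  rw [pow_succ', Equiv.Perm.mul_apply]

instance : Nonempty M.Dart := ⟨M.root⟩

namespace IsBanded

variable {h : ℕ} {f : M.Face}

section
variable (hM : M.IsBanded h f)
include hM

omit hM in
theorem isHor_rot_pow_numUp {b : M.Dart} (hb : M.IsHor b) :
    M.IsHor ((M.rot ^ (M.numUp b + 1)) b) := by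
  -- A full turn returns to `b`, so the set is nonempty and its infimum is attained.
  refine Nat.sInf_mem (s := {m | M.IsHor ((M.rot ^ (m + 1)) b)}) ⟨orderOf M.rot - 1, ?_⟩
  rw [Set.mem_ofPred_eq, Nat.sub_add_cancel (orderOf_pos M.rot), pow_orderOf_eq_one]
  exact hb

theorem isUp_rot_pow {b : M.Dart} (hb : M.IsBack b) {j : ℕ} (hj : j < M.numUp b) :
    M.IsUp ((M.rot ^ (j + 1)) b) := by
  induction j with
  | zero => simpa using isUp_rot_of_isHor hb.1 (hM.isFwd_flip hb).2
  | succ j ih =>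
    rw [← rot_pow_succ]
    refine (hM.isUp_rot (ih (by omega))).resolve_right fun h1 => ?_
    rw [rot_pow_succ] at h1
    exact Nat.notMem_of_lt_sInf hj h1.1

theorem isUp_rot_of_isBack {b : M.Dart} (hb : M.IsBack b) : M.IsUp (M.rot b) :=
  isUp_rot_of_isHor hb.1 (hM.isFwd_flip hb).2

theorem numUp_pos {b : M.Dart} (hb : M.IsBack b) : 0 < M.numUp b := by
  by_contra h0
  have h1 := isHor_rot_pow_numUp hb.1
  rw [Nat.eq_zero_of_not_pos h0] at h1
  exact (hM.isUp_rot_of_isBack hb).not_isHor (by simpa using h1)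

theorem isFwd_rot_pow_numUp {b : M.Dart} (hb : M.IsBack b) :
    M.IsFwd ((M.rot ^ (M.numUp b + 1)) b) := by
  have h0 := hM.numUp_pos hb
  have h1 := hM.isUp_rot_pow hb (show M.numUp b - 1 < M.numUp b by omega)
  rw [Nat.sub_add_cancel h0] at h1
  have h2 := hM.isUp_rot h1
  rw [rot_pow_succ] at h2
  exact h2.resolve_left fun h3 => h3.not_isHor (isHor_rot_pow_numUp hb.1)

theorem isBack_nextBack {b : M.Dart} (hb : M.IsBack b) : M.IsBack (M.nextBack b) :=
  hM.isBack_flip (hM.isFwd_rot_pow_numUp hb)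

omit hM in
theorem target_nextBack (b : M.Dart) : M.target (M.nextBack b) = M.vert b := by
  rw [nextBack, target_flip, vert_rot_pow]

theorem lev_nextBack {b : M.Dart} (hb : M.IsBack b) : M.lev (M.nextBack b) = M.lev b := by
  rw [← (hM.isBack_nextBack hb).1]
  exact congrArg M.height (target_nextBack b)

/-- This is the triangle on the forward dart that leaves the initial vertex of `b`. At its apex the
last ascending dart of this vertex meets the first one of the next vertex. -/
theorem faceStep_rot_nextBack {b : M.Dart} (hb : M.IsBack b) :
    M.faceStep (M.rot (M.nextBack b)) = M.flip ((M.rot ^ M.numUp b) b) := by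
  have h1 := hM.faceStep_three (hM.face_ne_of_isHor (hM.isFwd_rot_pow_numUp hb).1)
  have h2 : M.faceStep (M.flip ((M.rot ^ M.numUp b) b)) = (M.rot ^ (M.numUp b + 1)) b := by
    rw [faceStep_flip, rot_pow_succ]
  have h3 : M.faceStep ((M.rot ^ (M.numUp b + 1)) b) = M.rot (M.nextBack b) := rfl
  rw [h3, ← h2] at h1
  exact M.faceStep.injective h1

theorem target_rot_nextBack {b : M.Dart} (hb : M.IsBack b) :
    M.target (M.rot (M.nextBack b)) = M.target ((M.rot ^ M.numUp b) b) := by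
  rw [← vert_faceStep, hM.faceStep_rot_nextBack hb, target]

/-- Between two consecutive ascending darts there is a triangle based on the next cycle. -/
theorem faceStep_rot_of_isUp {u : M.Dart} (hu : M.IsUp u) (hu' : M.IsUp (M.rot u))
    (hlt : M.lev u + 1 < h) :
    M.IsBack (M.faceStep (M.rot u)) ∧ M.faceStep (M.faceStep (M.rot u)) = M.flip u ∧
      M.target (M.faceStep (M.rot u)) = M.target u := by
  have hf : M.face (M.flip u) ≠ f := hM.face_ne_of_lev (by
    rw [M.flip_flip]; exact Or.inr hlt)
  have h1 := hM.faceStep_three hf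
  rw [faceStep_flip] at h1
  have h2 : M.lev (M.faceStep (M.rot u)) = M.lev u + 1 := by
    rw [lev_faceStep, hu', lev_rot]
  refine ⟨⟨?_, fun h3 => ?_⟩, h1, ?_⟩
  · rw [IsHor, ← lev_faceStep, h1, h2]; exact hu
  · rw [ApexUp, h1, faceStep_flip, lev_rot] at h3
    omega
  · rw [← vert_faceStep, h1, target]

/-- Above the top cycle a corner between consecutive ascending darts lies in the exterior face,
since a triangle there would need a horizontal side at height `h`. Simplicity of the boundary allows
only one such corner per vertex. With a single ascending dart, both corners at its upper end would
lie in triangles, so that the end would miss the exterior face. -/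
theorem numUp_top {b : M.Dart} (hb : M.IsBack b) (hl : M.lev b + 1 = h) : M.numUp b = 2 := by
  have h0 := hM.numUp_pos hb
  have hup : ∀ j, j < M.numUp b → M.lev (M.flip ((M.rot ^ (j + 1)) b)) = h := fun j hj => by
    rw [hM.isUp_rot_pow hb hj, lev_rot_pow, hl]
  have hext : ∀ j, j + 1 < M.numUp b → M.face ((M.rot ^ (j + 2)) b) = f := by
    intro j hj
    have hface : M.face (M.flip ((M.rot ^ (j + 1)) b)) = M.face ((M.rot ^ (j + 2)) b) := by
      rw [← face_faceStep, faceStep_flip, rot_pow_succ]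
    by_contra hcon
    rw [← hface] at hcon
    have h1 := hM.faceStep_three hcon
    rw [faceStep_flip, rot_pow_succ] at h1
    have h2 : M.lev (M.faceStep ((M.rot ^ (j + 2)) b)) = h := by
      rw [lev_faceStep]; exact hup (j + 1) hj
    have h3 := hM.lev_flip_of_top h2
    rw [← lev_faceStep, h1, hup j (by omega)] at h3
    omega
  have h1 : M.numUp b ≠ 1 := by
    intro h1
    have hf := hM.isFwd_rot_pow_numUp hb
    rw [h1] at hf
    obtain ⟨d, hd, hdf⟩ := hM.exists_exterior (v := M.vert (M.flip (M.rot b)))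
      (show M.lev _ = h by simpa using hup 0 (by omega))
    have hw : M.lev (M.flip (M.rot b)) = h := by simpa using hup 0 (by omega)
    have hrr := hM.rot_rot_of_top hw
    have hS : d = M.flip (M.rot b) ∨ d = M.rot (M.flip (M.rot b)) := by
      refine (vert_eq_iff.1 hd.symm).mem_of_closed
        (S := fun d => d = M.flip (M.rot b) ∨ d = M.rot (M.flip (M.rot b))) (Or.inl rfl) ?_
      rintro x (rfl | rfl)
      · exact Or.inr rfl
      · exact Or.inl hrr
    rcases hS with rfl | rfl
    · rw [← face_faceStep, faceStep_flip] at hdf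
      exact hM.not_isHor_exterior hdf hf.1
    · rw [← faceStep_apply, face_faceStep, ← faceStep_flip, face_faceStep] at hdf
      exact hM.not_isHor_exterior hdf hb.1.flip
  have h2 : ¬ 2 < M.numUp b := by
    intro h2
    have h3 := hM.exterior_simple _ _ (hext 0 (by omega)) (hext 1 (by omega)) (by simp)
    have h4 : (M.rot ^ 2) b = (M.rot ^ 2) (M.rot b) := h3
    have h5 := hM.isUp_rot_of_isBack hb
    rw [← (M.rot ^ 2).injective h4] at h5
    exact h5.not_isHor hb.1
  omega

theorem faceStep_rot_rot_top {b : M.Dart} (hb : M.IsBack b) (hl : M.lev b + 1 = h) :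
    M.faceStep ((M.rot ^ 2) b) = M.flip (M.rot (M.nextBack b)) := by
  have h2 := hM.numUp_top hb hl
  have h1 := hM.faceStep_rot_nextBack hb
  rw [h2, faceStep_apply] at h1
  have hl2 : M.lev (M.flip (M.rot (M.nextBack b))) = h := by
    rw [hM.isUp_rot_of_isBack (hM.isBack_nextBack hb), lev_rot, hM.lev_nextBack hb, hl]
  rw [faceStep_apply, ← h1, hM.rot_rot_of_top hl2]

end

end IsBanded

/-- The first backward dart of each cycle. -/
noncomputable def base (M : RootedMap) : ℕ → M.Dart
  | 0 => Classical.epsilon fun t => M.IsBack t ∧ M.target t = M.target M.root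
  -- The numbering of a layer starts where the first ascending dart at the base of the layer below
  -- ends, in accordance with `offset k 0 = 0`.
  | k + 1 => Classical.epsilon fun t => M.IsBack t ∧ M.target t = M.target (M.rot (M.base k))

noncomputable def backDart (M : RootedMap) (k i : ℕ) : M.Dart := M.nextBack^[i] (M.base k)

/-- The number of children of a vertex in the plane forest of a causal triangulation. -/
noncomputable def childCount (M : RootedMap) (k i : ℕ) : ℕ := M.numUp (M.backDart k i) - 1

/-- Lengths are defined through child counts, not as lengths of the cycles; that they agree with the
latter is a consequence of the final isomorphism. Only layer 0 refers to an actual period. -/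
noncomputable def layerLength (M : RootedMap) : ℕ → ℕ
  | 0 => Function.minimalPeriod M.rot M.root
  | k + 1 => ∑ i ∈ Finset.range (M.layerLength k), M.childCount k i

noncomputable def childOffset (M : RootedMap) (k i : ℕ) : ℕ :=
  ∑ j ∈ Finset.range i, M.childCount k j

theorem backDart_succ (k i : ℕ) : M.backDart k (i + 1) = M.nextBack (M.backDart k i) :=
  Function.iterate_succ_apply' _ _ _

theorem target_backDart_succ (k i : ℕ) :
    M.target (M.backDart k (i + 1)) = M.vert (M.backDart k i) := by
  rw [backDart_succ, IsBanded.target_nextBack]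

theorem childOffset_succ (k i : ℕ) :
    M.childOffset k (i + 1) = M.childOffset k i + M.childCount k i := Finset.sum_range_succ _ _

theorem rot_pow_layerLength_zero : (M.rot ^ M.layerLength 0) M.root = M.root := by
  have := Function.iterate_minimalPeriod (f := M.rot) (x := M.root)
  rwa [Equiv.Perm.iterate_eq_pow] at this

theorem layerLength_zero_pos : 0 < M.layerLength 0 := by
  refine Function.IsPeriodicPt.minimalPeriod_pos (orderOf_pos M.rot) ?_
  rw [Function.IsPeriodicPt, Function.IsFixedPt, Equiv.Perm.iterate_eq_pow, pow_orderOf_eq_one]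
  rfl

namespace IsBanded

variable {n : ℕ} {f : M.Face} (hM : M.IsBanded (n + 2) f)
include hM

theorem isUp_rot_pow_root (i : ℕ) : M.IsUp ((M.rot ^ i) M.root) := by
  have h1 : M.lev ((M.rot ^ i) M.root) = 0 := by rw [lev_rot_pow, lev_root]
  rw [IsUp, hM.lev_flip_center h1, h1]

theorem base_spec {k : ℕ} (hk : k ≤ n) : M.IsBack (M.base k) ∧ M.lev (M.base k) = k + 1 ∧
    M.target (M.base k) = M.target (match k with | 0 => M.root | k + 1 => M.rot (M.base k)) := by
  have key : ∀ d : M.Dart, M.lev (M.flip d) = k + 1 →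
      let t := Classical.epsilon fun t => M.IsBack t ∧ M.target t = M.target d
      M.IsBack t ∧ M.lev t = k + 1 ∧ M.target t = M.target d := by
    intro d hd t
    obtain ⟨e, he, he'⟩ := hM.exists_isBack (v := M.target d)
      (by rw [height_target]; omega) (by rw [height_target]; omega)
    have h1 : M.IsBack t ∧ M.target t = M.target d :=
      Classical.epsilon_spec (p := fun t => M.IsBack t ∧ M.target t = M.target d) ⟨e, he', he⟩
    refine ⟨h1.1, ?_, h1.2⟩
    rw [← h1.1.1, ← hd]
    exact congrArg M.height h1.2
  cases k with
  | zero => exact key M.root (hM.lev_flip_center lev_root)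
  | succ k =>
    have ih := base_spec (k := k) (by omega)
    refine key (M.rot (M.base k)) ?_
    rw [hM.isUp_rot_of_isBack ih.1, lev_rot, ih.2.1]

theorem isBack_backDart {k : ℕ} (hk : k ≤ n) (i : ℕ) : M.IsBack (M.backDart k i) := by
  induction i with
  | zero => exact (hM.base_spec hk).1
  | succ i ih => rw [backDart_succ]; exact hM.isBack_nextBack ih

theorem lev_backDart {k : ℕ} (hk : k ≤ n) (i : ℕ) : M.lev (M.backDart k i) = k + 1 := by
  induction i with
  | zero => exact (hM.base_spec hk).2.1
  | succ i ih => rw [backDart_succ, hM.lev_nextBack (hM.isBack_backDart hk i), ih]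

theorem numUp_backDart {k : ℕ} (hk : k ≤ n) (i : ℕ) :
    M.numUp (M.backDart k i) = M.childCount k i + 1 :=
  (Nat.sub_add_cancel (hM.numUp_pos (hM.isBack_backDart hk i))).symm

theorem childCount_top (i : ℕ) : M.childCount n i = 1 := by
  rw [childCount, hM.numUp_top (hM.isBack_backDart le_rfl i) (by rw [hM.lev_backDart le_rfl])]

/-- Consecutive spokes at the centre bound a triangle based on the first cycle, so one turn of the
spoke advances the back dart by one. -/
theorem target_rot_pow_root (i : ℕ) :
    M.target ((M.rot ^ i) M.root) = M.target (M.backDart 0 i) ∧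
      M.faceStep ((M.rot ^ (i + 1)) M.root) = M.backDart 0 i := by
  have hstep : ∀ i, M.target ((M.rot ^ i) M.root) = M.target (M.backDart 0 i) →
      M.faceStep ((M.rot ^ (i + 1)) M.root) = M.backDart 0 i := by
    intro i hi
    have h1 := hM.isUp_rot_pow_root (i + 1)
    rw [← rot_pow_succ] at h1 ⊢
    have h2 := hM.faceStep_rot_of_isUp (hM.isUp_rot_pow_root i) h1
      (by rw [lev_rot_pow, lev_root]; omega)
    exact hM.eq_of_isBack h2.1 (hM.isBack_backDart (Nat.zero_le _) i) (h2.2.2.trans hi)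
  induction i with
  | zero => exact ⟨(hM.base_spec (Nat.zero_le _)).2.2.symm,
      hstep 0 (hM.base_spec (Nat.zero_le _)).2.2.symm⟩
  | succ i ih =>
    have h1 : M.target ((M.rot ^ (i + 1)) M.root) = M.target (M.backDart 0 (i + 1)) := by
      rw [← vert_faceStep, ih.2, target_backDart_succ]
    exact ⟨h1, hstep _ h1⟩

/-- Each triangle between consecutive ascending darts is based on the next back dart of the upper
cycle. A back dart is determined by its target, so the position advances by one per triangle. -/
theorem target_rot_pow_backDart_aux {k i w : ℕ} (hk : k < n)
    (hw : M.target (M.rot (M.backDart k i)) = M.target (M.backDart (k + 1) w)) {j : ℕ}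
    (hj : j ≤ M.childCount k i) :
    M.target ((M.rot ^ (j + 1)) (M.backDart k i)) = M.target (M.backDart (k + 1) (w + j)) ∧
      (j < M.childCount k i →
        M.faceStep ((M.rot ^ (j + 2)) (M.backDart k i)) = M.backDart (k + 1) (w + j)) := by
  have hnum := hM.numUp_backDart hk.le i
  have hb := hM.isBack_backDart hk.le i
  have hstep : ∀ j, M.target ((M.rot ^ (j + 1)) (M.backDart k i)) =
      M.target (M.backDart (k + 1) (w + j)) → j < M.childCount k i →
      M.faceStep ((M.rot ^ (j + 2)) (M.backDart k i)) = M.backDart (k + 1) (w + j) := by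
    intro j hj hlt
    have h1 := hM.isUp_rot_pow hb (j := j) (by omega)
    have h2 := hM.isUp_rot_pow hb (j := j + 1) (by omega)
    rw [← rot_pow_succ _ (j + 1)] at h2 ⊢
    have h3 := hM.faceStep_rot_of_isUp h1 h2
      (by rw [lev_rot_pow, hM.lev_backDart hk.le]; omega)
    exact hM.eq_of_isBack h3.1 (hM.isBack_backDart hk _) (h3.2.2.trans hj)
  induction j with
  | zero =>
    have h1 : M.target ((M.rot ^ (0 + 1)) (M.backDart k i)) =
        M.target (M.backDart (k + 1) (w + 0)) := by simpa using hw
    exact ⟨h1, hstep 0 h1⟩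
  | succ j ih =>
    have h1 : M.target ((M.rot ^ (j + 1 + 1)) (M.backDart k i)) =
        M.target (M.backDart (k + 1) (w + (j + 1))) := by
      rw [← vert_faceStep, (ih (by omega)).2 (by omega), ← add_assoc, target_backDart_succ]
    exact ⟨h1, hstep _ h1⟩

/-- The last ascending dart of a vertex and the first of its successor share their upper end, so the
starting position moves by the child count. -/
theorem target_rot_backDart {k : ℕ} (hk : k < n) (i : ℕ) :
    M.target (M.rot (M.backDart k i)) =
      M.target (M.backDart (k + 1) (M.childOffset k i)) := by
  induction i with
  | zero => exact (hM.base_spec (k := k + 1) hk).2.2.symm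
  | succ i ih =>
    rw [backDart_succ, hM.target_rot_nextBack (hM.isBack_backDart hk.le i),
      hM.numUp_backDart hk.le, (hM.target_rot_pow_backDart_aux hk ih le_rfl).1, childOffset_succ]

theorem faceStep_rot_pow_backDart {k i j : ℕ} (hk : k < n) (hj : j < M.childCount k i) :
    M.faceStep ((M.rot ^ (j + 2)) (M.backDart k i)) =
      M.backDart (k + 1) (M.childOffset k i + j) :=
  (hM.target_rot_pow_backDart_aux hk (hM.target_rot_backDart hk i) hj.le).2 hj

/-- A turn around cycle `k` carries the first ascending dart to itself. Its upper end has then moved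
through `layerLength (k + 1)` back darts of the next cycle. -/
theorem backDart_layerLength {k : ℕ} (hk : k ≤ n) :
    M.backDart k (M.layerLength k) = M.backDart k 0 := by
  induction k with
  | zero =>
    refine hM.eq_of_isBack (hM.isBack_backDart hk _) (hM.isBack_backDart hk _) ?_
    rw [← (hM.target_rot_pow_root _).1, ← (hM.target_rot_pow_root _).1, rot_pow_layerLength_zero]
    rfl
  | succ k ih =>
    refine hM.eq_of_isBack (hM.isBack_backDart hk _) (hM.isBack_backDart hk _) ?_
    have h1 := hM.target_rot_backDart hk (M.layerLength k)
    have h2 := hM.target_rot_backDart hk 0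
    rw [ih (by omega), h2] at h1
    exact h1.symm

theorem backDart_add_layerLength {k : ℕ} (hk : k ≤ n) (i : ℕ) :
    M.backDart k (i + M.layerLength k) = M.backDart k i := by
  rw [backDart, Function.iterate_add_apply]
  exact congrArg (M.nextBack^[i]) (hM.backDart_layerLength hk)

theorem backDart_mod_layerLength {k : ℕ} (hk : k ≤ n) (i : ℕ) :
    M.backDart k (i % M.layerLength k) = M.backDart k i := by
  have key : ∀ q r, M.backDart k (r + M.layerLength k * q) = M.backDart k r := by
    intro q
    induction q with
    | zero => intro r; rfl
    | succ q ih => intro r; rw [Nat.mul_succ, ← add_assoc, hM.backDart_add_layerLength hk, ih]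
  conv_rhs => rw [← Nat.mod_add_div i (M.layerLength k)]
  rw [key]

/-- If a layer had no children, each of its vertices would have one ascending dart and all these
would end at one vertex. The rotation there would meet only their reverses, never the horizontal
darts that an inner vertex carries. -/
theorem layerLength_pos {k : ℕ} (hk : k ≤ n) : 0 < M.layerLength k := by
  induction k with
  | zero => exact layerLength_zero_pos
  | succ k ih =>
    have hpos := ih (by omega)
    by_contra hcon
    have h0 : ∑ i ∈ Finset.range (M.layerLength k), M.childCount k i = 0 :=
      Nat.eq_zero_of_not_pos hcon
    rw [Finset.sum_eq_zero_iff] at h0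
    have hk' : k ≤ n := by omega
    have h1 : ∀ i, M.numUp (M.backDart k i) = 1 := by
      intro i
      rw [← hM.backDart_mod_layerLength hk', hM.numUp_backDart hk',
        h0 _ (Finset.mem_range.2 (Nat.mod_lt _ hpos))]
    have h2 : ∀ i, M.rot (M.flip (M.rot (M.backDart k (i + 1)))) =
        M.flip (M.rot (M.backDart k i)) := by
      intro i
      have := hM.faceStep_rot_nextBack (hM.isBack_backDart hk' i)
      rwa [h1, pow_one, ← backDart_succ] at this
    have h3 : M.vert (M.flip (M.rot (M.backDart k 0))) = M.vert (M.flip (M.backDart (k + 1) 0)) :=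
      hM.target_rot_backDart hk 0
    obtain ⟨i, hi⟩ : ∃ i, M.flip (M.backDart (k + 1) 0) = M.flip (M.rot (M.backDart k i)) := by
      refine (vert_eq_iff.1 h3).mem_of_closed
        (S := fun d => ∃ i, d = M.flip (M.rot (M.backDart k i))) ⟨0, rfl⟩ ?_
      rintro _ ⟨i, rfl⟩
      refine ⟨i + (M.layerLength k - 1), ?_⟩
      have h5 := h2 (i + (M.layerLength k - 1))
      rwa [add_assoc, Nat.sub_add_cancel hpos, hM.backDart_add_layerLength hk'] at h5
    have h4 := M.flip.injective hi
    have h5 := hM.isUp_rot_of_isBack (hM.isBack_backDart hk' i)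
    rw [← h4] at h5
    exact h5.not_isHor (hM.isBack_backDart hk 0).1

end IsBanded

end RootedMap

/-! ### A causal triangulation is rebuilt from its forest -/

namespace RootedMap

theorem forall_dart_of_closed {M : RootedMap} (hc : M.graph.Connected) {S : M.Dart → Prop}
    (hroot : S M.root) (hrot : ∀ d, S d → S (M.rot d)) (hflip : ∀ d, S d → S (M.flip d))
    (d : M.Dart) : S d := by
  have hvert : ∀ d e, M.vert d = M.vert e → S d → S e := fun d e hde hd =>
    (vert_eq_iff.1 hde).mem_of_closed hd hrot
  have key : ∀ v, M.graph.Reachable M.center v → ∀ e, M.vert e = v → S e := by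
    intro v hv
    rw [SimpleGraph.reachable_iff_reflTransGen] at hv
    induction hv with
    | refl => exact fun e he => hvert M.root e he.symm hroot
    | tail _ hadj ih =>
      obtain ⟨-, x, hx, hx'⟩ := hadj
      exact fun e he => hvert (M.flip x) e (hx'.trans he.symm) (hflip _ (ih x hx))
  exact key _ (hc.preconnected _ _) d rfl

/-- A morphism of rooted maps onto a connected map is an isomorphism if the root has only one
preimage. -/
theorem nonempty_iso_of_hom {N M : RootedMap} (hc : M.graph.Connected) (F : N.Dart → M.Dart)
    (hrot : ∀ d, F (N.rot d) = M.rot (F d)) (hflip : ∀ d, F (N.flip d) = M.flip (F d))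
    (hroot : F N.root = M.root) (huniq : ∀ d, F d = M.root → d = N.root) :
    Nonempty (Iso N M) := by
  have hsurj : Function.Surjective F :=
    forall_dart_of_closed hc (S := fun d => ∃ a, F a = d) ⟨_, hroot⟩
      (by rintro _ ⟨a, rfl⟩; exact ⟨_, hrot a⟩) (by rintro _ ⟨a, rfl⟩; exact ⟨_, hflip a⟩)
  -- Uniqueness of the preimage is carried from `d` to its images under `rot` and `flip`, which are
  -- bijective in `N` as well.
  have hinj : ∀ d a b, F a = d → F b = d → a = b := by
    refine forall_dart_of_closed hc (S := fun d => ∀ a b, F a = d → F b = d → a = b) ?_ ?_ ?_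
    · exact fun a b ha hb => (huniq a ha).trans (huniq b hb).symm
    · intro d hd a b ha hb
      obtain ⟨a, rfl⟩ := N.rot.surjective a
      obtain ⟨b, rfl⟩ := N.rot.surjective b
      rw [hrot] at ha hb
      rw [hd a b (M.rot.injective ha) (M.rot.injective hb)]
    · intro d hd a b ha hb
      obtain ⟨a, rfl⟩ := N.flip.surjective a
      obtain ⟨b, rfl⟩ := N.flip.surjective b
      rw [hflip] at ha hb
      rw [hd a b (M.flip.injective ha) (M.flip.injective hb)]
  exact ⟨⟨Equiv.ofBijective F ⟨fun a b hab => hinj _ a b hab rfl, hsurj⟩, hrot, hflip, hroot⟩⟩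

open LayerData.RawDart

/-- The dart of a causal triangulation with a given label. -/
noncomputable def labelled (M : RootedMap) : LayerData.RawDart → M.Dart
  | cup i => (M.rot ^ i) M.root
  | cdown i => M.flip ((M.rot ^ i) M.root)
  | back k i => M.backDart k i
  | fwd k i => M.flip (M.backDart k i)
  | up k i j => (M.rot ^ (j + 1)) (M.backDart k i)
  | down k i j => M.flip ((M.rot ^ (j + 1)) (M.backDart k i))

theorem labelled_rawFlip (M : RootedMap) (x : LayerData.RawDart) :
    M.labelled (LayerData.rawFlip x) = M.flip (M.labelled x) := by
  cases x <;> simp [labelled, LayerData.rawFlip, M.flip_flip]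

namespace IsBanded

variable {M : RootedMap} {n : ℕ} {f : M.Face}

theorem backDart_next (hM : M.IsBanded (n + 2) f) (P : LayerData n) {k i : ℕ} (hk : k ≤ n)
    (hsize : P.size k = M.layerLength k) :
    M.backDart k (P.next k i) = M.backDart k (i + 1) := by
  rw [LayerData.next]
  split_ifs with h
  · rw [h, hsize, hM.backDart_layerLength hk]
  · rfl

/-- The face rules of the model hold in every banded map. With `labelled_rawFlip` this makes the
labelling a morphism of maps. -/
theorem labelled_rawFace (hM : M.IsBanded (n + 2) f) (P : LayerData n)
    (hsize : ∀ k ≤ n, P.size k = M.layerLength k)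
    (hdeg : ∀ k ≤ n, ∀ i < P.size k, P.deg k i = M.childCount k i) {x : LayerData.RawDart}
    (hx : P.Valid x) : M.labelled (P.rawFace x) = M.faceStep (M.labelled x) := by
  have hoff : ∀ k ≤ n, ∀ i ≤ P.size k, P.offset k i = M.childOffset k i := fun k hk i hi =>
    Finset.sum_congr rfl fun j hj => hdeg k hk j (by rw [Finset.mem_range] at hj; omega)
  have hroot : ∀ i, M.backDart 0 i = M.faceStep ((M.rot ^ (i + 1)) M.root) := fun i =>
    (hM.target_rot_pow_root i).2.symm
  have hnext : ∀ i, (M.rot ^ (P.next 0 i)) M.root = (M.rot ^ (i + 1)) M.root := by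
    intro i
    rw [LayerData.next]
    split_ifs with h
    · rw [h, hsize 0 (Nat.zero_le _), rot_pow_layerLength_zero]
      rfl
    · rfl
  match x, hx with
  | cup i, hx =>
    change M.backDart 0 (P.prev 0 i) = M.faceStep ((M.rot ^ i) M.root)
    rw [hroot, ← hnext, P.next_prev hx]
  | cdown i, hx =>
    change (M.rot ^ (P.next 0 i)) M.root = M.faceStep (M.flip ((M.rot ^ i) M.root))
    rw [hnext, faceStep_flip, rot_pow_succ]
  | back 0 i, hx =>
    change M.flip ((M.rot ^ i) M.root) = M.faceStep (M.backDart 0 i)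
    have h1 := hM.isUp_rot_pow_root (i + 1)
    rw [← rot_pow_succ] at h1
    rw [hroot, ← rot_pow_succ, (hM.faceStep_rot_of_isUp (hM.isUp_rot_pow_root i) h1
      (by rw [lev_rot_pow, lev_root]; omega)).2.1]
  | back (k + 1) w, hx =>
    have hk : k < n := hx.1
    obtain ⟨i, j, hi, hj, rfl⟩ := P.exists_offset_add (k := k) hk.le hx.2
    rw [P.rawFace_back_succ hj]
    rw [hdeg k hk.le i hi] at hj
    have hb := hM.isBack_backDart hk.le i
    have hnum := hM.numUp_backDart hk.le i
    change M.flip ((M.rot ^ (j + 1)) (M.backDart k i)) =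
      M.faceStep (M.backDart (k + 1) (P.offset k i + j))
    have h1 := hM.isUp_rot_pow hb (j := j) (by omega)
    have h2 := hM.isUp_rot_pow hb (j := j + 1) (by omega)
    rw [← rot_pow_succ] at h2
    rw [hoff k hk.le i hi.le, ← hM.faceStep_rot_pow_backDart hk hj, ← rot_pow_succ _ (j + 1),
      (hM.faceStep_rot_of_isUp h1 h2 (by rw [lev_rot_pow, hM.lev_backDart hk.le]; omega)).2.1]
  | fwd k i, hx =>
    change (M.rot ^ 1) (M.backDart k i) = M.faceStep (M.flip (M.backDart k i))
    rw [faceStep_flip, pow_one]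
  | up k i 0, hx =>
    have hi := P.prev_lt hx.2.1
    change M.flip ((M.rot ^ (P.deg k (P.prev k i) + 1)) (M.backDart k (P.prev k i))) =
      M.faceStep ((M.rot ^ 1) (M.backDart k i))
    rw [hdeg k hx.1 _ hi, ← hM.numUp_backDart hx.1,
      ← hM.faceStep_rot_nextBack (hM.isBack_backDart hx.1 _), ← backDart_succ,
      ← hM.backDart_next P hx.1 (hsize k hx.1), P.next_prev hx.2.1, pow_one]
  | up k i (j + 1), hx =>
    have hj : j < M.childCount k i := by
      rw [← hdeg k hx.1 i hx.2.1]; exact hx.2.2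
    rcases hx.1.eq_or_lt with rfl | hk
    · rw [LayerData.rawFace_up_top]
      rw [hM.childCount_top] at hj
      obtain rfl : j = 0 := by omega
      change M.flip ((M.rot ^ 1) (M.backDart k (P.next k i))) =
        M.faceStep ((M.rot ^ 2) (M.backDart k i))
      rw [hM.backDart_next P le_rfl (hsize k le_rfl), pow_one, backDart_succ,
        hM.faceStep_rot_rot_top (hM.isBack_backDart le_rfl _)
          (by rw [hM.lev_backDart le_rfl])]
    · rw [P.rawFace_up_succ hk]
      change M.backDart (k + 1) (P.offset k i + j) =
        M.faceStep ((M.rot ^ (j + 2)) (M.backDart k i))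
      rw [hM.faceStep_rot_pow_backDart hk hj, hoff k hk.le i hx.2.1.le]
  | down k i j, hx =>
    have h1 : M.faceStep (M.labelled (down k i j)) = (M.rot ^ (j + 2)) (M.backDart k i) := by
      change M.faceStep (M.flip ((M.rot ^ (j + 1)) (M.backDart k i))) = _
      rw [faceStep_flip, rot_pow_succ]
    rw [h1]
    rcases hx.2.2.eq_or_lt with rfl | hj
    · rw [P.rawFace_down_last]
      change M.flip (M.backDart k (P.next k i)) = _
      rw [hM.backDart_next P hx.1 (hsize k hx.1), backDart_succ, nextBack, M.flip_flip,
        hM.numUp_backDart hx.1, hdeg k hx.1 i hx.2.1]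
    · rw [P.rawFace_down hj]
      rfl

/-- Only the labels `cup i` have level 0, and these give distinct darts because `layerLength 0` is
the minimal period. This single fibre is all that injectivity requires. -/
theorem eq_cup_zero_of_labelled_eq_root (hM : M.IsBanded (n + 2) f) (P : LayerData n)
    (hsize : ∀ k ≤ n, P.size k = M.layerLength k)
    (hdeg : ∀ k ≤ n, ∀ i < P.size k, P.deg k i = M.childCount k i) {x : LayerData.RawDart}
    (hx : P.Valid x) (hroot : M.labelled x = M.root) : x = cup 0 := by
  have hlev : M.lev (M.labelled x) = 0 := by rw [hroot, lev_root]
  match x, hx with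
  | cup i, hx =>
    have hi : i < Function.minimalPeriod M.rot M.root := by
      have h1 : i < P.size 0 := hx
      rwa [hsize 0 (Nat.zero_le _)] at h1
    have hper : Function.IsPeriodicPt M.rot i M.root := by
      rw [Function.IsPeriodicPt, Function.IsFixedPt, Equiv.Perm.iterate_eq_pow]
      exact hroot
    by_contra hne
    have := hper.minimalPeriod_le (Nat.pos_of_ne_zero fun h0 => hne (by rw [h0]))
    omega
  | cdown i, hx =>
    have h1 := hM.isUp_rot_pow_root i
    rw [IsUp] at h1
    change M.lev (M.flip ((M.rot ^ i) M.root)) = 0 at hlev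
    omega
  | back k i, hx =>
    change M.lev (M.backDart k i) = 0 at hlev
    rw [hM.lev_backDart hx.1] at hlev
    omega
  | fwd k i, hx =>
    change M.lev (M.flip (M.backDart k i)) = 0 at hlev
    rw [(hM.isBack_backDart hx.1 i).1, hM.lev_backDart hx.1] at hlev
    omega
  | up k i j, hx =>
    change M.lev ((M.rot ^ (j + 1)) (M.backDart k i)) = 0 at hlev
    rw [lev_rot_pow, hM.lev_backDart hx.1] at hlev
    omega
  | down k i j, hx =>
    have hj := hx.2.2
    rw [hdeg k hx.1 i hx.2.1] at hj
    have h1 := hM.isUp_rot_pow (hM.isBack_backDart hx.1 i) (j := j)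
      (by rw [hM.numUp_backDart hx.1]; omega)
    rw [IsUp] at h1
    change M.lev (M.flip ((M.rot ^ (j + 1)) (M.backDart k i))) = 0 at hlev
    omega

/-- A causal triangulation is determined by its plane forest. -/
theorem nonempty_iso (hM : M.IsBanded (n + 2) f) (P : LayerData n)
    (hsize : ∀ k ≤ n, P.size k = M.layerLength k)
    (hdeg : ∀ k ≤ n, ∀ i < P.size k, P.deg k i = M.childCount k i) :
    Nonempty (Iso P.toMap M) := by
  have hflip : ∀ d, M.labelled (P.label (P.toMap.flip d)) = M.flip (M.labelled (P.label d)) :=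
    fun d => by rw [P.label_flip, labelled_rawFlip]
  refine nonempty_iso_of_hom hM.connected (fun d => M.labelled (P.label d)) ?_ hflip ?_ ?_
  · intro d
    rw [← faceStep_flip, P.label_faceStep,
      hM.labelled_rawFace P hsize hdeg (P.valid_label _), hflip, faceStep_flip]
  · rw [P.root_eq, P.label_dart P.valid_root]
    rfl
  · intro d hd
    rw [P.root_eq, ← hM.eq_cup_zero_of_labelled_eq_root P hsize hdeg (P.valid_label d) hd,
      P.dart_label]

end IsBanded

end RootedMap

/-! ### Isomorphic maps come from the same forest -/

namespace LayerData

open RawDart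

section

variable {n : ℕ} {P P' : LayerData n} (e : RootedMap.Iso P.toMap P'.toMap)
include e

theorem size_eq_of_iso {k : ℕ} (hk : k ≤ n) : P.size k = P'.size k := by
  rw [← P.layerSize_toMap hk, ← P'.layerSize_toMap hk, e.layerSize_eq]

theorem lev_iso (d : P.toMap.Dart) : P'.toMap.lev (e.toEquiv d) = P.toMap.lev d :=
  e.height_eq (P.toMap.vert d)

theorem iso_rawFlip {x : RawDart} (hx : P.Valid x) (hx' : P'.Valid x)
    (h : e.toEquiv (P.dart x) = P'.dart x) :
    e.toEquiv (P.dart (rawFlip x)) = P'.dart (rawFlip x) := by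
  rw [← P.flip_dart hx, ← P'.flip_dart hx', ← h, e.map_flip]

theorem iso_rawFace {x : RawDart} (hx : P.Valid x) (hx' : P'.Valid x)
    (h : e.toEquiv (P.dart x) = P'.dart x) :
    e.toEquiv (P.dart (P.rawFace x)) = P'.dart (P'.rawFace x) := by
  rw [← P.faceStep_dart hx, ← P'.faceStep_dart hx', ← h, e.map_faceStep]

theorem iso_up {k i : ℕ} (hk : k ≤ n) (hi : i < P.size k)
    (h : e.toEquiv (P.dart (back k i)) = P'.dart (back k i)) {j : ℕ} (hj : j ≤ P.deg k i)
    (hj' : j ≤ P'.deg k i) : e.toEquiv (P.dart (up k i j)) = P'.dart (up k i j) := by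
  have hi' : i < P'.size k := by rwa [← size_eq_of_iso e hk]
  induction j with
  | zero =>
    exact iso_rawFace e (x := fwd k i) ⟨hk, hi⟩ ⟨hk, hi'⟩
      (iso_rawFlip e (x := back k i) ⟨hk, hi⟩ ⟨hk, hi'⟩ h)
  | succ j ih =>
    have hv : P.Valid (down k i j) := ⟨hk, hi, by omega⟩
    have hv' : P'.Valid (down k i j) := ⟨hk, hi', by omega⟩
    have := iso_rawFace e hv hv' (iso_rawFlip e (x := up k i j) hv hv' (ih (by omega) (by omega)))
    rwa [P.rawFace_down hj, P'.rawFace_down hj'] at this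

/-- Both rotations run through ascending darts in step. With unequal degrees one would reach its
forward dart while the other still ascends, but an isomorphism preserves heights. -/
theorem deg_eq_of_iso_back {k i : ℕ} (hk : k ≤ n) (hi : i < P.size k)
    (h : e.toEquiv (P.dart (back k i)) = P'.dart (back k i)) : P.deg k i = P'.deg k i := by
  have hi' : i < P'.size k := by rwa [← size_eq_of_iso e hk]
  have hlev : ∀ x y, P.Valid x → P'.Valid y → e.toEquiv (P.dart x) = P'.dart y →
      rawLev (rawFlip x) = rawLev (rawFlip y) := by
    intro x y hx hy hxy
    have h1 := lev_iso e (P.toMap.flip (P.dart x))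
    rw [e.map_flip, hxy, P.flip_dart hx, P'.flip_dart hy, P.lev_dart (P.valid_rawFlip hx),
      P'.lev_dart (P'.valid_rawFlip hy)] at h1
    exact h1.symm
  rcases lt_trichotomy (P.deg k i) (P'.deg k i) with hlt | heq | hlt
  · have h1 := iso_up e hk hi h le_rfl hlt.le
    have hv : P.Valid (down k i (P.deg k i)) := ⟨hk, hi, le_rfl⟩
    have hv' : P'.Valid (down k i (P.deg k i)) := ⟨hk, hi', hlt.le⟩
    have h2 := iso_rawFace e hv hv' (iso_rawFlip e (x := up _ _ _) hv hv' h1)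
    rw [P.rawFace_down_last, P'.rawFace_down hlt] at h2
    have h3 := hlev (fwd k (P.next k i)) (up k i (P.deg k i + 1)) ⟨hk, P.next_lt hi⟩
      ⟨hk, hi', hlt⟩ h2
    simp [rawLev, rawFlip] at h3
  · exact heq
  · have h1 := iso_up e hk hi h hlt.le le_rfl
    have hv : P.Valid (down k i (P'.deg k i)) := ⟨hk, hi, hlt.le⟩
    have hv' : P'.Valid (down k i (P'.deg k i)) := ⟨hk, hi', le_rfl⟩
    have h2 := iso_rawFace e hv hv' (iso_rawFlip e (x := up _ _ _) hv hv' h1)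
    rw [P.rawFace_down hlt, P'.rawFace_down_last] at h2
    have h3 := hlev (up k i (P'.deg k i + 1)) (fwd k (P'.next k i)) ⟨hk, hi, hlt⟩
      ⟨hk, P'.next_lt hi'⟩ h2
    simp [rawLev, rawFlip] at h3

/-- The image of the root fixes everything else: spokes determine the back darts of layer 0, and
equal degrees in one layer match the back darts of the next. -/
theorem iso_back {k : ℕ} (hk : k ≤ n) :
    ∀ i < P.size k, e.toEquiv (P.dart (back k i)) = P'.dart (back k i) := by
  have hsize := fun k (hk : k ≤ n) => size_eq_of_iso e hk
  induction k with
  | zero =>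
    have h0 := hsize 0 hk
    have hcup : ∀ i < P.size 0, e.toEquiv (P.dart (cup i)) = P'.dart (cup i) := by
      intro i
      induction i with
      | zero => intro _; rw [← root_eq, ← root_eq, e.map_root]
      | succ i ih =>
        intro hi
        have hv : P.Valid (cdown i) := show i < P.size 0 by omega
        have hv' : P'.Valid (cdown i) := show i < P'.size 0 by omega
        have := iso_rawFace e hv hv' (iso_rawFlip e (x := cup i) hv hv' (ih (by omega)))
        rwa [rawFace_cdown, rawFace_cdown, next, next, ← h0, if_neg hi.ne] at this
    intro i hi
    have hn := P.next_lt hi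
    have hn' : P'.next 0 i = P.next 0 i := by rw [next, next, h0]
    have := iso_rawFace e (x := cup (P.next 0 i)) hn (show _ < P'.size 0 by omega) (hcup _ hn)
    rwa [rawFace_cup, rawFace_cup, P.prev_next, ← hn', P'.prev_next] at this
  | succ k ih =>
    intro w hw
    have hk' : k < n := hk
    have ihk := ih hk'.le
    have hd : ∀ i < P.size k, P.deg k i = P'.deg k i := fun i hi =>
      deg_eq_of_iso_back e hk'.le hi (ihk i hi)
    obtain ⟨i, j, hi, hj, rfl⟩ := P.exists_offset_add hk'.le hw
    have hi' : i < P'.size k := by rwa [← hsize k hk'.le]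
    have hj' : j < P'.deg k i := by rwa [← hd i hi]
    have hoff : P.offset k i = P'.offset k i :=
      Finset.sum_congr rfl fun m hm => hd m (by rw [Finset.mem_range] at hm; omega)
    have := iso_rawFace e (x := up k i (j + 1)) ⟨hk'.le, hi, hj⟩ ⟨hk'.le, hi', hj'⟩
      (iso_up e hk'.le hi (ihk i hi) hj hj')
    rwa [P.rawFace_up_succ hk', P'.rawFace_up_succ hk', ← hoff] at this

theorem deg_eq_of_iso {k i : ℕ} (hk : k ≤ n) (hi : i < P.size k) : P.deg k i = P'.deg k i :=
  deg_eq_of_iso_back e hk hi (iso_back e hk i hi)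

end

end LayerData

/-! ### Plane forests as a recursive type and the bijection -/

/-- Plane forests of height at most `n` with `p` roots: the numbers of children of the roots and
the forest above them. -/
def PlaneForest : ℕ → ℕ → Type
  | 0, _ => Unit
  | n + 1, p => Σ c : Fin p → ℕ, PlaneForest n (∑ i, c i)

namespace PlaneForest

/-- The number of vertices at a given height. -/
def size : (n p : ℕ) → PlaneForest n p → ℕ → ℕ
  | 0, p, _, _ => p
  | _ + 1, p, _, 0 => p
  | n + 1, _, F, k + 1 => size n _ F.2 k

/-- The number of children of a vertex at a given height. -/
def deg : (n p : ℕ) → PlaneForest n p → ℕ → ℕ → ℕ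
  | 0, _, _, _, _ => 1
  | _ + 1, p, F, 0, i => if hi : i < p then F.1 ⟨i, hi⟩ else 0
  | n + 1, _, F, k + 1, i => deg n _ F.2 k i

theorem size_zero : ∀ (n p : ℕ) (F : PlaneForest n p), F.size n p 0 = p
  | 0, _, _ => rfl
  | _ + 1, _, _ => rfl

theorem deg_top : ∀ (n p : ℕ) (F : PlaneForest n p) (i : ℕ), F.deg n p n i = 1
  | 0, _, _, _ => rfl
  | n + 1, _, F, i => deg_top n _ F.2 i

theorem size_succ : ∀ (n p : ℕ) (F : PlaneForest n p), ∀ k ≤ n,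
    F.size n p (k + 1) = ∑ i ∈ Finset.range (F.size n p k), F.deg n p k i
  | 0, p, F, k, hk => by
    simp [size, deg]
  | n + 1, p, F, 0, hk => by
    change size n _ F.2 0 = ∑ i ∈ Finset.range p, if hi : i < p then F.1 ⟨i, hi⟩ else 0
    rw [size_zero, ← Fin.sum_univ_eq_sum_range (fun i => if hi : i < p then F.1 ⟨i, hi⟩ else 0)]
    simp
  | n + 1, p, F, k + 1, hk => size_succ n _ F.2 k (by omega)

theorem size_pos {n p : ℕ} (F : PlaneForest n p) (hF : 0 < F.size n p n) {k : ℕ} (hk : k ≤ n) :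
    0 < F.size n p k := by
  refine Nat.decreasingInduction' (P := fun k => 0 < F.size n p k) ?_ hk hF
  intro m hm _ hpos
  by_contra h0
  rw [F.size_succ n p m hm.le, Nat.eq_zero_of_not_pos h0] at hpos
  simp at hpos

def layerData {n p : ℕ} (F : PlaneForest n p) (hF : 0 < F.size n p n) : LayerData n where
  size := F.size n p
  deg := F.deg n p
  size_succ := F.size_succ n p
  size_pos _ hk := F.size_pos hF hk
  deg_top := F.deg_top n p

theorem eq_of_deg_eq : ∀ {n p : ℕ} {F F' : PlaneForest n p},
    (∀ k < n, ∀ i < F.size n p k, F.deg n p k i = F'.deg n p k i) → F = F'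
  | 0, _, _, _, _ => rfl
  | n + 1, p, ⟨c, F⟩, ⟨c', F'⟩, h => by
    obtain rfl : c = c' := by
      funext i
      have := h 0 (Nat.succ_pos n) i i.2
      simpa [deg] using this
    rw [eq_of_deg_eq (F := F) (F' := F') fun k hk i hi => h (k + 1) (by omega) i hi]

theorem exists_of_deg : ∀ (n p : ℕ) (s : ℕ → ℕ) (d : ℕ → ℕ → ℕ), s 0 = p →
    (∀ k < n, s (k + 1) = ∑ i ∈ Finset.range (s k), d k i) → (∀ i, d n i = 1) →
    ∃ F : PlaneForest n p, ∀ k ≤ n, F.size n p k = s k ∧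
      ∀ i < s k, F.deg n p k i = d k i
  | 0, p, s, d, h0, _, h2 => by
    refine ⟨(), fun k hk => ?_⟩
    obtain rfl : k = 0 := by omega
    exact ⟨h0.symm, fun i _ => (h2 i).symm⟩
  | n + 1, p, s, d, h0, h1, h2 => by
    obtain ⟨F, hF⟩ := exists_of_deg n (∑ i : Fin p, d 0 i) (fun k => s (k + 1))
      (fun k => d (k + 1))
      (by rw [h1 0 (Nat.succ_pos n), h0, Fin.sum_univ_eq_sum_range (fun i => d 0 i)])
      (fun k hk => h1 (k + 1) (by omega)) h2
    refine ⟨⟨fun i => d 0 i, F⟩, fun k hk => ?_⟩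
    cases k with
    | zero => exact ⟨h0.symm, fun i hi => dif_pos (h0 ▸ hi)⟩
    | succ k => exact hF k (by omega)

end PlaneForest

namespace CausalTriangulation

/-- Plane forests with vertices at height `n`. -/
abbrev Code (n : ℕ) : Type := {F : Σ p, PlaneForest n p // 0 < F.2.size n F.1 n}

noncomputable def ofCode {n : ℕ} (F : Code n) : CausalTriangulation (n + 2) :=
  Quotient.mk (causalSetoid (n + 2)) ⟨_, (F.1.2.layerData F.2).isCausal_toMap⟩

theorem ofCode_injective (n : ℕ) : Function.Injective (ofCode (n := n)) := by
  rintro ⟨⟨p, F⟩, hF⟩ ⟨⟨p', F'⟩, hF'⟩ h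
  obtain ⟨e⟩ : Nonempty (RootedMap.Iso (F.layerData hF).toMap (F'.layerData hF').toMap) :=
    Quotient.exact h
  obtain rfl : p = p' := by
    have := LayerData.size_eq_of_iso e (Nat.zero_le n)
    change F.size n p 0 = F'.size n p' 0 at this
    rwa [PlaneForest.size_zero, PlaneForest.size_zero] at this
  obtain rfl : F = F' := PlaneForest.eq_of_deg_eq fun k hk i hi =>
    LayerData.deg_eq_of_iso e hk.le hi
  rfl

theorem ofCode_surjective (n : ℕ) : Function.Surjective (ofCode (n := n)) := by
  intro G
  obtain ⟨⟨M, hM⟩, rfl⟩ := Quotient.exists_rep G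
  obtain ⟨f, hB⟩ := (RootedMap.isCausal_iff_isBanded (Nat.le_add_left _ _)).1 hM
  obtain ⟨F, hF⟩ := PlaneForest.exists_of_deg n _ M.layerLength M.childCount rfl
    (fun _ _ => rfl) hB.childCount_top
  have hpos : 0 < F.size n _ n := by
    rw [(hF n le_rfl).1]
    exact hB.layerLength_pos le_rfl
  refine ⟨⟨⟨_, F⟩, hpos⟩, Quotient.sound ?_⟩
  refine hB.nonempty_iso (F.layerData hpos) (fun k hk => (hF k hk).1) fun k hk i hi => ?_
  refine (hF k hk).2 i ?_
  rw [← (hF k hk).1]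
  exact hi

/-- Causal triangulations correspond to plane forests. -/
noncomputable def codeEquiv (n : ℕ) : Code n ≃ CausalTriangulation (n + 2) :=
  Equiv.ofBijective ofCode ⟨ofCode_injective n, ofCode_surjective n⟩

theorem layerSize_codeEquiv {n : ℕ} (F : Code n) {k : ℕ} (hk : k ≤ n) :
    (codeEquiv n F).layerSize (k + 1) = F.1.2.size n F.1.1 k :=
  (F.1.2.layerData F.2).layerSize_toMap hk

theorem area_codeEquiv {n : ℕ} (F : Code n) :
    (codeEquiv n F).area = ∑ k ∈ Finset.range (n + 1), 2 * F.1.2.size n F.1.1 k := by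
  change (F.1.2.layerData F.2).toMap.area = _
  rw [(F.1.2.layerData F.2).isBanded_toMap.area_eq, show Finset.Ioo 0 (n + 2) =
    Finset.Ico (0 + 1) (n + 1 + 1) from rfl, ← Finset.sum_Ico_add', Nat.Ico_zero_eq_range]
  refine Finset.sum_congr rfl fun k hk => ?_
  rw [(F.1.2.layerData F.2).layerSize_toMap (by rw [Finset.mem_range] at hk; omega)]
  rfl

end CausalTriangulation

/-! ### Generating functions of plane forests -/

section Series

variable {𝕜 : Type*} [RCLike 𝕜]

theorem HasSum.mul_of_norm {α β : Type*} {a b : 𝕜} {u : α → 𝕜} {v : β → 𝕜}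
    (hu : HasSum u a) (hv : HasSum v b) :
    HasSum (fun c : α × β => u c.1 * v c.2) (a * b) :=
  hu.mul hv (summable_mul_of_summable_norm (summable_norm_iff.2 hu.summable)
    (summable_norm_iff.2 hv.summable))

/-- Independent geometric series for `p` vertices; the second sum is `t d/dt` of the first. -/
theorem hasSum_pow_sum {t : 𝕜} (ht : ‖t‖ < 1) (p : ℕ) :
    HasSum (fun c : Fin p → ℕ => t ^ ∑ i, c i) ((1 - t)⁻¹ ^ p) ∧
      HasSum (fun c : Fin p → ℕ => ((∑ i, c i : ℕ) : 𝕜) * t ^ ∑ i, c i)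
        (p * t * (1 - t)⁻¹ ^ (p + 1)) := by
  induction p with
  | zero =>
    exact ⟨by simp, by simp⟩
  | succ p ih =>
    obtain ⟨h0, h1⟩ := ih
    have g0 := hasSum_geometric_of_norm_lt_one ht
    have g1 : HasSum (fun n : ℕ => (n : 𝕜) * t ^ n) (t / (1 - t) ^ 2) :=
      hasSum_coe_mul_geometric_of_norm_lt_one ht
    have k0 := g0.mul_of_norm h0
    have k1 := g1.mul_of_norm h0
    have k2 := g0.mul_of_norm h1
    let e : ℕ × (Fin p → ℕ) ≃ (Fin (p + 1) → ℕ) := Fin.consEquiv fun _ => ℕ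
    have he : ∀ c, ∑ i, e c i = c.1 + ∑ i, c.2 i := fun c => Fin.sum_univ_succ _
    refine ⟨e.hasSum_iff.1 ?_, e.hasSum_iff.1 ?_⟩
    · rw [pow_succ']
      convert k0 using 1
      ext c
      rw [Function.comp_apply, he, pow_add]
    · rw [show ((p + 1 : ℕ) : 𝕜) * t * (1 - t)⁻¹ ^ (p + 1 + 1) =
        t / (1 - t) ^ 2 * (1 - t)⁻¹ ^ p + (1 - t)⁻¹ * (p * t * (1 - t)⁻¹ ^ (p + 1)) by
          rw [div_eq_mul_inv, ← inv_pow]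
          push_cast
          ring]
      convert k1.add k2 using 1
      ext c
      rw [Function.comp_apply, he, pow_add]
      push_cast
      ring

instance (p : ℕ) : Unique (PlaneForest 0 p) := inferInstanceAs (Unique Unit)

namespace PlaneForest

/-- The generating function of the descendants of one vertex `n` layers below the top. -/
noncomputable def branch (g y : 𝕜) : ℕ → 𝕜
  -- A top vertex has `y / g` from the boundary and `g ^ 2` from two triangles.
  | 0 => y * g
  | n + 1 => g ^ 2 / (1 - branch g y n)

/-- The factor that marks a vertex of the top layer. -/
noncomputable def marking (g y : 𝕜) : ℕ → 𝕜
  | 0 => 1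
  | n + 1 => marking g y n * branch g y n * (1 - branch g y n)⁻¹

/-- The weight of a plane forest. -/
noncomputable def weight (g y : 𝕜) : (n p : ℕ) → PlaneForest n p → 𝕜
  | 0, p, _ => g ^ (2 * p) * (p * (y / g) ^ p)
  | n + 1, p, F => g ^ (2 * p) * weight g y n _ F.2

theorem weight_eq (g y : 𝕜) : ∀ (n p : ℕ) (F : PlaneForest n p), weight g y n p F =
    F.size n p n * (y / g) ^ F.size n p n * g ^ ∑ k ∈ Finset.range (n + 1), 2 * F.size n p k
  | 0, p, F => by
    simp [weight, size, mul_comm]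
  | n + 1, p, F => by
    have h1 : ∑ k ∈ Finset.range (n + 1 + 1), 2 * F.size (n + 1) p k =
        ∑ k ∈ Finset.range (n + 1), 2 * F.2.size n _ k + 2 * p := Finset.sum_range_succ' _ _
    rw [weight, weight_eq g y n _ F.2, h1, pow_add]
    change _ = F.2.size n _ n * (y / g) ^ F.2.size n _ n *
      (g ^ (∑ k ∈ Finset.range (n + 1), 2 * F.2.size n _ k) * g ^ (2 * p))
    ring

theorem norm_weight (g y : 𝕜) : ∀ (n p : ℕ) (F : PlaneForest n p),
    ‖weight g y n p F‖ = weight ‖g‖ ‖y‖ n p F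
  | 0, p, F => by simp [weight]
  | n + 1, p, F => by rw [weight, weight, norm_mul, norm_weight g y n _ F.2, norm_pow]

theorem weight_nonneg {g y : ℝ} (hg : 0 ≤ g) (hy : 0 ≤ y) : ∀ (n p : ℕ) (F : PlaneForest n p),
    0 ≤ weight g y n p F
  | 0, p, F => by rw [weight]; positivity
  | n + 1, p, F => mul_nonneg (by positivity) (weight_nonneg hg hy n _ F.2)

theorem half_lt_norm_one_sub {t : 𝕜} (ht : ‖t‖ < 1 / 2) : 1 / 2 < ‖1 - t‖ := by
  have h1 := norm_sub_norm_le (1 : 𝕜) t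
  rw [norm_one] at h1
  linarith

/-- The disc of radius `1 / 2` is mapped into itself by `t ↦ g ^ 2 / (1 - t)`, as `‖g‖ ^ 2 < 1 / 4`
and `‖1 - t‖ > 1 / 2`. -/
theorem norm_branch_lt {g y : 𝕜} (hg : ‖g‖ < 1 / 2) (hy : ‖y‖ < 1) (n : ℕ) :
    ‖branch g y n‖ < 1 / 2 := by
  induction n with
  | zero =>
    rw [branch, norm_mul]
    nlinarith [norm_nonneg g, norm_nonneg y]
  | succ n ih =>
    have h1 := half_lt_norm_one_sub ih
    rw [branch, norm_div, norm_pow, div_lt_iff₀ (by linarith)]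
    nlinarith [norm_nonneg g]

/-- Summing `(∑ c) t ^ (∑ c)` reproduces a factor `p`, so the shape `p * m * b ^ p` survives the
addition of a layer. This dictates the recursions of `branch` and `marking`. -/
theorem hasSum_weight_step {g y : 𝕜} (hg : ‖g‖ < 1 / 2) (hy : ‖y‖ < 1) (n p : ℕ) :
    HasSum (fun c : Fin p → ℕ => g ^ (2 * p) *
      ((∑ i, c i : ℕ) * marking g y n * branch g y n ^ ∑ i, c i))
      (p * marking g y (n + 1) * branch g y (n + 1) ^ p) := by
  have h1 := norm_branch_lt hg hy n
  have h2 := ((hasSum_pow_sum (h1.trans (by norm_num)) p).2.mul_left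
    (g ^ (2 * p) * marking g y n))
  convert! h2 using 1
  · funext c
    ring
  · rw [marking, branch, div_pow, ← pow_mul, div_eq_mul_inv, ← inv_pow]
    ring

/-- For nonnegative weights summability over the sigma type reduces to the fibres. Through
`norm_weight` this case supplies absolute convergence for all others. -/
theorem hasSum_weight_real {g y : ℝ} (hg0 : 0 ≤ g) (hy0 : 0 ≤ y) (hg : ‖g‖ < 1 / 2)
    (hy : ‖y‖ < 1) (hgne : g ≠ 0) :
    ∀ n p : ℕ, HasSum (weight g y n p) (p * marking g y n * branch g y n ^ p)
  | 0, p => by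
    convert! hasSum_unique (weight g y 0 p) using 1
    rw [weight, marking, branch, div_pow, mul_pow, mul_comm 2 p, pow_mul]
    field_simp
  | n + 1, p => by
    have hstep := hasSum_weight_step hg hy n p
    have hfib : ∀ c : Fin p → ℕ, HasSum (fun F => weight g y (n + 1) p ⟨c, F⟩)
        (g ^ (2 * p) * ((∑ i, c i : ℕ) * marking g y n * branch g y n ^ ∑ i, c i)) := fun c =>
      (hasSum_weight_real hg0 hy0 hg hy hgne n (∑ i, c i)).mul_left (g ^ (2 * p))
    refine HasSum.sigma_of_hasSum hstep hfib ?_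
    refine (summable_sigma_of_nonneg fun F => weight_nonneg hg0 hy0 (n + 1) p F).2
      ⟨fun c => (hfib c).summable, ?_⟩
    simp_rw [fun c => (hfib c).tsum_eq]
    exact hstep.summable

theorem summable_weight {g y : 𝕜} (hg : ‖g‖ < 1 / 2) (hy : ‖y‖ < 1) (hgne : g ≠ 0) (n p : ℕ) :
    Summable (weight g y n p) := by
  rw [← summable_norm_iff]
  simp_rw [norm_weight]
  exact (hasSum_weight_real (norm_nonneg g) (norm_nonneg y) (by simpa using hg)
    (by simpa using hy) (norm_ne_zero_iff.2 hgne) n p).summable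

theorem hasSum_weight {g y : 𝕜} (hg : ‖g‖ < 1 / 2) (hy : ‖y‖ < 1) (hgne : g ≠ 0) :
    ∀ n p : ℕ, HasSum (weight g y n p) (p * marking g y n * branch g y n ^ p)
  | 0, p => by
    convert! hasSum_unique (weight g y 0 p) using 1
    rw [weight, marking, branch, div_pow, mul_pow, mul_comm 2 p, pow_mul]
    field_simp
  | n + 1, p => by
    refine HasSum.sigma_of_hasSum (hasSum_weight_step hg hy n p) (fun c => ?_)
      (summable_weight hg hy hgne (n + 1) p)
    exact (hasSum_weight hg hy hgne n (∑ i, c i)).mul_left (g ^ (2 * p))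

theorem hasSum_weight_step_root {g y q : 𝕜} {n : ℕ} (hq : ‖q * branch g y n‖ < 1) :
    HasSum (fun p : ℕ => q ^ p * (p * marking g y n * branch g y n ^ p))
      (marking g y n * (q * branch g y n) / (1 - q * branch g y n) ^ 2) := by
  have h1 := (hasSum_coe_mul_geometric_of_norm_lt_one hq).mul_left (marking g y n)
  convert! h1 using 1
  · funext p
    rw [mul_pow]
    ring
  · ring

theorem hasSum_weight_sigma {g y q : 𝕜} (hg : ‖g‖ < 1 / 2) (hy : ‖y‖ < 1) (hgne : g ≠ 0) (n : ℕ)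
    (hq : ‖q * branch g y n‖ < 1) (hq' : ‖‖q‖ * branch ‖g‖ ‖y‖ n‖ < 1) :
    HasSum (fun F : Σ p, PlaneForest n p => q ^ F.1 * weight g y n F.1 F.2)
      (marking g y n * (q * branch g y n) / (1 - q * branch g y n) ^ 2) := by
  refine HasSum.sigma_of_hasSum (hasSum_weight_step_root hq)
    (fun p => (hasSum_weight hg hy hgne n p).mul_left (q ^ p)) ?_
  rw [← summable_norm_iff]
  have hfib : ∀ p : ℕ, HasSum (fun F : PlaneForest n p => ‖q ^ p * weight g y n p F‖)
      (‖q‖ ^ p * (p * marking ‖g‖ ‖y‖ n * branch ‖g‖ ‖y‖ n ^ p)) := by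
    intro p
    simp_rw [norm_mul, norm_pow, norm_weight]
    exact (hasSum_weight (by simpa using hg) (by simpa using hy) (norm_ne_zero_iff.2 hgne)
      n p).mul_left _
  refine (summable_sigma_of_nonneg fun F => norm_nonneg _).2 ⟨fun p => (hfib p).summable, ?_⟩
  simp_rw [fun p => (hfib p).tsum_eq]
  exact (hasSum_weight_step_root hq').summable

/-- One factor `g` cancels: what remains is `x * y` for `n = 0` and `x * g / (1 - b)` with `‖b‖ < 1
/ 2` otherwise. -/
theorem norm_div_mul_branch_lt {g x y : 𝕜} (hg : ‖g‖ < 1 / 2) (hx : ‖x‖ < 1) (hy : ‖y‖ < 1)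
    (hgne : g ≠ 0) (n : ℕ) : ‖x / g * branch g y n‖ < 1 := by
  cases n with
  | zero =>
    rw [branch, show x / g * (y * g) = x * y by field_simp, norm_mul]
    nlinarith [norm_nonneg x, norm_nonneg y]
  | succ n =>
    have h1 := half_lt_norm_one_sub (norm_branch_lt hg hy n)
    rw [branch, show x / g * (g ^ 2 / (1 - branch g y n)) = x * g / (1 - branch g y n) by
      field_simp, norm_div, norm_mul, div_lt_one (by linarith)]
    nlinarith [norm_nonneg x, norm_nonneg g]

/-! ### Linearisation of the continued fraction -/

section Recurrence

variable {g y : 𝕜} {D : ℕ → 𝕜}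

/-- The substitution `1 - branch = g D_{n+1} / D_n` turns the continued fraction into the linear
recurrence. That `D` has no zeros comes for free from `branch ≠ 1`. -/
theorem one_sub_branch (hg : ‖g‖ < 1 / 2) (hy : ‖y‖ < 1) (hgne : g ≠ 0) (h0 : D 0 ≠ 0)
    (h1 : D 1 = (g⁻¹ - y) * D 0) (h2 : ∀ j, D (j + 2) = g⁻¹ * D (j + 1) - D j) (n : ℕ) :
    D n ≠ 0 ∧ (1 - branch g y n) * D n = g * D (n + 1) := by
  have hne : ∀ n, 1 - branch g y n ≠ 0 := fun n => norm_pos_iff.1 (by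
    linarith [half_lt_norm_one_sub (norm_branch_lt hg hy n)])
  induction n with
  | zero =>
    refine ⟨h0, ?_⟩
    rw [h1, branch]
    field_simp
  | succ n ih =>
    have h3 : D (n + 1) ≠ 0 := fun h3 => by
      rw [h3, mul_zero] at ih
      exact mul_ne_zero (hne n) ih.1 ih.2
    refine ⟨h3, ?_⟩
    rw [h2, branch, sub_mul, mul_sub, mul_inv_cancel_left₀ hgne, one_mul, sub_right_inj,
      div_mul_eq_mul_div, div_eq_iff (hne n)]
    linear_combination -g * ih.2

/-- A telescoping product: each step contributes `(g / (1 - branch)) ^ 2 = (D_n / D_{n+1}) ^ 2`. -/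
theorem marking_mul_branch (hg : ‖g‖ < 1 / 2) (hy : ‖y‖ < 1) (hgne : g ≠ 0) (h0 : D 0 ≠ 0)
    (h1 : D 1 = (g⁻¹ - y) * D 0) (h2 : ∀ j, D (j + 2) = g⁻¹ * D (j + 1) - D j) (n : ℕ) :
    marking g y n * branch g y n = y * g * D 0 ^ 2 / D n ^ 2 := by
  induction n with
  | zero =>
    rw [marking, branch]
    field_simp
  | succ n ih =>
    obtain ⟨h3, h4⟩ := one_sub_branch hg hy hgne h0 h1 h2 n
    obtain ⟨h5, -⟩ := one_sub_branch hg hy hgne h0 h1 h2 (n + 1)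
    have h6 : 1 - branch g y n = g * D (n + 1) / D n := by rw [← h4]; field_simp
    rw [marking, branch, ih, h6]
    field_simp

end Recurrence

end PlaneForest

namespace CausalTriangulation

open PlaneForest

theorem annulusWeight_codeEquiv (g x y : 𝕜) {n : ℕ} (F : Code n) :
    annulusWeight g x y (codeEquiv n F) = (x / g) ^ F.1.1 * weight g y n F.1.1 F.1.2 := by
  rw [annulusWeight, weight_eq, area_codeEquiv, show n + 2 - 1 = n + 1 from rfl,
    layerSize_codeEquiv F le_rfl, layerSize_codeEquiv F (Nat.zero_le n), size_zero]
  ring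

theorem diskWeight_codeEquiv (g y : 𝕜) {n : ℕ} (F : Code n) :
    diskWeight g y (codeEquiv n F) = 1 ^ F.1.1 * weight g y n F.1.1 F.1.2 := by
  rw [diskWeight, weight_eq, area_codeEquiv, show n + 2 - 1 = n + 1 from rfl,
    layerSize_codeEquiv F le_rfl, one_pow, one_mul]

/-- Forests that die out below layer `n` code no triangulation, but the factor for the size of layer
`n` gives them weight 0. The sum may thus run over all forests. -/
theorem hasSum_codeEquiv_iff {n : ℕ} {w : CausalTriangulation (n + 2) → 𝕜} {q g y a : 𝕜}
    (hw : ∀ F, w (codeEquiv n F) = q ^ F.1.1 * weight g y n F.1.1 F.1.2) :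
    HasSum w a ↔ HasSum (fun F : Σ p, PlaneForest n p => q ^ F.1 * weight g y n F.1 F.2) a := by
  rw [← (codeEquiv n).hasSum_iff, ← hasSum_subtype_iff_of_support_subset
    (s := {F : Σ p, PlaneForest n p | 0 < F.2.size n F.1 n})]
  · exact iff_of_eq (congrArg (fun v => HasSum v a) (funext hw))
  · intro F hF
    by_contra h0
    have h1 : F.2.size n F.1 n = 0 := Nat.eq_zero_of_not_pos h0
    apply hF
    change q ^ F.1 * weight g y n F.1 F.2 = 0
    rw [weight_eq, h1]
    simp

variable {g x y : 𝕜} {D : ℕ → 𝕜}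

theorem hasSum_diskWeight (hg : ‖g‖ < 1 / 2) (hy : ‖y‖ < 1) (hgne : g ≠ 0) (h0 : D 0 ≠ 0)
    (h1 : D 1 = (g⁻¹ - y) * D 0) (h2 : ∀ j, D (j + 2) = g⁻¹ * D (j + 1) - D j) (n : ℕ) :
    D (n + 1) ≠ 0 ∧ HasSum (fun G : CausalTriangulation (n + 2) => diskWeight g y G)
      (g⁻¹ * (y * D 0 ^ 2 / D (n + 1) ^ 2)) := by
  obtain ⟨h3, h4⟩ := one_sub_branch hg hy hgne h0 h1 h2 n
  obtain ⟨h5, -⟩ := one_sub_branch hg hy hgne h0 h1 h2 (n + 1)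
  refine ⟨h5, (hasSum_codeEquiv_iff (diskWeight_codeEquiv g y)).2 ?_⟩
  convert! hasSum_weight_sigma (q := 1) hg hy hgne n ?_ ?_ using 1
  · have h6 : 1 - branch g y n = g * D (n + 1) / D n := by rw [← h4]; field_simp
    rw [one_mul, marking_mul_branch hg hy hgne h0 h1 h2, h6]
    field_simp
  · rw [one_mul]
    exact (norm_branch_lt hg hy n).trans (by norm_num)
  · rw [norm_one, one_mul]
    exact (norm_branch_lt (by simpa using hg) (by simpa using hy) n).trans (by norm_num)

/-- The expression `g⁻¹ * D n - D (n + 1)` stands for `D (n - 1)`, which has no natural index when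
`n = 0`. -/
theorem hasSum_annulusWeight (hg : ‖g‖ < 1 / 2) (hx : ‖x‖ < 1) (hy : ‖y‖ < 1) (hgne : g ≠ 0)
    (h0 : D 0 ≠ 0) (h1 : D 1 = (g⁻¹ - y) * D 0) (h2 : ∀ j, D (j + 2) = g⁻¹ * D (j + 1) - D j)
    (n : ℕ) :
    D n - x * (g⁻¹ * D n - D (n + 1)) ≠ 0 ∧
      HasSum (fun G : CausalTriangulation (n + 2) => annulusWeight g x y G)
        (x * y * D 0 ^ 2 / (D n - x * (g⁻¹ * D n - D (n + 1))) ^ 2) := by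
  obtain ⟨h3, h4⟩ := one_sub_branch hg hy hgne h0 h1 h2 n
  have hlt := norm_div_mul_branch_lt hg hx hy hgne n
  have hne : 1 - x / g * branch g y n ≠ 0 := fun h => by
    rw [← sub_eq_zero.1 h, norm_one] at hlt
    exact lt_irrefl _ hlt
  have h5 : D n - x * (g⁻¹ * D n - D (n + 1)) = D n * (1 - x / g * branch g y n) := by
    have h6 : D (n + 1) = g⁻¹ * ((1 - branch g y n) * D n) := by
      rw [h4, inv_mul_cancel_left₀ hgne]
    rw [h6]
    ring
  refine ⟨by rw [h5]; exact mul_ne_zero h3 hne,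
    (hasSum_codeEquiv_iff (annulusWeight_codeEquiv g x y)).2 ?_⟩
  convert! hasSum_weight_sigma (q := x / g) hg hy hgne n hlt ?_ using 1
  · rw [h5, mul_left_comm, marking_mul_branch hg hy hgne h0 h1 h2]
    field_simp
  · rw [norm_div]
    exact norm_div_mul_branch_lt (by simpa using hg) (by simpa using hx) (by simpa using hy)
      (norm_ne_zero_iff.2 hgne) n

end CausalTriangulation

end Series

/-! ### Closed forms with hyperbolic sines -/

namespace CausalTriangulation

section Recurrence

variable {𝕜 : Type*} [RCLike 𝕜] {g x y : 𝕜} {S : ℤ → 𝕜} {h : ℕ}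

theorem sub_mul_recurrence (hS : ∀ j, S (j + 1) = g⁻¹ * S j - S (j - 1)) (y : 𝕜) (j : ℕ) :
    S ((j + 2 : ℕ) + 1) - y * S (j + 2 : ℕ) =
      g⁻¹ * (S ((j + 1 : ℕ) + 1) - y * S (j + 1 : ℕ)) - (S (j + 1) - y * S j) := by
  have h2 := hS (j + 1)
  have h3 := hS (j + 2)
  rw [add_sub_cancel_right] at h2
  rw [add_sub_assoc, show (2 : ℤ) - 1 = 1 by norm_num] at h3
  rw [show ((j + 1 : ℕ) : ℤ) = j + 1 by push_cast; ring,
    show ((j + 2 : ℕ) : ℤ) = j + 2 by push_cast; ring]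
  rw [show (j : ℤ) + 1 + 1 = j + 2 by ring] at h2 ⊢
  linear_combination h3 - y * h2

/-- Since `S 0 = 0`, the combination `D j = S (j + 1) - y * S j` has the required initial ratio `g⁻¹
- y`. -/
theorem hasSum_diskWeight_of_recurrence (hh : 2 ≤ h) (hg : ‖g‖ < 1 / 2) (hy : ‖y‖ < 1)
    (hg0 : g ≠ 0) (h0 : S 0 = 0) (h1 : S 1 ≠ 0) (hS : ∀ j, S (j + 1) = g⁻¹ * S j - S (j - 1)) :
    S h - y * S (h - 1) ≠ 0 ∧ HasSum (fun G : CausalTriangulation h => diskWeight g y G)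
      (g⁻¹ * (y * S 1 ^ 2 / (S h - y * S (h - 1)) ^ 2)) := by
  obtain ⟨n, rfl⟩ := Nat.exists_eq_add_of_le' hh
  have key := hasSum_diskWeight (D := fun j => S (j + 1) - y * S j) hg hy hg0
    (by simpa [h0] using h1)
    (by
      have := hS 1
      simp only [sub_self, h0] at this
      simp only [Nat.cast_one, Nat.cast_zero, zero_add, h0, this]
      ring)
    (sub_mul_recurrence hS y) n
  have e1 : ((n + 1 : ℕ) : ℤ) + 1 = (n + 2 : ℕ) := by push_cast; ring
  have e2 : ((n + 2 : ℕ) : ℤ) - 1 = (n + 1 : ℕ) := by push_cast; ring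
  simpa only [e1, e2, Nat.cast_zero, zero_add, h0, mul_zero, sub_zero] using key

/-- The solution is indexed by integers because `h - 3 = -1` occurs for `h = 2`. -/
theorem hasSum_annulusWeight_of_recurrence (hh : 2 ≤ h) (hg : ‖g‖ < 1 / 2) (hx : ‖x‖ < 1)
    (hy : ‖y‖ < 1) (hg0 : g ≠ 0) (h0 : S 0 = 0) (h1 : S 1 ≠ 0)
    (hS : ∀ j, S (j + 1) = g⁻¹ * S j - S (j - 1)) :
    S (h - 1) - (x + y) * S (h - 2) + x * y * S (h - 3) ≠ 0 ∧
      HasSum (fun G : CausalTriangulation h => annulusWeight g x y G)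
        (x * y * S 1 ^ 2 / (S (h - 1) - (x + y) * S (h - 2) + x * y * S (h - 3)) ^ 2) := by
  obtain ⟨n, rfl⟩ := Nat.exists_eq_add_of_le' hh
  have key := hasSum_annulusWeight (D := fun j => S (j + 1) - y * S j) hg hx hy hg0
    (by simpa [h0] using h1)
    (by
      have := hS 1
      simp only [sub_self, h0] at this
      simp only [Nat.cast_one, Nat.cast_zero, zero_add, h0, this]
      ring)
    (sub_mul_recurrence hS y) n
  have e : S ((n + 2 : ℕ) - 1) - (x + y) * S ((n + 2 : ℕ) - 2) + x * y * S ((n + 2 : ℕ) - 3) =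
      S (n + 1) - y * S n -
        x * (g⁻¹ * (S (n + 1) - y * S n) - (S ((n + 1 : ℕ) + 1) - y * S (n + 1 : ℕ))) := by
    have h2 := hS (n + 1)
    have h3 := hS n
    rw [add_sub_cancel_right] at h2
    rw [show ((n + 2 : ℕ) : ℤ) - 1 = n + 1 by push_cast; ring,
      show ((n + 2 : ℕ) : ℤ) - 2 = n by push_cast; ring,
      show ((n + 2 : ℕ) : ℤ) - 3 = n - 1 by push_cast; ring, Nat.cast_add, Nat.cast_one, h2]
    linear_combination x * y * h3
  rw [e]
  simpa only [Nat.cast_zero, zero_add, h0, mul_zero, sub_zero] using key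

end Recurrence

section Complex

/-- A zero of `sinh` has `cosh θ ^ 2 = 1`, which puts `g` on the excluded circle `‖g‖ = 1 / 2`. -/
theorem sinh_ne_zero_of_norm_lt {g θ : ℂ} (hg : ‖g‖ < 1 / 2) (hθ : g⁻¹ = 2 * Complex.cosh θ) :
    Complex.sinh θ ≠ 0 := by
  intro h
  have h1 := Complex.cosh_sq θ
  rw [h, zero_pow two_ne_zero, zero_add] at h1
  have h2 : ‖Complex.cosh θ‖ = 1 := by
    have := congrArg norm h1
    rw [norm_pow, norm_one] at this
    exact (pow_eq_one_iff_of_nonneg (norm_nonneg _) two_ne_zero).1 this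
  have h3 := congrArg norm hθ
  rw [norm_inv, norm_mul, h2, RCLike.norm_ofNat] at h3
  have h4 : ‖g‖ = 1 / 2 := by rw [← inv_inv ‖g‖, h3]; norm_num
  linarith

theorem complex_sinh_recurrence (θ : ℂ) (j : ℤ) : Complex.sinh ((j + 1 : ℤ) * θ) =
    2 * Complex.cosh θ * Complex.sinh (j * θ) - Complex.sinh ((j - 1 : ℤ) * θ) := by
  push_cast
  rw [add_mul, sub_mul, one_mul, Complex.sinh_add, Complex.sinh_sub]
  ring

theorem real_sinh_recurrence (θ : ℝ) (j : ℤ) : Real.sinh ((j + 1 : ℤ) * θ) =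
    2 * Real.cosh θ * Real.sinh (j * θ) - Real.sinh ((j - 1 : ℤ) * θ) := by
  push_cast
  rw [add_mul, sub_mul, one_mul, Real.sinh_add, Real.sinh_sub]
  ring

variable {h : ℕ} {g θ x y : ℂ}

theorem hasSum_diskWeight_complex (hh : 2 ≤ h) (hg0 : g ≠ 0) (hg : ‖g‖ < 1 / 2)
    (hθ : g⁻¹ = 2 * Complex.cosh θ) (hy : ‖y‖ < 1) :
    Complex.sinh (h * θ) - y * Complex.sinh ((h - 1) * θ) ≠ 0 ∧
      HasSum (fun G : CausalTriangulation h => diskWeight g y G)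
        (2 * Complex.cosh θ * (y * Complex.sinh θ ^ 2 /
          (Complex.sinh (h * θ) - y * Complex.sinh ((h - 1) * θ)) ^ 2)) := by
  simpa [hθ] using hasSum_diskWeight_of_recurrence (S := fun j => Complex.sinh (j * θ)) hh hg hy
    hg0 (by simp) (by simpa using sinh_ne_zero_of_norm_lt hg hθ)
    (fun j => by rw [hθ]; exact complex_sinh_recurrence θ j)

theorem hasSum_annulusWeight_complex (hh : 2 ≤ h) (hg0 : g ≠ 0) (hg : ‖g‖ < 1 / 2)
    (hθ : g⁻¹ = 2 * Complex.cosh θ) (hx : ‖x‖ < 1) (hy : ‖y‖ < 1) :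
    Complex.sinh ((h - 1) * θ) - (x + y) * Complex.sinh ((h - 2) * θ)
        + x * y * Complex.sinh ((h - 3) * θ) ≠ 0 ∧
      HasSum (fun G : CausalTriangulation h => annulusWeight g x y G)
        (x * y * Complex.sinh θ ^ 2 /
          (Complex.sinh ((h - 1) * θ) - (x + y) * Complex.sinh ((h - 2) * θ)
            + x * y * Complex.sinh ((h - 3) * θ)) ^ 2) := by
  simpa [hθ] using hasSum_annulusWeight_of_recurrence (S := fun j => Complex.sinh (j * θ)) hh hg
    hx hy hg0 (by simp) (by simpa using sinh_ne_zero_of_norm_lt hg hθ)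
    (fun j => by rw [hθ]; exact complex_sinh_recurrence θ j)

end Complex

section Real

variable {h : ℕ} {θ x y : ℝ}

theorem norm_half_mul_inv_cosh_lt (hθ : 0 < θ) : ‖1 / 2 * (Real.cosh θ)⁻¹‖ < 1 / 2 := by
  rw [Real.norm_of_nonneg (by positivity)]
  have := inv_lt_one_of_one_lt₀ (Real.one_lt_cosh.2 hθ.ne')
  linarith

theorem inv_half_mul_inv_cosh (θ : ℝ) : (1 / 2 * (Real.cosh θ)⁻¹)⁻¹ = 2 * Real.cosh θ := by
  rw [mul_inv, inv_inv, one_div, inv_inv]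

theorem diskPartition_real (hh : 2 ≤ h) (hθ : 0 < θ) (hy : |y| < 1) :
    Real.sinh (h * θ) - y * Real.sinh ((h - 1) * θ) ≠ 0 ∧
      diskPartition (1 / 2 * (Real.cosh θ)⁻¹) y h =
        2 * Real.cosh θ * (y * Real.sinh θ ^ 2 /
          (Real.sinh (h * θ) - y * Real.sinh ((h - 1) * θ)) ^ 2) := by
  have hg := inv_half_mul_inv_cosh θ
  have key := hasSum_diskWeight_of_recurrence (S := fun j => Real.sinh (j * θ)) hh
    (norm_half_mul_inv_cosh_lt hθ) hy (by have := Real.cosh_pos θ; positivity) (by simp)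
    (by simpa using hθ.ne') (fun j => by rw [hg]; exact real_sinh_recurrence θ j)
  rw [hg] at key
  push_cast [one_mul] at key
  exact ⟨key.1, key.2.tsum_eq⟩

theorem annulusPartition_real (hh : 2 ≤ h) (hθ : 0 < θ) (hx : |x| < 1) (hy : |y| < 1) :
    annulusPartition (1 / 2 * (Real.cosh θ)⁻¹) x y h =
        x * y * Real.sinh θ ^ 2 /
          (Real.sinh ((h - 1) * θ) - (x + y) * Real.sinh ((h - 2) * θ)
            + x * y * Real.sinh ((h - 3) * θ)) ^ 2 := by
  have hg := inv_half_mul_inv_cosh θ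
  have key := hasSum_annulusWeight_of_recurrence (S := fun j => Real.sinh (j * θ)) hh
    (norm_half_mul_inv_cosh_lt hθ) hx hy (by have := Real.cosh_pos θ; positivity) (by simp)
    (by simpa using hθ.ne') (fun j => by rw [hg]; exact real_sinh_recurrence θ j)
  push_cast [one_mul] at key
  exact key.2.tsum_eq

end Real

end CausalTriangulation

/-! ### Scaling limits -/

namespace CausalTriangulation

section ScalingLimit

variable {Λ H c d : ℝ}

theorem tendsto_fst_scalingLimit (Λ H : ℝ) :
    Tendsto (fun p : ℝ × ℕ => p.1) (scalingLimit Λ H) (𝓝[>] 0) :=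
  tendsto_comap.mono_left inf_le_left

theorem tendsto_fst_scalingLimit_nhds (Λ H : ℝ) :
    Tendsto (fun p : ℝ × ℕ => p.1) (scalingLimit Λ H) (𝓝 0) :=
  (tendsto_fst_scalingLimit Λ H).mono_right nhdsWithin_le_nhds

theorem tendsto_mul_scalingLimit (Λ H : ℝ) :
    Tendsto (fun p : ℝ × ℕ => (p.2 : ℝ) * p.1) (scalingLimit Λ H) (𝓝 (H * √Λ)) := by
  have : Tendsto (fun p : ℝ × ℕ => p.1 * p.2) (scalingLimit Λ H) (𝓝 (H * √Λ)) :=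
    tendsto_comap.mono_left inf_le_right
  simpa only [mul_comm] using this

theorem eventually_pos_scalingLimit (Λ H : ℝ) : ∀ᶠ p in scalingLimit Λ H, 0 < p.1 :=
  (tendsto_fst_scalingLimit Λ H).eventually self_mem_nhdsWithin

theorem eventually_two_le_scalingLimit (hΛ : 0 < Λ) (hH : 0 < H) :
    ∀ᶠ p in scalingLimit Λ H, 2 ≤ p.2 := by
  have hpos : 0 < H * √Λ := mul_pos hH (Real.sqrt_pos.2 hΛ)
  have h1 := (tendsto_mul_scalingLimit Λ H).eventually_const_lt (half_lt_self hpos)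
  have h2 := (tendsto_fst_scalingLimit_nhds Λ H).eventually_lt_const
    (show 0 < H * √Λ / 2 / 2 by positivity)
  filter_upwards [h1, h2, eventually_pos_scalingLimit Λ H] with p h1 h2 h3
  by_contra hlt
  have h4 : (p.2 : ℝ) ≤ 1 := by exact_mod_cast (by omega : p.2 ≤ 1)
  nlinarith

theorem tendsto_one_sub_mul (c Λ H : ℝ) :
    Tendsto (fun p : ℝ × ℕ => 1 - c * p.1) (scalingLimit Λ H) (𝓝 1) := by
  simpa using ((tendsto_fst_scalingLimit_nhds Λ H).const_mul c).const_sub 1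

theorem eventually_abs_one_sub_mul_lt (hc : 0 < c) (Λ H : ℝ) :
    ∀ᶠ p in scalingLimit Λ H, 0 < 1 - c * p.1 ∧ |1 - c * p.1| < 1 := by
  filter_upwards [(tendsto_one_sub_mul c Λ H).eventually_const_lt one_pos,
    eventually_pos_scalingLimit Λ H] with p h1 h2
  refine ⟨h1, abs_lt.2 ⟨by linarith, by nlinarith⟩⟩

theorem tendsto_cosh_fst (Λ H : ℝ) :
    Tendsto (fun p : ℝ × ℕ => Real.cosh p.1) (scalingLimit Λ H) (𝓝 1) := by
  simpa [Function.comp_def] using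
    (Real.continuous_cosh.tendsto 0).comp (tendsto_fst_scalingLimit_nhds Λ H)

theorem tendsto_sinh_div (Λ H : ℝ) :
    Tendsto (fun p : ℝ × ℕ => Real.sinh p.1 / p.1) (scalingLimit Λ H) (𝓝 1) := by
  have h := (Real.hasDerivAt_sinh 0).tendsto_slope_zero_right
  simp only [zero_add, Real.sinh_zero, sub_zero, smul_eq_mul, Real.cosh_zero] at h
  refine (h.comp (tendsto_fst_scalingLimit Λ H)).congr fun p => ?_
  rw [Function.comp_apply, inv_mul_eq_div]

theorem tendsto_cosh_sub_one_div (Λ H : ℝ) :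
    Tendsto (fun p : ℝ × ℕ => (Real.cosh p.1 - 1) / p.1 ^ 2) (scalingLimit Λ H) (𝓝 (1 / 2)) := by
  have h := ((tendsto_sinh_div Λ H).pow 2).div ((tendsto_cosh_fst Λ H).add_const 1)
    (by norm_num)
  norm_num at h
  refine h.congr fun p => ?_
  have h1 : Real.cosh p.1 + 1 ≠ 0 := by have := Real.cosh_pos p.1; positivity
  rw [Pi.div_apply, div_pow, Real.sinh_sq, div_right_comm,
    show Real.cosh p.1 ^ 2 - 1 = (Real.cosh p.1 - 1) * (Real.cosh p.1 + 1) by ring,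
    mul_div_cancel_right₀ _ h1]

theorem tendsto_one_sub_mul_cosh_div (c Λ H : ℝ) :
    Tendsto (fun p : ℝ × ℕ => (1 - (1 - c * p.1) * Real.cosh p.1) / p.1) (scalingLimit Λ H)
      (𝓝 c) := by
  have h := (((tendsto_one_sub_mul c Λ H).mul (tendsto_fst_scalingLimit_nhds Λ H)).mul
    (tendsto_cosh_sub_one_div Λ H)).const_sub c
  rw [mul_zero, zero_mul, sub_zero] at h
  refine h.congr' ?_
  filter_upwards [eventually_pos_scalingLimit Λ H] with p hp
  field_simp
  ring

theorem tendsto_sinh_mul (Λ H : ℝ) : Tendsto (fun p : ℝ × ℕ => Real.sinh (p.2 * p.1))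
    (scalingLimit Λ H) (𝓝 (Real.sinh (H * √Λ))) :=
  (Real.continuous_sinh.tendsto _).comp (tendsto_mul_scalingLimit Λ H)

theorem tendsto_cosh_mul (Λ H : ℝ) : Tendsto (fun p : ℝ × ℕ => Real.cosh (p.2 * p.1))
    (scalingLimit Λ H) (𝓝 (Real.cosh (H * √Λ))) :=
  (Real.continuous_cosh.tendsto _).comp (tendsto_mul_scalingLimit Λ H)

/-- With `y = 1 - c θ`, the addition formula gives `(1 - y cosh θ) sinh hθ + y sinh θ cosh hθ`,
where both coefficients are of order `θ`. -/
theorem tendsto_disk_denominator (c Λ H : ℝ) :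
    Tendsto (fun p : ℝ × ℕ =>
      (Real.sinh (p.2 * p.1) - (1 - c * p.1) * Real.sinh ((p.2 - 1) * p.1)) / p.1)
      (scalingLimit Λ H) (𝓝 (c * Real.sinh (H * √Λ) + Real.cosh (H * √Λ))) := by
  have h := ((tendsto_one_sub_mul_cosh_div c Λ H).mul (tendsto_sinh_mul Λ H)).add
    (((tendsto_one_sub_mul c Λ H).mul (tendsto_cosh_mul Λ H)).mul (tendsto_sinh_div Λ H))
  rw [one_mul, mul_one] at h
  refine h.congr fun p => ?_
  rw [sub_one_mul, Real.sinh_sub]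
  ring

/-- The `θ`-derivative of the disk denominator at fixed `y`. The factor `h` of order `1 / θ`
multiplies `cosh hθ - y cosh (h-1)θ`, which is of order `θ`; the term `y cosh (h-1)θ` is left over.
-/
theorem tendsto_disk_denominator_deriv (c Λ H : ℝ) :
    Tendsto (fun p : ℝ × ℕ =>
      p.2 * Real.cosh (p.2 * p.1) - (1 - c * p.1) * ((p.2 - 1) * Real.cosh ((p.2 - 1) * p.1)))
      (scalingLimit Λ H) (𝓝 (H * √Λ * (c * Real.cosh (H * √Λ) + Real.sinh (H * √Λ)) +
        Real.cosh (H * √Λ))) := by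
  have h0 : Tendsto (fun p : ℝ × ℕ => Real.cosh ((p.2 - 1) * p.1)) (scalingLimit Λ H)
      (𝓝 (Real.cosh (H * √Λ))) := by
    refine (Real.continuous_cosh.tendsto _).comp ?_
    simpa [sub_one_mul] using
      (tendsto_mul_scalingLimit Λ H).sub (tendsto_fst_scalingLimit_nhds Λ H)
  have h := ((tendsto_mul_scalingLimit Λ H).mul
    (((tendsto_one_sub_mul_cosh_div c Λ H).mul (tendsto_cosh_mul Λ H)).add
    (((tendsto_one_sub_mul c Λ H).mul (tendsto_sinh_mul Λ H)).mul (tendsto_sinh_div Λ H)))).add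
    ((tendsto_one_sub_mul c Λ H).mul h0)
  rw [one_mul, mul_one, one_mul] at h
  refine h.congr' ?_
  filter_upwards [eventually_pos_scalingLimit Λ H] with p hp
  rw [sub_one_mul (p.2 : ℝ) p.1, Real.cosh_sub]
  field_simp
  ring

/-- Expanding around `a = (h - 2) θ` gives `((1 + x y)(cosh θ - 1) + (1 - x)(1 - y)) sinh a + (1 - x
y) sinh θ cosh a`. Both coefficients are of order `θ ^ 2`, with limits `1 + c d` and `c + d`. -/
theorem tendsto_annulus_denominator (c d Λ H : ℝ) :
    Tendsto (fun p : ℝ × ℕ =>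
      (Real.sinh ((p.2 - 1) * p.1) - (1 - c * p.1 + (1 - d * p.1)) * Real.sinh ((p.2 - 2) * p.1)
        + (1 - c * p.1) * (1 - d * p.1) * Real.sinh ((p.2 - 3) * p.1)) / p.1 ^ 2)
      (scalingLimit Λ H)
      (𝓝 ((c * d + 1) * Real.sinh (H * √Λ) + (c + d) * Real.cosh (H * √Λ))) := by
  have hs : Tendsto (fun p : ℝ × ℕ => (p.2 - 2) * p.1) (scalingLimit Λ H) (𝓝 (H * √Λ)) := by
    simpa [sub_mul] using
      (tendsto_mul_scalingLimit Λ H).sub ((tendsto_fst_scalingLimit_nhds Λ H).const_mul 2)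
  have h1 := (Real.continuous_sinh.tendsto _).comp hs
  have h2 := (Real.continuous_cosh.tendsto _).comp hs
  have hx := tendsto_one_sub_mul c Λ H
  have hy := tendsto_one_sub_mul d Λ H
  have h := (((((hx.mul hy).const_add 1).mul (tendsto_cosh_sub_one_div Λ H)).const_add
    (c * d)).mul h1).add ((((tendsto_fst_scalingLimit_nhds Λ H).const_mul (c * d)).const_sub
      (c + d)).mul ((tendsto_sinh_div Λ H).mul h2))
  norm_num at h
  refine h.congr' ?_
  filter_upwards [eventually_pos_scalingLimit Λ H] with p hp
  have e1 : ((p.2 : ℝ) - 1) * p.1 = (p.2 - 2) * p.1 + p.1 := by ring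
  have e3 : ((p.2 : ℝ) - 3) * p.1 = (p.2 - 2) * p.1 - p.1 := by ring
  rw [e1, e3, Real.sinh_add, Real.sinh_sub]
  field_simp
  ring

end ScalingLimit

end CausalTriangulation

namespace CausalTriangulation

section Limits

variable {Λ H X Y c d : ℝ}

/-- In applications `c = Y / √Λ`. The powers of `θ` in `sinh θ` and in the denominator cancel. -/
theorem tendsto_diskPartition (hΛ : 0 < Λ) (hH : 0 < H) (hc : 0 < c) :
    Tendsto (fun p : ℝ × ℕ => diskPartition (1 / 2 * (Real.cosh p.1)⁻¹) (1 - c * p.1) p.2)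
      (scalingLimit Λ H)
      (𝓝 (2 / (c * Real.sinh (H * √Λ) + Real.cosh (H * √Λ)) ^ 2)) := by
  have hs : 0 < Real.sinh (H * √Λ) := Real.sinh_pos_iff.2 (by positivity)
  have hch := Real.cosh_pos (H * √Λ)
  have h := ((tendsto_cosh_fst Λ H).const_mul 2).mul ((tendsto_one_sub_mul c Λ H).mul
    (((tendsto_sinh_div Λ H).div (tendsto_disk_denominator c Λ H) (by positivity)).pow 2))
  have e : (2 * 1 * (1 * (1 / (c * Real.sinh (H * √Λ) + Real.cosh (H * √Λ))) ^ 2) : ℝ) =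
      2 / (c * Real.sinh (H * √Λ) + Real.cosh (H * √Λ)) ^ 2 := by
    rw [div_pow]; ring
  rw [e] at h
  refine h.congr' ?_
  filter_upwards [eventually_pos_scalingLimit Λ H, eventually_two_le_scalingLimit hΛ hH,
    eventually_abs_one_sub_mul_lt hc Λ H] with p hp h2 hy
  rw [(diskPartition_real h2 hp hy.2).2, Pi.div_apply, div_div_div_cancel_right₀ hp.ne', div_pow,
    mul_div_assoc]

theorem tendsto_annulusPartition (hΛ : 0 < Λ) (hH : 0 < H) (hc : 0 < c) (hd : 0 < d) :
    Tendsto (fun p : ℝ × ℕ => p.1 ^ 2 *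
        annulusPartition (1 / 2 * (Real.cosh p.1)⁻¹) (1 - c * p.1) (1 - d * p.1) p.2)
      (scalingLimit Λ H)
      (𝓝 (1 / ((c * d + 1) * Real.sinh (H * √Λ) + (c + d) * Real.cosh (H * √Λ)) ^ 2)) := by
  have hs : 0 < Real.sinh (H * √Λ) := Real.sinh_pos_iff.2 (by positivity)
  have hch := Real.cosh_pos (H * √Λ)
  have h := ((tendsto_one_sub_mul c Λ H).mul (tendsto_one_sub_mul d Λ H)).mul
    (((tendsto_sinh_div Λ H).div (tendsto_annulus_denominator c d Λ H) (by positivity)).pow 2)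
  rw [one_mul, one_mul, div_pow, one_pow] at h
  refine h.congr' ?_
  filter_upwards [eventually_pos_scalingLimit Λ H, eventually_two_le_scalingLimit hΛ hH,
    eventually_abs_one_sub_mul_lt hc Λ H, eventually_abs_one_sub_mul_lt hd Λ H]
    with p hp h2 hx hy
  rw [annulusPartition_real h2 hp hx.2 hy.2, Pi.div_apply]
  generalize Real.sinh ((p.2 - 1) * p.1) -
    (1 - c * p.1 + (1 - d * p.1)) * Real.sinh ((p.2 - 2) * p.1) +
    (1 - c * p.1) * (1 - d * p.1) * Real.sinh ((p.2 - 3) * p.1) = E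
  rw [show Real.sinh p.1 / p.1 / (E / p.1 ^ 2) = p.1 * (Real.sinh p.1 / E) by field_simp]
  rw [mul_pow, div_pow]
  ring

end Limits

/-! ### The average area and the Hausdorff dimension -/

section AverageArea

variable {θ y : ℝ} {h : ℕ}

/-- The logarithmic derivative of the disk partition function, as a function of `θ`. -/
theorem hasDerivAt_log_disk (hθ : 0 < θ) (hy : y ≠ 0)
    (hD : Real.sinh (h * θ) - y * Real.sinh ((h - 1) * θ) ≠ 0) :
    HasDerivAt (fun t => Real.log (2 * Real.cosh t * (y * Real.sinh t ^ 2 /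
        (Real.sinh (h * t) - y * Real.sinh ((h - 1) * t)) ^ 2)))
      (Real.sinh θ / Real.cosh θ + 2 * (Real.cosh θ / Real.sinh θ) -
        2 * ((h * Real.cosh (h * θ) - y * ((h - 1) * Real.cosh ((h - 1) * θ))) /
          (Real.sinh (h * θ) - y * Real.sinh ((h - 1) * θ)))) θ := by
  have hs : Real.sinh θ ≠ 0 := (Real.sinh_pos_iff.2 hθ).ne'
  have hc : Real.cosh θ ≠ 0 := (Real.cosh_pos θ).ne'
  have hm : ∀ a : ℝ, HasDerivAt (fun t => Real.sinh (a * t)) (a * Real.cosh (a * θ)) θ := fun a => by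
    have := ((hasDerivAt_id θ).const_mul a).sinh
    simpa [mul_comm] using this
  have hd := (hm h).sub ((hm (h - 1)).const_mul y)
  have hf := ((Real.hasDerivAt_cosh θ).const_mul 2).mul
    ((((Real.hasDerivAt_sinh θ).pow 2).const_mul y).div (hd.pow 2) (pow_ne_zero 2 hD))
  have hl := hf.log (by simp [hs, hc, hy]; exact hD)
  convert! hl using 1
  simp only [Pi.mul_apply, Pi.div_apply, Pi.sub_apply, Pi.pow_apply]
  generalize Real.sinh (h * θ) - y * Real.sinh ((h - 1) * θ) = D at hD ⊢
  field_simp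
  ring

/-- Chain rule: for `g = 1 / (2 cosh θ)` one has `g dθ/dg = -cosh θ / sinh θ`, with `arcosh` as the
local inverse. -/
theorem averageArea_eq (hh : 2 ≤ h) (hθ : 0 < θ) (hy0 : y ≠ 0) (hy : |y| < 1) :
    averageArea (1 / 2 * (Real.cosh θ)⁻¹) y h =
      Real.cosh θ / Real.sinh θ *
        (2 * ((h * Real.cosh (h * θ) - y * ((h - 1) * Real.cosh ((h - 1) * θ))) /
          (Real.sinh (h * θ) - y * Real.sinh ((h - 1) * θ))) -
        2 * (Real.cosh θ / Real.sinh θ) - Real.sinh θ / Real.cosh θ) := by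
  have hs : 0 < Real.sinh θ := Real.sinh_pos_iff.2 hθ
  have hc : 0 < Real.cosh θ := Real.cosh_pos θ
  have h1 : 1 < Real.cosh θ := Real.one_lt_cosh.2 hθ.ne'
  set g := 1 / 2 * (Real.cosh θ)⁻¹ with hg
  have hg0 : 0 < g := by positivity
  have hgc : 1 / 2 * g⁻¹ = Real.cosh θ := by rw [hg, inv_half_mul_inv_cosh]; ring
  have hA : HasDerivAt (fun t : ℝ => Real.arcosh (1 / 2 * t⁻¹))
      ((Real.sinh θ)⁻¹ * (1 / 2 * (-(g ^ 2)⁻¹))) g := by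
    have h2 := Real.hasDerivAt_arcosh (x := 1 / 2 * g⁻¹) (by rw [hgc]; exact h1)
    have h3 := h2.comp g ((hasDerivAt_inv hg0.ne').const_mul (1 / 2))
    rw [hgc, ← Real.sinh_sq, Real.sqrt_sq hs.le] at h3
    exact h3
  have hAg : Real.arcosh (1 / 2 * g⁻¹) = θ := by rw [hgc, Real.arcosh_cosh hθ.le]
  have hD := hasDerivAt_log_disk hθ hy0 (diskPartition_real hh hθ hy).1
  rw [← hAg] at hD
  have hcomp := hD.comp g hA
  rw [hAg] at hcomp
  -- The derivative requires the closed form in a neighbourhood of `g`, where `1 / (2 t)` stays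
  -- above 1 and is a hyperbolic cosine.
  have hev : ∀ᶠ t in 𝓝 g, 1 < 1 / 2 * t⁻¹ := by
    refine Tendsto.eventually_const_lt ?_ (continuousAt_const.mul (continuousAt_inv₀ hg0.ne'))
    rw [← hgc] at h1
    exact h1
  have hder := hcomp.congr_of_eventuallyEq (f₁ := fun t => Real.log (diskPartition t y h)) <| by
    filter_upwards [hev] with t ht
    have h4 := (diskPartition_real hh (Real.arcosh_pos ht) hy).2
    rw [Real.cosh_arcosh ht.le, mul_inv, inv_inv, ← mul_assoc, one_div, inv_inv,
      inv_mul_cancel₀ two_ne_zero, one_mul] at h4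
    rw [h4, Function.comp_apply, one_div, Real.cosh_arcosh (by rw [← one_div]; exact ht.le)]
  rw [averageArea, hder.deriv]
  have hg2 : g * (g ^ 2)⁻¹ = 2 * Real.cosh θ := by
    rw [← inv_half_mul_inv_cosh, ← hg]; field_simp
  rw [show ∀ L : ℝ, g * (L * ((Real.sinh θ)⁻¹ * (1 / 2 * -(g ^ 2)⁻¹))) =
    g * (g ^ 2)⁻¹ * (-1 / 2 * L * (Real.sinh θ)⁻¹) from fun L => by ring, hg2]
  ring

end AverageArea

end CausalTriangulation

/-- Mean value theorem; the bound makes the limit of `θ ^ 2 ⟨Δ⟩` positive. -/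
theorem Real.sinh_le_self_mul_cosh {s : ℝ} (hs : 0 ≤ s) : Real.sinh s ≤ s * Real.cosh s := by
  rcases hs.eq_or_lt with rfl | hs
  · simp
  obtain ⟨t, ht, h⟩ := exists_deriv_eq_slope Real.sinh hs Real.continuous_sinh.continuousOn
    Real.differentiable_sinh.differentiableOn
  rw [Real.deriv_sinh, Real.sinh_zero, sub_zero, sub_zero, eq_div_iff hs.ne'] at h
  rw [← h, mul_comm]
  refine mul_le_mul_of_nonneg_left (Real.cosh_le_cosh.2 ?_) hs.le
  rw [abs_of_pos ht.1, abs_of_pos hs]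
  exact ht.2.le

namespace CausalTriangulation

variable {Λ H c : ℝ}

/-- The limit is `2 (Q - 1)`, where `Q` is the quotient of the limits of
`tendsto_disk_denominator_deriv` and `tendsto_disk_denominator`. With `s = H √Λ`, `Q > 1` follows
from `sinh s ≤ s cosh s`. Positivity matters because logarithms are taken next. -/
theorem tendsto_sq_mul_averageArea (hΛ : 0 < Λ) (hH : 0 < H) (hc : 0 < c) :
    ∃ C : ℝ, 0 < C ∧ Tendsto (fun p : ℝ × ℕ => p.1 ^ 2 *
        averageArea (1 / 2 * (Real.cosh p.1)⁻¹) (1 - c * p.1) p.2) (scalingLimit Λ H) (𝓝 C) := by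
  have hs : 0 < H * √Λ := by positivity
  have hsh : 0 < Real.sinh (H * √Λ) := Real.sinh_pos_iff.2 hs
  have hch := Real.cosh_pos (H * √Λ)
  have hθ := tendsto_fst_scalingLimit_nhds Λ H
  have hC := tendsto_cosh_fst Λ H
  have hS : Tendsto (fun p : ℝ × ℕ => (Real.sinh p.1 / p.1)⁻¹) (scalingLimit Λ H) (𝓝 1) := by
    simpa using (tendsto_sinh_div Λ H).inv₀ one_ne_zero
  have hQ := (tendsto_disk_denominator_deriv c Λ H).div (tendsto_disk_denominator c Λ H)
    (by positivity)
  have hT := hθ.mul ((hθ.mul (tendsto_sinh_div Λ H)).div hC one_ne_zero)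
  have h := (hC.mul hS).mul (((hQ.const_mul 2).sub ((hC.mul hS).const_mul 2)).sub hT)
  refine ⟨_, ?_, h.congr' ?_⟩
  · have h1 := Real.sinh_le_self_mul_cosh hs.le
    have h2 : 1 < (H * √Λ * (c * Real.cosh (H * √Λ) + Real.sinh (H * √Λ)) +
        Real.cosh (H * √Λ)) / (c * Real.sinh (H * √Λ) + Real.cosh (H * √Λ)) := by
      rw [one_lt_div (by positivity)]
      nlinarith [mul_le_mul_of_nonneg_left h1 hc.le, mul_pos hs hsh]
    norm_num
    linarith
  · filter_upwards [eventually_pos_scalingLimit Λ H, eventually_two_le_scalingLimit hΛ hH,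
      eventually_abs_one_sub_mul_lt hc Λ H] with p hp h2 hy
    rw [averageArea_eq h2 hp hy.1.ne' hy.2]
    have hne := (diskPartition_real h2 hp hy.2).1
    have hs' : Real.sinh p.1 ≠ 0 := (Real.sinh_pos_iff.2 hp).ne'
    have hc' : Real.cosh p.1 ≠ 0 := (Real.cosh_pos p.1).ne'
    simp only [Pi.div_apply]
    generalize Real.sinh (p.2 * p.1) - (1 - c * p.1) * Real.sinh ((p.2 - 1) * p.1) = D at hne ⊢
    field_simp

/-- After division by `-log θ` the numerator is `2 - log (θ ^ 2 ⟨Δ⟩) / log θ` and the denominator `1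
- log (h θ) / log θ`. Both inner logarithms converge while `log θ → -∞`. -/
theorem tendsto_log_averageArea_div_log (hΛ : 0 < Λ) (hH : 0 < H) (hc : 0 < c) :
    Tendsto (fun p : ℝ × ℕ =>
      Real.log (averageArea (1 / 2 * (Real.cosh p.1)⁻¹) (1 - c * p.1) p.2) / Real.log p.2)
      (scalingLimit Λ H) (𝓝 2) := by
  obtain ⟨C, hC, h⟩ := tendsto_sq_mul_averageArea hΛ hH hc
  have hs : 0 < H * √Λ := by positivity
  have hl : Tendsto (fun p : ℝ × ℕ => (Real.log p.1)⁻¹) (scalingLimit Λ H) (𝓝 0) :=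
    tendsto_inv_atBot_zero.comp (Real.tendsto_log_nhdsGT_zero.comp (tendsto_fst_scalingLimit Λ H))
  have hA := ((h.log hC.ne').mul hl).const_sub 2
  have hB := (((tendsto_mul_scalingLimit Λ H).log hs.ne').mul hl).const_sub 1
  have hAB := hA.div hB (by norm_num)
  norm_num at hAB
  refine hAB.congr' ?_
  filter_upwards [eventually_pos_scalingLimit Λ H, eventually_two_le_scalingLimit hΛ hH,
    h.eventually_const_lt hC,
    (tendsto_fst_scalingLimit_nhds Λ H).eventually_lt_const one_pos] with p hp h2 hpos h1
  have hlog : Real.log p.1 ≠ 0 := (Real.log_neg hp h1).ne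
  have hA0 : averageArea (1 / 2 * (Real.cosh p.1)⁻¹) (1 - c * p.1) p.2 ≠ 0 := by
    intro h0
    rw [h0, mul_zero] at hpos
    exact hpos.false
  have hp2 : (p.2 : ℝ) ≠ 0 := by positivity
  simp only [Pi.div_apply]
  rw [Real.log_mul (by positivity) hA0, Real.log_mul hp2 hp.ne', Real.log_pow]
  generalize Real.log (averageArea (1 / 2 * (Real.cosh p.1)⁻¹) (1 - c * p.1) p.2) = a
  rw [show 2 - ((2 : ℕ) * Real.log p.1 + a) * (Real.log p.1)⁻¹ = -a / Real.log p.1 by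
      push_cast; field_simp; ring,
    show 1 - (Real.log p.2 + Real.log p.1) * (Real.log p.1)⁻¹ = -Real.log p.2 / Real.log p.1 by
      field_simp; ring, div_div_div_cancel_right₀ hlog, neg_div_neg_eq]

end CausalTriangulation

theorem mainTheorem7 :
    (∀ (h : ℕ) (g θ z : ℂ), 2 ≤ h → g ≠ 0 → ‖g‖ < 1 / 2 → g⁻¹ = 2 * Complex.cosh θ → ‖z‖ < 1 →
      Summable (fun G : CausalTriangulation h => diskWeight g z G) ∧
      Complex.sinh (h * θ) - z * Complex.sinh ((h - 1) * θ) ≠ 0 ∧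
      diskPartition g z h =
        2 * Complex.cosh θ * (z * Complex.sinh θ ^ 2 /
          (Complex.sinh (h * θ) - z * Complex.sinh ((h - 1) * θ)) ^ 2)) ∧
    (∀ (h : ℕ) (g θ x y : ℂ), 2 ≤ h → g ≠ 0 → ‖g‖ < 1 / 2 → g⁻¹ = 2 * Complex.cosh θ →
      ‖x‖ < 1 → ‖y‖ < 1 →
      Summable (fun G : CausalTriangulation h => annulusWeight g x y G) ∧
      Complex.sinh ((h - 1) * θ) - (x + y) * Complex.sinh ((h - 2) * θ)
        + x * y * Complex.sinh ((h - 3) * θ) ≠ 0 ∧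
      annulusPartition g x y h =
        x * y * Complex.sinh θ ^ 2 /
          (Complex.sinh ((h - 1) * θ) - (x + y) * Complex.sinh ((h - 2) * θ)
            + x * y * Complex.sinh ((h - 3) * θ)) ^ 2) ∧
    (∀ Λ H Y : ℝ, 0 < Λ → 0 < H → 0 < Y →
      Tendsto
        (fun p : ℝ × ℕ => diskPartition (1 / 2 * (Real.cosh p.1)⁻¹) (1 - Y * p.1 / √Λ) p.2)
        (scalingLimit Λ H)
        (𝓝 (2 * Λ / (√Λ * Real.cosh (H * √Λ) + Y * Real.sinh (H * √Λ)) ^ 2))) ∧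
    (∀ Λ H X Y : ℝ, 0 < Λ → 0 < H → 0 < X → 0 < Y →
      Tendsto
        (fun p : ℝ × ℕ => p.1 ^ 2 *
          annulusPartition (1 / 2 * (Real.cosh p.1)⁻¹)
            (1 - X * p.1 / √Λ) (1 - Y * p.1 / √Λ) p.2)
        (scalingLimit Λ H)
        (𝓝 (Λ ^ 2 / ((Λ + X * Y) * Real.sinh (√Λ * H)
          + √Λ * (X + Y) * Real.cosh (√Λ * H)) ^ 2)) ∧
      Tendsto
        (fun p : ℝ × ℕ => p.1 ^ 2 / Λ *
          annulusPartition (1 / 2 * (Real.cosh p.1)⁻¹)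
            (1 - X * p.1 / √Λ) (1 - Y * p.1 / √Λ) p.2)
        (scalingLimit Λ H)
        (𝓝 (Λ / ((Λ + X * Y) * Real.sinh (√Λ * H)
          + √Λ * (X + Y) * Real.cosh (√Λ * H)) ^ 2))) ∧
    (∀ Λ H Y : ℝ, 0 < Λ → 0 < H → 0 < Y →
      Tendsto
        (fun p : ℝ × ℕ =>
          Real.log (averageArea (1 / 2 * (Real.cosh p.1)⁻¹) (1 - Y * p.1 / √Λ) p.2) /
            Real.log p.2)
        (scalingLimit Λ H) (𝓝 2)) := by
  refine ⟨fun h g θ z hh hg0 hg hθ hz => ?_, fun h g θ x y hh hg0 hg hθ hx hy => ?_,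
    fun Λ H Y hΛ hH hY => ?_, fun Λ H X Y hΛ hH hX hY => ?_, fun Λ H Y hΛ hH hY => ?_⟩
  · obtain ⟨h1, h2⟩ := CausalTriangulation.hasSum_diskWeight_complex hh hg0 hg hθ hz
    exact ⟨h2.summable, h1, h2.tsum_eq⟩
  · obtain ⟨h1, h2⟩ := CausalTriangulation.hasSum_annulusWeight_complex hh hg0 hg hθ hx hy
    exact ⟨h2.summable, h1, h2.tsum_eq⟩
  · have hq : 0 < √Λ := Real.sqrt_pos.2 hΛ
    have key := CausalTriangulation.tendsto_diskPartition hΛ hH (div_pos hY hq)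
    have e : 2 / (Y / √Λ * Real.sinh (H * √Λ) + Real.cosh (H * √Λ)) ^ 2 =
        2 * Λ / (√Λ * Real.cosh (H * √Λ) + Y * Real.sinh (H * √Λ)) ^ 2 := by
      rw [show Y / √Λ * Real.sinh (H * √Λ) + Real.cosh (H * √Λ) =
        (√Λ * Real.cosh (H * √Λ) + Y * Real.sinh (H * √Λ)) / √Λ by field_simp; ring,
        div_pow, div_div_eq_mul_div, Real.sq_sqrt hΛ.le]
    rw [e] at key
    simpa only [div_mul_eq_mul_div Y] using key
  · have hq : 0 < √Λ := Real.sqrt_pos.2 hΛ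
    have key := CausalTriangulation.tendsto_annulusPartition hΛ hH (div_pos hX hq) (div_pos hY hq)
    have e : 1 / ((X / √Λ * (Y / √Λ) + 1) * Real.sinh (H * √Λ) +
        (X / √Λ + Y / √Λ) * Real.cosh (H * √Λ)) ^ 2 =
        Λ ^ 2 / ((Λ + X * Y) * Real.sinh (√Λ * H) + √Λ * (X + Y) * Real.cosh (√Λ * H)) ^ 2 := by
      rw [mul_comm H, show (X / √Λ * (Y / √Λ) + 1) * Real.sinh (√Λ * H) +
        (X / √Λ + Y / √Λ) * Real.cosh (√Λ * H) = ((√Λ ^ 2 + X * Y) * Real.sinh (√Λ * H) +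
          √Λ * (X + Y) * Real.cosh (√Λ * H)) / √Λ ^ 2 by field_simp; ring,
        Real.sq_sqrt hΛ.le, div_pow, one_div_div]
    rw [e] at key
    simp only [div_mul_eq_mul_div X, div_mul_eq_mul_div Y] at key
    refine ⟨key, ?_⟩
    have key' := key.div_const Λ
    rw [pow_two Λ, mul_div_assoc Λ Λ, mul_div_cancel_left₀ _ hΛ.ne'] at key'
    exact key'.congr fun p => by rw [mul_div_right_comm]
  · have key := CausalTriangulation.tendsto_log_averageArea_div_log hΛ hH
      (div_pos hY (Real.sqrt_pos.2 hΛ))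
    simpa only [div_mul_eq_mul_div Y] using key
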